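/- All algebras are unital associative $\mathbb{C}$-algebras. For a $\mathbb{Z}$-graded algebra $\Lambda_\bullet$ put $[x,y]=xy-(-1)^{ab}yx$ for $x\in\Lambda_a$, $y\in\Lambda_b$, extended bilinearly, let $\Lambda_k^{\mathrm{Lie}}$ be the span of all $[x_1,[x_2,\dots,[x_{k-1},x_k]\dots]]$, and let $$F^d\Lambda=\sum_{m\ge 0}\ \sum_{i_1+\dots+i_m=m+d}\Lambda\cdot\Lambda_{i_1}^{\mathrm{Lie}}\cdot\Lambda\cdots\Lambda_{i_m}^{\mathrm{Lie}}\cdot\Lambda$$ (the graded NC filtration by two-sided ideals). An ungraded algebra is regarded as concentrated in degree $0$. Put $\Lambda^{\le d}=\Lambda/F^{d+1}\Lambda$ and $\Lambda^{ab}=\Lambda/F^1\Lambda$, and let $\mathrm{gr}_F(\Lambda)=\bigoplus_{d\ge0}F^d\Lambda/F^{d+1}\Lambda$, bigraded by the filtration degree $d$ and the degree $e$ coming from $\Lambda_\bullet$. An ungraded algebra $R$ is *NC nilpotent of degree $d$* if $F^{d+1}R=0$, and *NC complete* if $R\to\varprojlim_d R^{\le d}$ is an isomorphism. An algebra $R$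 that is NC nilpotent of degree $d$ is *$d$-smooth* if $R^{ab}$ is a finitely generated $\mathbb{C}$-algebra, each $F^jR/F^{j+1}R$ is a finitely generated $R^{ab}$-module, and for every surjection $R_1\to R_2$ of algebras that are NC nilpotent of degree $d$ whose kernel $J$ is central in $R_1$ with $J^2=0$, every homomorphism $R\to R_2$ lifts to a homomorphism $R\to R_1$. An NC complete algebra $R$ is *smooth* if $R^{\le d}$ is $d$-smooth for all $d\ge 0$. A *bigraded Poisson algebra* is a bigraded algebra $P=\bigoplus_{d\ge0,\,e\in\mathbb{Z}}P^d_e$, super commutative with respect to $e$, with a bilinear bracket $\{\,,\}\colon P^d_e\times P^{d'}_{e'}\to P^{d+d'+1}_{e+e'}$ that is super anti-symmetric, satisfies the super Jacobi identity, and is such that $\{x,-\}$ is a super derivation for every $x$ (signs with respect to $e$). The product and the super commutator of $\Lambda$ induce such a structure on $\mathrm{gr}_F(\Lambda)$. For a super commutative graded algebra $A_\bullet$, the *graded Poisson envelope* $P(A)$ is the value at $A$ of the left adjoint of the functor forgetting the bracket: the free graded Poisson algebra on the graded vector space $A$ modulo the Poisson ideal that identifies the formal products of elements of $A$ (and the unit)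 with those in $A$. The degree $d$ on $P(A)$ counts brackets, and $e$ is induced by the grading of $A$. **Lemma.** Let $R$ be a smooth (not necessarily commutative) algebra, let $W_\bullet$ be a finite dimensional graded vector space, and let $\Lambda_\bullet=R\ast T(W_\bullet)$ (the free product of $\mathbb{C}$-algebras), graded by placing $R$ in degree $0$ and using the grading of $W_\bullet$. Then there is an isomorphism of bigraded Poisson algebras $$P(\Lambda^{ab}_\bullet)^\bullet_\bullet\ \xrightarrow{\ \cong\ }\ \mathrm{gr}_F(\Lambda_\bullet)^\bullet_\bullet,$$ and exactly one whose restriction along $\Lambda^{ab}\to P(\Lambda^{ab})^0$ is the identification $\Lambda^{ab}=\mathrm{gr}_F(\Lambda)^0$. -/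

import Mathlib

open scoped DirectSum

universe u

namespace NCPoisson

/-- The sign `(-1)^{ab}` of the super sign rule. -/
noncomputable def sgn (a b : ℤ) : ℂ := (-1 : ℂ) ^ (a * b)

lemma sgn_add_left (a b c : ℤ) : sgn (a + b) c = sgn a c * sgn b c := by
  simp only [sgn, add_mul]
  exact zpow_add₀ (by norm_num) _ _

lemma sgn_add_right (a b c : ℤ) : sgn a (b + c) = sgn a b * sgn a c := by
  simp only [sgn, mul_add]
  exact zpow_add₀ (by norm_num) _ _

lemma sgn_comm (a b : ℤ) : sgn a b = sgn b a := by simp only [sgn, mul_comm]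

@[simp] lemma sgn_zero_left (b : ℤ) : sgn 0 b = 1 := by simp [sgn]

@[simp] lemma sgn_zero_right (b : ℤ) : sgn b 0 = 1 := by simp [sgn]

lemma sgn_mul_self (a b : ℤ) : sgn a b * sgn a b = 1 := by
  simp only [sgn, ← mul_zpow]
  norm_num

lemma sgn_eq (a b : ℤ) : sgn a b = 1 ∨ sgn a b = -1 :=
  mul_self_eq_one_iff.1 (sgn_mul_self a b)

/-! ### The graded NC filtration -/

section Filtration

/-- `IsLieMonomial 𝒜 k e x`: the element `x` is an iterated super commutator
`[x₁, [x₂, …, [x_{k-1}, x_k]…]]` of `k` homogeneous elements of total degree `e`,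
where `[x, y] = x y - (-1)^{ab} y x` for `x` of degree `a` and `y` of degree `b`. -/
inductive IsLieMonomial {Λ : Type u} [Ring Λ] [Algebra ℂ Λ] (𝒜 : ℤ → Submodule ℂ Λ) :
    ℕ → ℤ → Λ → Prop
  | base {e : ℤ} {x : Λ} (hx : x ∈ 𝒜 e) : IsLieMonomial 𝒜 1 e x
  | step {k : ℕ} {a b : ℤ} {x y : Λ} (hx : x ∈ 𝒜 a) (hy : IsLieMonomial 𝒜 k b y) :
      IsLieMonomial 𝒜 (k + 1) (a + b) (x * y - sgn a b • (y * x))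

/-- The span `Λ_k^{Lie}` of all `k`-fold iterated super commutators (zero for `k = 0`). -/
def lieSpan {Λ : Type u} [Ring Λ] [Algebra ℂ Λ] (𝒜 : ℤ → Submodule ℂ Λ) (k : ℕ) :
    Submodule ℂ Λ :=
  Submodule.span ℂ {x | ∃ e, IsLieMonomial 𝒜 k e x}

/-- The `d`-th step `F^d Λ` of the graded NC filtration: the sum over all `m ≥ 0` and all
`(i₁, …, i_m)` with `i₁ + ⋯ + i_m = m + d` of
`Λ · Λ_{i₁}^{Lie} · Λ · ⋯ · Λ_{i_m}^{Lie} · Λ` (products of subspaces). -/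
def ncFiltration {Λ : Type u} [Ring Λ] [Algebra ℂ Λ] (𝒜 : ℤ → Submodule ℂ Λ) (d : ℕ) :
    Submodule ℂ Λ :=
  ⨆ l : {l : List ℕ // l.sum = l.length + d},
    ⊤ * (l.1.map fun i => lieSpan 𝒜 i * (⊤ : Submodule ℂ Λ)).prod

lemma top_mul_top' {Λ : Type u} [Ring Λ] [Algebra ℂ Λ] :
    (⊤ : Submodule ℂ Λ) * ⊤ = ⊤ := by
  refine top_le_iff.1 fun x _ => ?_
  simpa using Submodule.mul_mem_mul (Submodule.mem_top (x := x)) (Submodule.mem_top (x := (1 : Λ)))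

lemma ncFiltration_left {Λ : Type u} [Ring Λ] [Algebra ℂ Λ] (𝒜 : ℤ → Submodule ℂ Λ) (d : ℕ)
    (a : Λ) {x : Λ} (hx : x ∈ ncFiltration 𝒜 d) : a * x ∈ ncFiltration 𝒜 d := by
  have h : (⊤ : Submodule ℂ Λ) * ncFiltration 𝒜 d ≤ ncFiltration 𝒜 d := by
    unfold ncFiltration
    rw [Submodule.mul_iSup]
    refine iSup_mono fun l => ?_
    rw [← mul_assoc, top_mul_top']
  exact h (Submodule.mul_mem_mul Submodule.mem_top hx)

lemma ncFiltration_right {Λ : Type u} [Ring Λ] [Algebra ℂ Λ] (𝒜 : ℤ → Submodule ℂ Λ) (d : ℕ)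
    (a : Λ) {x : Λ} (hx : x ∈ ncFiltration 𝒜 d) : x * a ∈ ncFiltration 𝒜 d := by
  have h : ncFiltration 𝒜 d * (⊤ : Submodule ℂ Λ) ≤ ncFiltration 𝒜 d := by
    unfold ncFiltration
    rw [Submodule.iSup_mul]
    refine iSup_mono fun l => ?_
    rcases List.eq_nil_or_concat l.1 with h | ⟨L, i, h⟩
    · simp [h, top_mul_top']
    · simp only [h, List.map_append, List.prod_append, List.map_cons, List.map_nil,
        List.prod_cons, List.prod_nil, mul_one, mul_assoc, top_mul_top', le_refl,
        List.concat_eq_append]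
  exact h (Submodule.mul_mem_mul hx Submodule.mem_top)

/-- `F^d Λ` as an ideal of `Λ`; it is two-sided. -/
def ncIdeal {Λ : Type u} [Ring Λ] [Algebra ℂ Λ] (𝒜 : ℤ → Submodule ℂ Λ) (d : ℕ) : Ideal Λ where
  carrier := ncFiltration 𝒜 d
  add_mem' := fun ha hb => (ncFiltration 𝒜 d).add_mem ha hb
  zero_mem' := (ncFiltration 𝒜 d).zero_mem
  smul_mem' := fun a _ hx => ncFiltration_left 𝒜 d a hx

instance {Λ : Type u} [Ring Λ] [Algebra ℂ Λ] (𝒜 : ℤ → Submodule ℂ Λ) (d : ℕ) :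
    (ncIdeal 𝒜 d).IsTwoSided :=
  ⟨fun a hx => ncFiltration_right 𝒜 d a hx⟩

end Filtration

/-! ### Smooth NC algebras -/

section Smooth

/-- An ungraded algebra viewed as a graded algebra concentrated in degree `0`. For it the super
commutators are the ordinary commutators. -/
def trivialGrading (R : Type u) [Ring R] [Algebra ℂ R] (e : ℤ) : Submodule ℂ R :=
  if e = 0 then ⊤ else ⊥

/-- The NC filtration `F^d R` of an ungraded algebra, as a two-sided ideal. -/
abbrev ncF (R : Type u) [Ring R] [Algebra ℂ R] (d : ℕ) : Ideal R := ncIdeal (trivialGrading R) d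

/-- `R^{≤ d} = R / F^{d+1} R`. In particular `R^{ab} = R^{≤ 0}`. -/
abbrev Trunc (R : Type u) [Ring R] [Algebra ℂ R] (d : ℕ) : Type u := R ⧸ ncF R (d + 1)

/-- `R` is NC nilpotent of degree `d`. -/
def IsNCNilpotent (d : ℕ) (R : Type u) [Ring R] [Algebra ℂ R] : Prop := ncF R (d + 1) = ⊥

/-- `R` is NC complete: `R → lim R^{≤ d}` is injective and surjective. An element of the limit
is represented by a sequence `s` in `R` with `s (d + 1) ≡ s d` modulo `F^{d+1} R`. -/
def IsNCComplete (R : Type u) [Ring R] [Algebra ℂ R] : Prop :=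
  (∀ x : R, (∀ d, x ∈ ncF R (d + 1)) → x = 0) ∧
  ∀ s : ℕ → R, (∀ d, s (d + 1) - s d ∈ ncF R (d + 1)) → ∃ x : R, ∀ d, x - s d ∈ ncF R (d + 1)

/-- Finite type: `R^{ab}` is a finitely generated `ℂ`-algebra and each `gr_F^d R` is a finitely
generated `R^{ab}`-module; the action of `R` on `gr_F^d R` factors through `R^{ab}`, so that
finite generation over `R` and over `R^{ab}` are the same. -/
def IsNCFiniteType (R : Type u) [Ring R] [Algebra ℂ R] : Prop :=
  Algebra.FiniteType ℂ (Trunc R 0) ∧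
  ∀ d, Module.Finite R (ncF R d ⧸ (ncF R (d + 1)).submoduleOf (ncF R d))

/-- `d`-smooth algebras: NC nilpotent of degree `d`, of finite type, and with the lifting
property for central extensions of algebras that are NC nilpotent of degree `d`. -/
def IsDSmooth (d : ℕ) (R : Type u) [Ring R] [Algebra ℂ R] : Prop :=
  IsNCNilpotent d R ∧ IsNCFiniteType R ∧
  ∀ (R₁ R₂ : Type u) [Ring R₁] [Ring R₂] [Algebra ℂ R₁] [Algebra ℂ R₂] (f : R₁ →ₐ[ℂ] R₂),
    IsNCNilpotent d R₁ → IsNCNilpotent d R₂ → Function.Surjective f →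
    (∀ x y : R₁, f x = 0 → f y = 0 → x * y = 0) →
    (∀ x y : R₁, f x = 0 → x * y = y * x) →
    ∀ g : R →ₐ[ℂ] R₂, ∃ h : R →ₐ[ℂ] R₁, f.comp h = g

/-- Smooth algebras: NC complete, with `R^{≤ d}` being `d`-smooth for every `d`. -/
def IsSmooth (R : Type u) [Ring R] [Algebra ℂ R] : Prop :=
  IsNCComplete R ∧ ∀ d, IsDSmooth d (Trunc R d)

end Smooth

/-! ### Bigraded Poisson algebras -/

section Poisson

/-- The inclusion of a homogeneous piece into the total space of a bigraded vector space. -/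
noncomputable def inc (M : ℕ → ℤ → Type u) [∀ d e, AddCommGroup (M d e)]
    [∀ d e, Module ℂ (M d e)] (d : ℕ) (e : ℤ) :
    M d e →ₗ[ℂ] ⨁ i : ℕ × ℤ, M i.1 i.2 :=
  DirectSum.lof ℂ (ℕ × ℤ) (fun i => M i.1 i.2) (d, e)

/-- A bigraded Poisson algebra `P = ⨁ P^d_e`, given by its homogeneous pieces `P^d_e`, the unit
and the restrictions of the product and of the bracket to the pieces. Signs follow the lower
degree `e`; the product preserves the upper degree `d` and the bracket raises it by one. The
axioms are equalities in the total space `⨁ P^d_e`. -/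
structure BigradedPoissonAlgebra : Type (u + 1) where
  /-- the piece `P^d_e` -/
  obj : ℕ → ℤ → Type u
  [acg : ∀ d e, AddCommGroup (obj d e)]
  [mod : ∀ d e, Module ℂ (obj d e)]
  one : obj 0 0
  mul : ∀ d e d' e', obj d e →ₗ[ℂ] obj d' e' →ₗ[ℂ] obj (d + d') (e + e')
  bracket : ∀ d e d' e', obj d e →ₗ[ℂ] obj d' e' →ₗ[ℂ] obj (d + d' + 1) (e + e')
  one_mul : ∀ d e (x : obj d e), inc obj _ _ (mul _ _ _ _ one x) = inc obj _ _ x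
  mul_assoc : ∀ d e d' e' d'' e'' (x : obj d e) (y : obj d' e') (z : obj d'' e''),
    inc obj _ _ (mul _ _ _ _ (mul _ _ _ _ x y) z) =
      inc obj _ _ (mul _ _ _ _ x (mul _ _ _ _ y z))
  /-- super commutativity: `x y = (-1)^{e e'} y x` -/
  mul_comm : ∀ d e d' e' (x : obj d e) (y : obj d' e'),
    inc obj _ _ (mul _ _ _ _ x y) = sgn e e' • inc obj _ _ (mul _ _ _ _ y x)
  /-- super anti-symmetry: `{x, y} = - (-1)^{e e'} {y, x}` -/
  bracket_antisymm : ∀ d e d' e' (x : obj d e) (y : obj d' e'),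
    inc obj _ _ (bracket _ _ _ _ x y) = -sgn e e' • inc obj _ _ (bracket _ _ _ _ y x)
  /-- super Jacobi identity: `{x, {y, z}} = {{x, y}, z} + (-1)^{e e'} {y, {x, z}}` -/
  jacobi : ∀ d e d' e' d'' e'' (x : obj d e) (y : obj d' e') (z : obj d'' e''),
    inc obj _ _ (bracket _ _ _ _ x (bracket _ _ _ _ y z)) =
      inc obj _ _ (bracket _ _ _ _ (bracket _ _ _ _ x y) z) +
        sgn e e' • inc obj _ _ (bracket _ _ _ _ y (bracket _ _ _ _ x z))
  /-- `{x, -}` is a super derivation: `{x, y z} = {x, y} z + (-1)^{e e'} y {x, z}` -/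
  leibniz : ∀ d e d' e' d'' e'' (x : obj d e) (y : obj d' e') (z : obj d'' e''),
    inc obj _ _ (bracket _ _ _ _ x (mul _ _ _ _ y z)) =
      inc obj _ _ (mul _ _ _ _ (bracket _ _ _ _ x y) z) +
        sgn e e' • inc obj _ _ (mul _ _ _ _ y (bracket _ _ _ _ x z))

attribute [instance] BigradedPoissonAlgebra.acg BigradedPoissonAlgebra.mod

/-- Isomorphisms of bigraded Poisson algebras. -/
structure BigradedPoissonIso (P Q : BigradedPoissonAlgebra.{u}) where
  toEquiv : ∀ d e, P.obj d e ≃ₗ[ℂ] Q.obj d e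
  map_one : toEquiv 0 0 P.one = Q.one
  map_mul : ∀ d e d' e' (x : P.obj d e) (y : P.obj d' e'),
    toEquiv _ _ (P.mul _ _ _ _ x y) = Q.mul _ _ _ _ (toEquiv _ _ x) (toEquiv _ _ y)
  map_bracket : ∀ d e d' e' (x : P.obj d e) (y : P.obj d' e'),
    toEquiv _ _ (P.bracket _ _ _ _ x y) = Q.bracket _ _ _ _ (toEquiv _ _ x) (toEquiv _ _ y)

end Poisson

/-! ### Subquotients -/

section SubQuotient

/-- The subquotient `S / (S ∩ K)`. -/
abbrev SubQ {N : Type u} [AddCommGroup N] [Module ℂ N] (S K : Submodule ℂ N) : Type u :=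
  S ⧸ K.submoduleOf S

/-- The class of an element of `S` in `S / (S ∩ K)`. -/
def SubQ.mk {N : Type u} [AddCommGroup N] [Module ℂ N] {S : Submodule ℂ N} (K : Submodule ℂ N)
    (x : S) : SubQ S K := Submodule.Quotient.mk x

/-- The bilinear map induced on subquotients by a bilinear map. -/
def SubQ.map₂ {N : Type u} [AddCommGroup N] [Module ℂ N] (B : N →ₗ[ℂ] N →ₗ[ℂ] N)
    (S₁ K₁ S₂ K₂ S₃ K₃ : Submodule ℂ N)
    (h : ∀ x ∈ S₁, ∀ y ∈ S₂, B x y ∈ S₃)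
    (h₁ : ∀ x ∈ S₁, x ∈ K₁ → ∀ y ∈ S₂, B x y ∈ K₃)
    (h₂ : ∀ x ∈ S₁, ∀ y ∈ S₂, y ∈ K₂ → B x y ∈ K₃) :
    SubQ S₁ K₁ →ₗ[ℂ] SubQ S₂ K₂ →ₗ[ℂ] SubQ S₃ K₃ :=
  Submodule.liftQ _
    (LinearMap.mk₂ ℂ (fun x : S₁ => fun y : SubQ S₂ K₂ =>
      Submodule.liftQ _
        ((Submodule.mkQ (K₃.submoduleOf S₃)).comp
          (((B x.1).comp S₂.subtype).codRestrict S₃ fun y => h x.1 x.2 y.1 y.2))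
        (fun y hy => by
          rw [LinearMap.mem_ker, LinearMap.comp_apply, Submodule.mkQ_apply,
            Submodule.Quotient.mk_eq_zero]
          exact h₂ x.1 x.2 y.1 y.2 hy) y)
      (fun x x' y => by
        obtain ⟨y, rfl⟩ := Submodule.Quotient.mk_surjective _ y
        simp only [Submodule.liftQ_apply, LinearMap.comp_apply, ← map_add]
        congr 1
        ext
        exact LinearMap.congr_fun (map_add B x.1 x'.1) y.1)
      (fun c x y => by
        obtain ⟨y, rfl⟩ := Submodule.Quotient.mk_surjective _ y
        simp only [Submodule.liftQ_apply, LinearMap.comp_apply, ← map_smul]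
        congr 1
        ext
        exact (LinearMap.congr_fun (map_smul B c x.1) y.1).trans (map_smul (B x.1) c y.1).symm)
      (fun x y y' => map_add _ y y')
      (fun c x y => map_smul _ c y))
    (fun x hx => by
      rw [LinearMap.mem_ker]
      refine LinearMap.ext fun y => ?_
      obtain ⟨y, rfl⟩ := Submodule.Quotient.mk_surjective _ y
      change Submodule.Quotient.mk _ = (0 : SubQ S₃ K₃)
      rw [Submodule.Quotient.mk_eq_zero]
      exact h₁ x.1 x.2 hx y.1 y.2)

lemma SubQ.map₂_mk {N : Type u} [AddCommGroup N] [Module ℂ N] {B : N →ₗ[ℂ] N →ₗ[ℂ] N}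
    {S₁ K₁ S₂ K₂ S₃ K₃ : Submodule ℂ N}
    (h : ∀ x ∈ S₁, ∀ y ∈ S₂, B x y ∈ S₃)
    (h₁ : ∀ x ∈ S₁, x ∈ K₁ → ∀ y ∈ S₂, B x y ∈ K₃)
    (h₂ : ∀ x ∈ S₁, ∀ y ∈ S₂, y ∈ K₂ → B x y ∈ K₃) (x : S₁) (y : S₂) :
    SubQ.map₂ B S₁ K₁ S₂ K₂ S₃ K₃ h h₁ h₂ (SubQ.mk K₁ x) (SubQ.mk K₂ y) =
      SubQ.mk K₃ ⟨B x.1 y.1, h x.1 x.2 y.1 y.2⟩ := rfl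

lemma mem_of_eq_zero {N : Type u} [AddCommGroup N] [Module ℂ N] {K : Submodule ℂ N} {x : N}
    (h : x = 0) : x ∈ K := h ▸ K.zero_mem

lemma inc_eq_smul {N : Type u} [AddCommGroup N] [Module ℂ N] (S K : ℕ → ℤ → Submodule ℂ N)
    {d d' : ℕ} {e e' : ℤ} (hd : d = d') (he : e = e') (c : ℂ) (x : S d e) (y : S d' e')
    (h : x.1 - c • y.1 ∈ K d e) :
    inc (fun d e => SubQ (S d e) (K d e)) d e (SubQ.mk _ x) =
      c • inc (fun d e => SubQ (S d e) (K d e)) d' e' (SubQ.mk _ y) := by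
  subst hd he
  rw [← map_smul]
  congr 1
  exact (Submodule.Quotient.eq _).2 h

lemma inc_eq {N : Type u} [AddCommGroup N] [Module ℂ N] (S K : ℕ → ℤ → Submodule ℂ N)
    {d d' : ℕ} {e e' : ℤ} (hd : d = d') (he : e = e') (x : S d e) (y : S d' e')
    (h : x.1 - y.1 ∈ K d e) :
    inc (fun d e => SubQ (S d e) (K d e)) d e (SubQ.mk _ x) =
      inc (fun d e => SubQ (S d e) (K d e)) d' e' (SubQ.mk _ y) := by
  subst hd he
  congr 1
  exact (Submodule.Quotient.eq _).2 h

lemma inc_eq_add_smul {N : Type u} [AddCommGroup N] [Module ℂ N] (S K : ℕ → ℤ → Submodule ℂ N)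
    {d d' d'' : ℕ} {e e' e'' : ℤ} (hd : d = d') (he : e = e') (hd' : d = d'') (he' : e = e'')
    (c : ℂ) (x : S d e) (y : S d' e') (z : S d'' e'')
    (h : x.1 - (y.1 + c • z.1) ∈ K d e) :
    inc (fun d e => SubQ (S d e) (K d e)) d e (SubQ.mk _ x) =
      inc (fun d e => SubQ (S d e) (K d e)) d' e' (SubQ.mk _ y) +
      c • inc (fun d e => SubQ (S d e) (K d e)) d'' e'' (SubQ.mk _ z) := by
  subst hd he hd' he'
  rw [← map_smul, ← map_add]
  congr 1
  exact (Submodule.Quotient.eq _).2 h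

end SubQuotient

/-! ### The associated graded Poisson algebra of the NC filtration -/

section Graded

/-- Products of homogeneous elements and Lie monomials; they span the steps of the filtration. -/
inductive IsNCMonomial {Λ : Type u} [Ring Λ] [Algebra ℂ Λ] (𝒜 : ℤ → Submodule ℂ Λ) :
    ℕ → ℤ → Λ → Prop
  | base {e : ℤ} {x : Λ} (hx : x ∈ 𝒜 e) : IsNCMonomial 𝒜 0 e x
  | step {d k : ℕ} {e a b : ℤ} {x l y : Λ} (hx : IsNCMonomial 𝒜 d e x)
      (hl : IsLieMonomial 𝒜 (k + 1) a l) (hy : y ∈ 𝒜 b) :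
      IsNCMonomial 𝒜 (d + k) (e + a + b) (x * l * y)

variable {Λ : Type u} [Ring Λ] [Algebra ℂ Λ] (𝒜 : ℤ → Submodule ℂ Λ)

/-- The span of the Lie monomials of a given length and degree. -/
def lieSp (k : ℕ) (e : ℤ) : Submodule ℂ Λ := Submodule.span ℂ {x | IsLieMonomial 𝒜 k e x}

/-- The span of the NC monomials of a given bidegree. -/
def ncSp (d : ℕ) (e : ℤ) : Submodule ℂ Λ := Submodule.span ℂ {x | IsNCMonomial 𝒜 d e x}

variable {𝒜}

lemma lieSp_cast {k k' : ℕ} {e e' : ℤ} {x : Λ} (h : x ∈ lieSp 𝒜 k e) (hk : k = k')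
    (he : e = e') : x ∈ lieSp 𝒜 k' e' := by subst hk he; exact h

lemma ncSp_cast {k k' : ℕ} {e e' : ℤ} {x : Λ} (h : x ∈ ncSp 𝒜 k e) (hk : k = k')
    (he : e = e') : x ∈ ncSp 𝒜 k' e' := by subst hk he; exact h

lemma IsNCMonomial.cast {k k' : ℕ} {e e' : ℤ} {x x' : Λ} (h : IsNCMonomial 𝒜 k e x) (hk : k = k')
    (he : e = e') (hx : x = x') : IsNCMonomial 𝒜 k' e' x' := by subst hk he hx; exact h

lemma IsLieMonomial.pos {k : ℕ} {e : ℤ} {x : Λ} (h : IsLieMonomial 𝒜 k e x) : 0 < k := by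
  cases h <;> omega

lemma lieSpan_zero : lieSpan 𝒜 0 = ⊥ := by
  rw [lieSpan, Submodule.span_eq_bot]
  rintro x ⟨e, h⟩
  exact absurd h.pos (lt_irrefl _)

lemma mem_ncSp_of_mem {e : ℤ} {x : Λ} (hx : x ∈ 𝒜 e) : x ∈ ncSp 𝒜 0 e :=
  Submodule.subset_span (IsNCMonomial.base hx)

lemma bracket_left_lieSp {k : ℕ} {a b : ℤ} {x y : Λ} (hx : x ∈ 𝒜 a) (hy : y ∈ lieSp 𝒜 k b) :
    x * y - sgn a b • (y * x) ∈ lieSp 𝒜 (k + 1) (a + b) := by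
  induction hy using Submodule.span_induction with
  | mem y h => exact Submodule.subset_span (IsLieMonomial.step hx h)
  | zero => simp
  | add y z _ _ hy hz =>
    convert Submodule.add_mem _ hy hz using 1
    simp only [mul_add, add_mul]; module
  | smul c y _ hy =>
    convert Submodule.smul_mem _ c hy using 1
    simp only [mul_smul_comm, smul_mul_assoc]; module

lemma bracket_lieSp {k l : ℕ} {a b : ℤ} {x y : Λ} (hx : IsLieMonomial 𝒜 k a x)
    (hy : y ∈ lieSp 𝒜 l b) : x * y - sgn a b • (y * x) ∈ lieSp 𝒜 (k + l) (a + b) := by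
  induction hx generalizing y l b with
  | base hx => exact lieSp_cast (bracket_left_lieSp hx hy) (by omega) rfl
  | @step k a a' x z hx hz ih =>
    have h1 := lieSp_cast (bracket_left_lieSp hx (ih hy)) (k' := k + 1 + l) (by omega)
      (add_assoc a a' b).symm
    have h2 := lieSp_cast (ih (bracket_left_lieSp hx hy)) (k' := k + 1 + l)
      (e' := a + a' + b) (by omega) (by ring)
    convert Submodule.sub_mem _ h1 (Submodule.smul_mem _ (sgn a a') h2) using 1
    simp only [mul_sub, sub_mul, mul_smul_comm, smul_mul_assoc, mul_assoc, sgn_add_left,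
      sgn_add_right, smul_sub, smul_smul]
    rw [sgn_comm a' a]
    rcases sgn_eq a a' with h | h <;> rw [h] <;> module

variable [GradedAlgebra 𝒜]

lemma IsLieMonomial.mem {k : ℕ} {e : ℤ} {x : Λ} (h : IsLieMonomial 𝒜 k e x) : x ∈ 𝒜 e := by
  induction h with
  | base hx => exact hx
  | @step k a b x y hx hy ih =>
    refine Submodule.sub_mem _ (SetLike.mul_mem_graded hx ih) (Submodule.smul_mem _ _ ?_)
    rw [add_comm]
    exact SetLike.mul_mem_graded ih hx

lemma IsNCMonomial.mem {k : ℕ} {e : ℤ} {x : Λ} (h : IsNCMonomial 𝒜 k e x) : x ∈ 𝒜 e := by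
  induction h with
  | base hx => exact hx
  | step hx hl hy ih => exact SetLike.mul_mem_graded (SetLike.mul_mem_graded ih hl.mem) hy

lemma IsNCMonomial.mul {d d' : ℕ} {e e' : ℤ} {x y : Λ} (hx : IsNCMonomial 𝒜 d e x)
    (hy : IsNCMonomial 𝒜 d' e' y) : IsNCMonomial 𝒜 (d + d') (e + e') (x * y) := by
  induction hy with
  | base hy =>
    cases hx with
    | base hx => exact .base (SetLike.mul_mem_graded hx hy)
    | step hx hl hz =>
      exact (IsNCMonomial.step hx hl (SetLike.mul_mem_graded hz hy)).cast (by omega) (by ring)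
        (by simp only [mul_assoc])
  | step hx hl hy ih =>
    exact (IsNCMonomial.step ih hl hy).cast (by omega) (by ring) (by simp only [mul_assoc])

lemma IsLieMonomial.toNC {k : ℕ} {e : ℤ} {x : Λ} (h : IsLieMonomial 𝒜 (k + 1) e x) :
    IsNCMonomial 𝒜 k e x :=
  (IsNCMonomial.step (.base (SetLike.one_mem_graded 𝒜)) h (SetLike.one_mem_graded 𝒜)).cast
    (by omega) (by ring) (by simp)

lemma lieSp_le_ncSp (k : ℕ) (e : ℤ) : lieSp 𝒜 (k + 1) e ≤ ncSp 𝒜 k e :=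
  Submodule.span_mono fun _ h => IsLieMonomial.toNC h

lemma mem_ncSp_mul {d d' : ℕ} {e e' : ℤ} {x y : Λ} (hx : x ∈ ncSp 𝒜 d e)
    (hy : y ∈ ncSp 𝒜 d' e') : x * y ∈ ncSp 𝒜 (d + d') (e + e') := by
  have h := Submodule.mul_mem_mul hx hy
  rw [ncSp, ncSp, Submodule.span_mul_span] at h
  refine Submodule.span_mono ?_ h
  rintro _ ⟨a, ha, b, hb, rfl⟩
  exact IsNCMonomial.mul ha hb

lemma top_eq_span : (⊤ : Submodule ℂ Λ) = Submodule.span ℂ {x | ∃ e, x ∈ 𝒜 e} := by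
  refine (top_le_iff.1 fun x _ => ?_).symm
  induction x using DirectSum.Decomposition.inductionOn 𝒜 with
  | zero => exact Submodule.zero_mem _
  | homogeneous m => exact Submodule.subset_span ⟨_, m.2⟩
  | add _ _ h h' => exact Submodule.add_mem _ (h trivial) (h' trivial)

lemma ncFiltration_eq_span (d : ℕ) :
    ncFiltration 𝒜 d = Submodule.span ℂ {x | ∃ e, IsNCMonomial 𝒜 d e x} := by
  apply le_antisymm
  · have key : ∀ l : List ℕ,
        ⊤ * (l.map fun i => lieSpan 𝒜 i * (⊤ : Submodule ℂ Λ)).prod = ⊥ ∨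
        ∃ d, l.sum = l.length + d ∧
          ⊤ * (l.map fun i => lieSpan 𝒜 i * (⊤ : Submodule ℂ Λ)).prod ≤
            Submodule.span ℂ {x | ∃ e, IsNCMonomial 𝒜 d e x} := by
      intro l
      induction l using List.reverseRecOn with
      | nil =>
        refine Or.inr ⟨0, by simp, ?_⟩
        simp only [List.map_nil, List.prod_nil, mul_one]
        rw [top_eq_span (𝒜 := 𝒜)]
        exact Submodule.span_mono fun x ⟨e, hx⟩ => ⟨e, .base hx⟩
      | append_singleton L i ih =>
        simp only [List.map_append, List.prod_append, List.map_cons, List.map_nil,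
          List.prod_cons, List.prod_nil, mul_one, ← mul_assoc ⊤]
        rcases ih with ih | ⟨d, hd, ih⟩
        · left; rw [ih, Submodule.bot_mul]
        · rcases i with _ | i
          · left; rw [lieSpan_zero, Submodule.bot_mul, Submodule.mul_bot]
          · right
            refine ⟨d + i, by simp; omega, (mul_le_mul' ih le_rfl).trans ?_⟩
            rw [lieSpan, top_eq_span (𝒜 := 𝒜), Submodule.span_mul_span, Submodule.span_mul_span]
            refine Submodule.span_mono ?_
            rintro _ ⟨x, ⟨e, hx⟩, _, ⟨l, ⟨a, hl⟩, y, ⟨b, hy⟩, rfl⟩, rfl⟩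
            exact ⟨_, (IsNCMonomial.step hx hl hy).cast rfl rfl (by simp only [mul_assoc])⟩
    refine iSup_le fun l => ?_
    rcases key l.1 with h | ⟨d', hd', h⟩
    · rw [h]; exact bot_le
    · obtain rfl : d' = d := by have := l.2; omega
      exact h
  · rw [Submodule.span_le]
    rintro x ⟨e, hx⟩
    have key : ∃ l : List ℕ, l.sum = l.length + d ∧
        x ∈ ⊤ * (l.map fun i => lieSpan 𝒜 i * (⊤ : Submodule ℂ Λ)).prod := by
      induction hx with
      | base hx => exact ⟨[], by simp, by simp⟩
      | @step d k e a b x m y hx hl hy ih =>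
        obtain ⟨l, h, ih⟩ := ih
        refine ⟨l ++ [k + 1], by simp; omega, ?_⟩
        simp only [List.map_append, List.prod_append, List.map_cons, List.map_nil,
          List.prod_cons, List.prod_nil, mul_one]
        rw [← mul_assoc, mul_assoc x]
        exact Submodule.mul_mem_mul ih (Submodule.mul_mem_mul (Submodule.subset_span ⟨_, hl⟩)
          Submodule.mem_top)
    obtain ⟨l, h, hl⟩ := key
    exact Submodule.mem_iSup_of_mem ⟨l, h⟩ hl

lemma ncFiltration_inf (d : ℕ) (e : ℤ) : ncFiltration 𝒜 d ⊓ 𝒜 e = ncSp 𝒜 d e := by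
  apply le_antisymm
  · rintro x ⟨hx, hxe⟩
    have key : ∀ x ∈ ncFiltration 𝒜 d,
        ((DirectSum.decompose 𝒜 x e : 𝒜 e) : Λ) ∈ ncSp 𝒜 d e := by
      intro x hx
      rw [ncFiltration_eq_span] at hx
      induction hx using Submodule.span_induction with
      | mem x h =>
        obtain ⟨e', h⟩ := h
        by_cases he : e' = e
        · subst he
          rw [DirectSum.decompose_of_mem_same _ h.mem]
          exact Submodule.subset_span h
        · rw [DirectSum.decompose_of_mem_ne _ h.mem he]
          exact Submodule.zero_mem _
      | zero => simp
      | add x y _ _ hx hy => simpa using Submodule.add_mem _ hx hy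
      | smul c x _ hx =>
        rw [DirectSum.decompose_smul]
        exact Submodule.smul_mem _ c hx
    have := key x hx
    rwa [DirectSum.decompose_of_mem_same _ hxe] at this
  · refine Submodule.span_le.2 fun x hx => ⟨?_, IsNCMonomial.mem hx⟩
    rw [SetLike.mem_coe, ncFiltration_eq_span]
    exact Submodule.subset_span ⟨e, hx⟩

lemma ncSp_le (d : ℕ) (e : ℤ) : ncSp 𝒜 d e ≤ ncFiltration 𝒜 d :=
  (ncFiltration_inf (𝒜 := 𝒜) d e).symm.le.trans inf_le_left

lemma bracket_lie_ncSp {k d : ℕ} {a b : ℤ} {l y : Λ} (hl : IsLieMonomial 𝒜 (k + 1) a l)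
    (hy : IsNCMonomial 𝒜 d b y) : l * y - sgn a b • (y * l) ∈ ncSp 𝒜 (k + d + 1) (a + b) := by
  have base : ∀ {b : ℤ} {y : Λ}, y ∈ 𝒜 b → l * y - sgn a b • (y * l) ∈ ncSp 𝒜 (k + 1) (a + b) :=
    fun {b y} hy => lieSp_le_ncSp _ _
      (bracket_lieSp hl (Submodule.subset_span (IsLieMonomial.base hy)))
  induction hy with
  | base hy => exact base hy
  | @step d j e a' b x m y hx hm hy ih =>
    have hx' : x ∈ ncSp 𝒜 d e := Submodule.subset_span hx
    have hm' : m ∈ ncSp 𝒜 j a' := Submodule.subset_span hm.toNC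
    have hy' : y ∈ ncSp 𝒜 0 b := mem_ncSp_of_mem hy
    have hlm : l * m - sgn a a' • (m * l) ∈ ncSp 𝒜 (k + 1 + j) (a + a') :=
      lieSp_le_ncSp _ _ (lieSp_cast (bracket_lieSp hl (Submodule.subset_span hm))
        (by omega) rfl)
    have h1 := ncSp_cast (mem_ncSp_mul (mem_ncSp_mul ih hm') hy') (k' := k + (d + j) + 1)
      (e' := a + (e + a' + b)) (by omega) (by ring)
    have h2 := ncSp_cast (mem_ncSp_mul (mem_ncSp_mul hx' hlm) hy') (k' := k + (d + j) + 1)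
      (e' := a + (e + a' + b)) (by omega) (by ring)
    have h3 := ncSp_cast (mem_ncSp_mul (mem_ncSp_mul hx' hm') (base hy)) (k' := k + (d + j) + 1)
      (e' := a + (e + a' + b)) (by omega) (by ring)
    convert Submodule.add_mem _ (Submodule.add_mem _ h1 (Submodule.smul_mem _ (sgn a e) h2))
      (Submodule.smul_mem _ (sgn a e * sgn a a') h3) using 1
    simp only [mul_sub, sub_mul, mul_smul_comm, smul_mul_assoc, mul_assoc, sgn_add_right]
    module

lemma bracket_ncMonomial {d d' : ℕ} {a b : ℤ} {x y : Λ} (hx : IsNCMonomial 𝒜 d a x)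
    (hy : IsNCMonomial 𝒜 d' b y) :
    x * y - sgn a b • (y * x) ∈ ncSp 𝒜 (d + d' + 1) (a + b) := by
  have base : ∀ {a : ℤ} {x : Λ}, x ∈ 𝒜 a →
      x * y - sgn a b • (y * x) ∈ ncSp 𝒜 (0 + d' + 1) (a + b) :=
    fun hx => bracket_lie_ncSp (.base hx) hy
  induction hx with
  | base hx => exact base hx
  | @step d k e a c x l z hx hl hz ih =>
    have hx' : x ∈ ncSp 𝒜 d e := Submodule.subset_span hx
    have hl' : l ∈ ncSp 𝒜 k a := Submodule.subset_span hl.toNC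
    have hz' : z ∈ ncSp 𝒜 0 c := mem_ncSp_of_mem hz
    have h1 := ncSp_cast (mem_ncSp_mul (mem_ncSp_mul hx' hl') (base hz)) (k' := d + k + d' + 1)
      (e' := e + a + c + b) (by omega) (by ring)
    have h2 := ncSp_cast (mem_ncSp_mul (mem_ncSp_mul hx' (bracket_lie_ncSp hl hy)) hz')
      (k' := d + k + d' + 1) (e' := e + a + c + b) (by omega) (by ring)
    have h3 := ncSp_cast (mem_ncSp_mul (mem_ncSp_mul ih hl') hz') (k' := d + k + d' + 1)
      (e' := e + a + c + b) (by omega) (by ring)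
    convert Submodule.add_mem _ (Submodule.add_mem _ h1 (Submodule.smul_mem _ (sgn c b) h2))
      (Submodule.smul_mem _ (sgn c b * sgn a b) h3) using 1
    simp only [mul_sub, sub_mul, mul_smul_comm, smul_mul_assoc, mul_assoc, sgn_add_left]
    module

/-- The super commutator of elements of degrees `a` and `b`, as a bilinear map. -/
noncomputable def superBracket (Λ : Type u) [Ring Λ] [Algebra ℂ Λ] (a b : ℤ) :
    Λ →ₗ[ℂ] Λ →ₗ[ℂ] Λ :=
  LinearMap.mul ℂ Λ - sgn a b • (LinearMap.mul ℂ Λ).flip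

lemma superBracket_apply (a b : ℤ) (x y : Λ) :
    superBracket Λ a b x y = x * y - sgn a b • (y * x) := rfl

lemma bracket_ncSp {d d' : ℕ} {a b : ℤ} {x y : Λ} (hx : x ∈ ncSp 𝒜 d a)
    (hy : y ∈ ncSp 𝒜 d' b) : superBracket Λ a b x y ∈ ncSp 𝒜 (d + d' + 1) (a + b) := by
  induction hx using Submodule.span_induction with
  | mem x hx =>
    induction hy using Submodule.span_induction with
    | mem y hy => exact bracket_ncMonomial hx hy
    | zero => simp
    | add y z _ _ hy hz => rw [map_add]; exact Submodule.add_mem _ hy hz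
    | smul c y _ hy => rw [map_smul]; exact Submodule.smul_mem _ c hy
  | zero => simp
  | add x z _ _ hx hz => rw [map_add]; exact Submodule.add_mem _ hx hz
  | smul c x _ hx => rw [map_smul]; exact Submodule.smul_mem _ c hx

lemma ncSp_of {d : ℕ} {e : ℤ} {x : Λ} (hx : x ∈ ncFiltration 𝒜 d ⊓ 𝒜 e) : x ∈ ncSp 𝒜 d e :=
  (ncFiltration_inf (𝒜 := 𝒜) d e).le hx

lemma of_ncSp {d : ℕ} {e : ℤ} {x : Λ} (hx : x ∈ ncSp 𝒜 d e) : x ∈ ncFiltration 𝒜 d ⊓ 𝒜 e :=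
  (ncFiltration_inf (𝒜 := 𝒜) d e).symm.le hx

variable (𝒜)

/-- The homogeneous part `(F^d Λ)_e`. -/
abbrev filPart (d : ℕ) (e : ℤ) : Submodule ℂ Λ := ncFiltration 𝒜 d ⊓ 𝒜 e

/-- `gr_F(Λ)^d_e = (F^d Λ)_e / (F^{d+1} Λ)_e`. -/
abbrev grPiece (d : ℕ) (e : ℤ) : Type u := SubQ (filPart 𝒜 d e) (ncFiltration 𝒜 (d + 1))

/-- The product `gr_F(Λ)^d_e × gr_F(Λ)^{d'}_{e'} → gr_F(Λ)^{d+d'}_{e+e'}` induced by the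
product of `Λ`. -/
noncomputable def grMul (d : ℕ) (e : ℤ) (d' : ℕ) (e' : ℤ) :
    grPiece 𝒜 d e →ₗ[ℂ] grPiece 𝒜 d' e' →ₗ[ℂ] grPiece 𝒜 (d + d') (e + e') :=
  SubQ.map₂ (LinearMap.mul ℂ Λ) _ _ _ _ _ _
    (fun _ hx _ hy => of_ncSp (mem_ncSp_mul (ncSp_of hx) (ncSp_of hy)))
    (fun _ hx hx' _ hy => (of_ncSp (ncSp_cast (mem_ncSp_mul (ncSp_of ⟨hx', hx.2⟩) (ncSp_of hy))
      (by omega) rfl)).1)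
    (fun _ hx _ hy hy' => (of_ncSp (mem_ncSp_mul (ncSp_of hx) (ncSp_of ⟨hy', hy.2⟩))).1)

/-- The bracket `gr_F(Λ)^d_e × gr_F(Λ)^{d'}_{e'} → gr_F(Λ)^{d+d'+1}_{e+e'}` induced by the
super commutator of `Λ`. -/
noncomputable def grBracket (d : ℕ) (e : ℤ) (d' : ℕ) (e' : ℤ) :
    grPiece 𝒜 d e →ₗ[ℂ] grPiece 𝒜 d' e' →ₗ[ℂ] grPiece 𝒜 (d + d' + 1) (e + e') :=
  SubQ.map₂ (superBracket Λ e e') _ _ _ _ _ _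
    (fun _ hx _ hy => of_ncSp (bracket_ncSp (ncSp_of hx) (ncSp_of hy)))
    (fun _ hx hx' _ hy => (of_ncSp (ncSp_cast (bracket_ncSp (ncSp_of ⟨hx', hx.2⟩) (ncSp_of hy))
      (by omega) rfl)).1)
    (fun _ hx _ hy hy' => (of_ncSp (ncSp_cast (bracket_ncSp (ncSp_of hx) (ncSp_of ⟨hy', hy.2⟩))
      (by omega) rfl)).1)

lemma one_mem_filPart : (1 : Λ) ∈ filPart 𝒜 0 0 :=
  of_ncSp (mem_ncSp_of_mem (SetLike.one_mem_graded 𝒜))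

lemma mem_filPart_zero {e : ℤ} {x : Λ} (hx : x ∈ 𝒜 e) : x ∈ filPart 𝒜 0 e :=
  of_ncSp (mem_ncSp_of_mem hx)

/-- The associated graded `gr_F(Λ)` of the graded NC filtration, as a bigraded Poisson algebra:
`d` is the filtration degree, `e` is the degree coming from `Λ`. -/
noncomputable def grPoisson : BigradedPoissonAlgebra.{u} where
  obj := grPiece 𝒜
  one := SubQ.mk _ ⟨1, one_mem_filPart 𝒜⟩
  mul := grMul 𝒜
  bracket := grBracket 𝒜
  one_mul := by
    rintro d e ⟨x⟩
    refine inc_eq _ (fun d _ => ncFiltration 𝒜 (d + 1)) (by omega) (by ring) ⟨_, _⟩ x ?_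
    simp
  mul_assoc := by
    rintro d e d' e' d'' e'' ⟨x⟩ ⟨y⟩ ⟨z⟩
    refine inc_eq _ (fun d _ => ncFiltration 𝒜 (d + 1)) (by omega) (by ring) ⟨_, _⟩ ⟨_, _⟩ ?_
    exact mem_of_eq_zero (show x.1 * y.1 * z.1 - x.1 * (y.1 * z.1) = 0 by simp [mul_assoc])
  mul_comm := by
    rintro d e d' e' ⟨x⟩ ⟨y⟩
    refine inc_eq_smul _ (fun d _ => ncFiltration 𝒜 (d + 1)) (by omega) (by ring) _
      ⟨_, _⟩ ⟨_, _⟩ ?_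
    exact (of_ncSp (bracket_ncSp (ncSp_of x.2) (ncSp_of y.2))).1
  bracket_antisymm := by
    rintro d e d' e' ⟨x⟩ ⟨y⟩
    refine inc_eq_smul _ (fun d _ => ncFiltration 𝒜 (d + 1)) (by omega) (by ring) _
      ⟨_, _⟩ ⟨_, _⟩ ?_
    refine mem_of_eq_zero (show superBracket Λ e e' x.1 y.1 -
      (-sgn e e') • superBracket Λ e' e y.1 x.1 = 0 from ?_)
    simp only [superBracket_apply, sgn_comm e' e]
    rcases sgn_eq e e' with h | h <;> rw [h] <;> module
  jacobi := by
    rintro d e d' e' d'' e'' ⟨x⟩ ⟨y⟩ ⟨z⟩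
    refine inc_eq_add_smul _ (fun d _ => ncFiltration 𝒜 (d + 1)) (by omega) (by ring)
      (by omega) (by ring) _ ⟨_, _⟩ ⟨_, _⟩ ⟨_, _⟩ ?_
    refine mem_of_eq_zero (show superBracket Λ e (e' + e'') x.1 (superBracket Λ e' e'' y.1 z.1) -
      (superBracket Λ (e + e') e'' (superBracket Λ e e' x.1 y.1) z.1 +
        sgn e e' • superBracket Λ e' (e + e'') y.1 (superBracket Λ e e'' x.1 z.1)) = 0 from ?_)
    simp only [superBracket_apply, sgn_add_left, sgn_add_right, sgn_comm e' e, mul_sub, sub_mul,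
      mul_smul_comm, smul_mul_assoc, mul_assoc]
    rcases sgn_eq e e' with h | h <;> rw [h] <;> module
  leibniz := by
    rintro d e d' e' d'' e'' ⟨x⟩ ⟨y⟩ ⟨z⟩
    refine inc_eq_add_smul _ (fun d _ => ncFiltration 𝒜 (d + 1)) (by omega) (by ring)
      (by omega) (by ring) _ ⟨_, _⟩ ⟨_, _⟩ ⟨_, _⟩ ?_
    refine mem_of_eq_zero (show superBracket Λ e (e' + e'') x.1 (y.1 * z.1) -
      (superBracket Λ e e' x.1 y.1 * z.1 + sgn e e' • (y.1 * superBracket Λ e e'' x.1 z.1)) = 0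
      from ?_)
    simp only [superBracket_apply, sgn_add_right, mul_sub, sub_mul,
      mul_smul_comm, smul_mul_assoc, mul_assoc]
    module

/-- The class in `gr_F(Λ)^0_e` of a homogeneous element of `Λ`. -/
noncomputable def grMk (e : ℤ) (x : 𝒜 e) : (grPoisson 𝒜).obj 0 e :=
  SubQ.mk _ ⟨x.1, mem_filPart_zero 𝒜 x.2⟩

/-- The abelianization `Λ^{ab} = Λ / F^1 Λ`. -/
abbrev Abel : Type u := Λ ⧸ ncIdeal 𝒜 1

/-- The grading of `Λ^{ab}` induced by the grading of `Λ`. -/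
def abelGrading (e : ℤ) : Submodule ℂ (Abel 𝒜) :=
  (𝒜 e).map (Ideal.Quotient.mkₐ ℂ (ncIdeal 𝒜 1)).toLinearMap

/-- The class in `(Λ^{ab})_e` of a homogeneous element of `Λ`. -/
def abelMk (e : ℤ) (x : 𝒜 e) : abelGrading 𝒜 e :=
  ⟨Ideal.Quotient.mkₐ ℂ (ncIdeal 𝒜 1) x.1, x.1, x.2, rfl⟩

instance : SetLike.GradedMonoid (abelGrading 𝒜) where
  one_mem := ⟨1, SetLike.one_mem_graded 𝒜, map_one (Ideal.Quotient.mkₐ ℂ (ncIdeal 𝒜 1))⟩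
  mul_mem := by
    rintro i j _ _ ⟨x, hx, rfl⟩ ⟨y, hy, rfl⟩
    exact ⟨x * y, SetLike.mul_mem_graded hx hy,
      map_mul (Ideal.Quotient.mkₐ ℂ (ncIdeal 𝒜 1)) x y⟩

end Graded

/-! ### The graded Poisson envelope -/

section Envelope

set_option linter.unusedSimpArgs false
set_option linter.unusedTactic false

/-- Formal Poisson monomials in the homogeneous elements of `A`: words built from generators with
a formal product and a formal bracket. -/
inductive PMon {A : Type u} [Ring A] [Algebra ℂ A] (𝒜 : ℤ → Submodule ℂ A) : Type u
  | of (e : ℤ) (a : 𝒜 e) : PMon 𝒜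
  | mul (m n : PMon 𝒜) : PMon 𝒜
  | br (m n : PMon 𝒜) : PMon 𝒜

variable {A : Type u} [Ring A] [Algebra ℂ A] {𝒜 : ℤ → Submodule ℂ A}

/-- The upper degree of a monomial: the number of brackets in it. -/
def PMon.up : PMon 𝒜 → ℕ
  | .of _ _ => 0
  | .mul m n => m.up + n.up
  | .br m n => m.up + n.up + 1

/-- The lower degree of a monomial: the sum of the degrees of the generators in it. -/
def PMon.low : PMon 𝒜 → ℤ
  | .of e _ => e
  | .mul m n => m.low + n.low
  | .br m n => m.low + n.low

variable (𝒜)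

/-- Formal linear combinations of Poisson monomials: the free vector space with two bilinear
operations on the generators `of e a`. -/
abbrev PFree : Type u := PMon 𝒜 →₀ ℂ

variable {𝒜}

/-- A monomial as an element of `PFree`. -/
noncomputable def PMon.toFree (m : PMon 𝒜) : PFree 𝒜 := Finsupp.single m 1

/-- The bilinear extension of an operation on monomials. -/
noncomputable def bilinExt (f : PMon 𝒜 → PMon 𝒜 → PMon 𝒜) :
    PFree 𝒜 →ₗ[ℂ] PFree 𝒜 →ₗ[ℂ] PFree 𝒜 :=
  Finsupp.lift (PFree 𝒜 →ₗ[ℂ] PFree 𝒜) ℂ (PMon 𝒜) fun m => Finsupp.lmapDomain ℂ ℂ (f m)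

lemma bilinExt_toFree (f : PMon 𝒜 → PMon 𝒜 → PMon 𝒜) (m n : PMon 𝒜) :
    bilinExt f m.toFree n.toFree = (f m n).toFree := by
  simp [bilinExt, PMon.toFree]

variable (𝒜)

/-- The defining relations of the Poisson envelope, closed under multiplying and bracketing with
monomials on either side: the generators `of e a` depend linearly on `a`, the formal product
restricts to the product of `A` on generators, and the axioms of a graded Poisson algebra hold. -/
inductive PRel [SetLike.GradedMonoid 𝒜] : PFree 𝒜 → Prop
  | of_add (e : ℤ) (a b : 𝒜 e) :
      PRel ((PMon.of e (a + b)).toFree - ((PMon.of e a).toFree + (PMon.of e b).toFree))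
  | of_smul (e : ℤ) (c : ℂ) (a : 𝒜 e) :
      PRel ((PMon.of e (c • a)).toFree - c • (PMon.of e a).toFree)
  | of_mul (e e' : ℤ) (a : 𝒜 e) (b : 𝒜 e') :
      PRel ((PMon.mul (.of e a) (.of e' b)).toFree -
        (PMon.of (e + e') ⟨(a : A) * (b : A), SetLike.mul_mem_graded a.2 b.2⟩).toFree)
  | one_mul (m : PMon 𝒜) :
      PRel ((PMon.mul (.of 0 ⟨1, SetLike.one_mem_graded 𝒜⟩) m).toFree - m.toFree)
  | mul_assoc (m n p : PMon 𝒜) :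
      PRel ((PMon.mul (.mul m n) p).toFree - (PMon.mul m (.mul n p)).toFree)
  | mul_comm (m n : PMon 𝒜) :
      PRel ((PMon.mul m n).toFree - sgn m.low n.low • (PMon.mul n m).toFree)
  | antisymm (m n : PMon 𝒜) :
      PRel ((PMon.br m n).toFree - (-sgn m.low n.low) • (PMon.br n m).toFree)
  | jacobi (m n p : PMon 𝒜) :
      PRel ((PMon.br m (.br n p)).toFree -
        ((PMon.br (.br m n) p).toFree + sgn m.low n.low • (PMon.br n (.br m p)).toFree))
  | leibniz (m n p : PMon 𝒜) :
      PRel ((PMon.br m (.mul n p)).toFree -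
        ((PMon.mul (.br m n) p).toFree + sgn m.low n.low • (PMon.mul n (.br m p)).toFree))
  | mul_left (m : PMon 𝒜) {x : PFree 𝒜} (hx : PRel x) : PRel (bilinExt .mul m.toFree x)
  | mul_right (m : PMon 𝒜) {x : PFree 𝒜} (hx : PRel x) : PRel (bilinExt .mul x m.toFree)
  | br_left (m : PMon 𝒜) {x : PFree 𝒜} (hx : PRel x) : PRel (bilinExt .br m.toFree x)
  | br_right (m : PMon 𝒜) {x : PFree 𝒜} (hx : PRel x) : PRel (bilinExt .br x m.toFree)

/-- The span of the relations. -/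
noncomputable def relSpan [SetLike.GradedMonoid 𝒜] : Submodule ℂ (PFree 𝒜) := Submodule.span ℂ {x | PRel 𝒜 x}

/-- The span of the monomials of bidegree `(d, e)`. -/
noncomputable def monSpan (d : ℕ) (e : ℤ) : Submodule ℂ (PFree 𝒜) :=
  Submodule.span ℂ {x | ∃ m : PMon 𝒜, m.up = d ∧ m.low = e ∧ m.toFree = x}

variable {𝒜}

lemma toFree_mem (m : PMon 𝒜) : m.toFree ∈ monSpan 𝒜 m.up m.low :=
  Submodule.subset_span ⟨m, rfl, rfl, rfl⟩

lemma mem_span_toFree (x : PFree 𝒜) : x ∈ Submodule.span ℂ (Set.range (PMon.toFree (𝒜 := 𝒜))) := by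
  induction x using Finsupp.induction_linear with
  | zero => exact Submodule.zero_mem _
  | add x y hx hy => exact Submodule.add_mem _ hx hy
  | single m c =>
    have : (Finsupp.single m c : PFree 𝒜) = c • m.toFree := by simp [PMon.toFree]
    rw [this]
    exact Submodule.smul_mem _ _ (Submodule.subset_span ⟨m, rfl⟩)

/-- Bilinear maps respecting spans. -/
lemma bilin_mem_of_span {N : Type u} [AddCommGroup N] [Module ℂ N] (B : N →ₗ[ℂ] N →ₗ[ℂ] N)
    {s t : Set N} {K : Submodule ℂ N} (h : ∀ x ∈ s, ∀ y ∈ t, B x y ∈ K) {x y : N}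
    (hx : x ∈ Submodule.span ℂ s) (hy : y ∈ Submodule.span ℂ t) : B x y ∈ K := by
  have := Submodule.apply_mem_map₂ B hx hy
  rw [Submodule.map₂_span_span] at this
  refine Submodule.span_le.2 ?_ this
  rintro _ ⟨x, hx, y, hy, rfl⟩
  exact h x hx y hy

lemma mul_mem_monSpan {d d' : ℕ} {e e' : ℤ} {x y : PFree 𝒜} (hx : x ∈ monSpan 𝒜 d e)
    (hy : y ∈ monSpan 𝒜 d' e') : bilinExt .mul x y ∈ monSpan 𝒜 (d + d') (e + e') := by
  refine bilin_mem_of_span _ ?_ hx hy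
  rintro _ ⟨m, rfl, rfl, rfl⟩ _ ⟨n, rfl, rfl, rfl⟩
  rw [bilinExt_toFree]
  exact toFree_mem (.mul m n)

lemma br_mem_monSpan {d d' : ℕ} {e e' : ℤ} {x y : PFree 𝒜} (hx : x ∈ monSpan 𝒜 d e)
    (hy : y ∈ monSpan 𝒜 d' e') : bilinExt .br x y ∈ monSpan 𝒜 (d + d' + 1) (e + e') := by
  refine bilin_mem_of_span _ ?_ hx hy
  rintro _ ⟨m, rfl, rfl, rfl⟩ _ ⟨n, rfl, rfl, rfl⟩
  rw [bilinExt_toFree]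
  exact toFree_mem (.br m n)

/-- A statement that is linear in one variable may be checked on monomials. -/
lemma mem_of_monomials {d : ℕ} {e : ℤ} {K : Submodule ℂ (PFree 𝒜)} {T : PFree 𝒜 → PFree 𝒜}
    (hT : IsLinearMap ℂ T) (h : ∀ m : PMon 𝒜, m.low = e → T m.toFree ∈ K) {x : PFree 𝒜}
    (hx : x ∈ monSpan 𝒜 d e) : T x ∈ K := by
  have : monSpan 𝒜 d e ≤ K.comap (hT.mk' T) := by
    refine Submodule.span_le.2 ?_
    rintro _ ⟨m, hm, hm', rfl⟩
    exact h m hm'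
  exact this hx

/-- A statement that is linear in each of two variables may be checked on monomials. -/
lemma mem_of_monomials₂ {d d' : ℕ} {e e' : ℤ} {K : Submodule ℂ (PFree 𝒜)}
    (T : PFree 𝒜 → PFree 𝒜 → PFree 𝒜)
    (h₁ : ∀ y, IsLinearMap ℂ fun x => T x y) (h₂ : ∀ x, IsLinearMap ℂ fun y => T x y)
    (h : ∀ m n : PMon 𝒜, m.low = e → n.low = e' → T m.toFree n.toFree ∈ K)
    {x y : PFree 𝒜} (hx : x ∈ monSpan 𝒜 d e) (hy : y ∈ monSpan 𝒜 d' e') : T x y ∈ K :=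
  mem_of_monomials (h₂ x) (fun n hn =>
    mem_of_monomials (h₁ n.toFree) (fun m hm => h m n hm hn) hx) hy

/-- A statement that is linear in each of three variables may be checked on monomials. -/
lemma mem_of_monomials₃ {d d' d'' : ℕ} {e e' e'' : ℤ} {K : Submodule ℂ (PFree 𝒜)}
    (T : PFree 𝒜 → PFree 𝒜 → PFree 𝒜 → PFree 𝒜)
    (h₁ : ∀ y z, IsLinearMap ℂ fun x => T x y z) (h₂ : ∀ x z, IsLinearMap ℂ fun y => T x y z)
    (h₃ : ∀ x y, IsLinearMap ℂ fun z => T x y z)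
    (h : ∀ m n p : PMon 𝒜, m.low = e → n.low = e' → p.low = e'' →
      T m.toFree n.toFree p.toFree ∈ K) {x y z : PFree 𝒜}
    (hx : x ∈ monSpan 𝒜 d e) (hy : y ∈ monSpan 𝒜 d' e') (hz : z ∈ monSpan 𝒜 d'' e'') :
    T x y z ∈ K :=
  mem_of_monomials (h₃ x y) (fun p hp =>
    mem_of_monomials₂ (fun x y => T x y p.toFree) (fun y => h₁ y _) (fun x => h₂ x _)
      (fun m n hm hn => h m n p hm hn hp) hx hy) hz

variable [SetLike.GradedMonoid 𝒜]

lemma subset_relSpan {x : PFree 𝒜} (h : PRel 𝒜 x) : x ∈ relSpan 𝒜 := Submodule.subset_span h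

lemma mul_left_mem (x : PFree 𝒜) {y : PFree 𝒜} (hy : y ∈ relSpan 𝒜) :
    bilinExt .mul x y ∈ relSpan 𝒜 := by
  refine bilin_mem_of_span _ ?_ (mem_span_toFree x) hy
  rintro _ ⟨m, rfl⟩ y hy
  exact subset_relSpan (PRel.mul_left m hy)

lemma mul_right_mem (x : PFree 𝒜) {y : PFree 𝒜} (hy : y ∈ relSpan 𝒜) :
    bilinExt .mul y x ∈ relSpan 𝒜 := by
  refine bilin_mem_of_span _ ?_ hy (mem_span_toFree x)
  rintro y hy _ ⟨m, rfl⟩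
  exact subset_relSpan (PRel.mul_right m hy)

lemma br_left_mem (x : PFree 𝒜) {y : PFree 𝒜} (hy : y ∈ relSpan 𝒜) :
    bilinExt .br x y ∈ relSpan 𝒜 := by
  refine bilin_mem_of_span _ ?_ (mem_span_toFree x) hy
  rintro _ ⟨m, rfl⟩ y hy
  exact subset_relSpan (PRel.br_left m hy)

lemma br_right_mem (x : PFree 𝒜) {y : PFree 𝒜} (hy : y ∈ relSpan 𝒜) :
    bilinExt .br y x ∈ relSpan 𝒜 := by
  refine bilin_mem_of_span _ ?_ hy (mem_span_toFree x)
  rintro y hy _ ⟨m, rfl⟩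
  exact subset_relSpan (PRel.br_right m hy)

lemma one_mul_rel {d : ℕ} {e : ℤ} {x : PFree 𝒜} (hx : x ∈ monSpan 𝒜 d e) :
    bilinExt .mul (PMon.of 0 ⟨1, SetLike.one_mem_graded 𝒜⟩).toFree x - x ∈ relSpan 𝒜 := by
  refine mem_of_monomials (T := fun x => bilinExt .mul
    (PMon.of 0 ⟨1, SetLike.one_mem_graded 𝒜⟩).toFree x - x)
    (by intros; constructor <;> intros <;>
      simp only [map_add, map_smul, LinearMap.add_apply, LinearMap.smul_apply] <;> module)
    (fun m _ => ?_) hx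
  rw [bilinExt_toFree]
  exact subset_relSpan (PRel.one_mul m)

lemma mul_assoc_rel {d d' d'' : ℕ} {e e' e'' : ℤ} {x y z : PFree 𝒜} (hx : x ∈ monSpan 𝒜 d e)
    (hy : y ∈ monSpan 𝒜 d' e') (hz : z ∈ monSpan 𝒜 d'' e'') :
    bilinExt .mul (bilinExt .mul x y) z - bilinExt .mul x (bilinExt .mul y z) ∈ relSpan 𝒜 := by
  refine mem_of_monomials₃ (fun x y z => bilinExt .mul (bilinExt .mul x y) z - bilinExt .mul x (bilinExt .mul y z))
    (by intros; constructor <;> intros <;>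
      simp only [map_add, map_smul, LinearMap.add_apply, LinearMap.smul_apply] <;> module)
    (by intros; constructor <;> intros <;>
      simp only [map_add, map_smul, LinearMap.add_apply, LinearMap.smul_apply] <;> module)
    (by intros; constructor <;> intros <;>
      simp only [map_add, map_smul, LinearMap.add_apply, LinearMap.smul_apply] <;> module)
    ?_ hx hy hz
  rintro m n p rfl rfl rfl
  simp only [bilinExt_toFree]
  exact subset_relSpan (PRel.mul_assoc m n p)

lemma mul_comm_rel {d d' : ℕ} {e e' : ℤ} {x y : PFree 𝒜} (hx : x ∈ monSpan 𝒜 d e)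
    (hy : y ∈ monSpan 𝒜 d' e') :
    bilinExt .mul x y - sgn e e' • bilinExt .mul y x ∈ relSpan 𝒜 := by
  refine mem_of_monomials₂ (fun x y => bilinExt .mul x y - sgn e e' • bilinExt .mul y x)
    (by intros; constructor <;> intros <;>
      simp only [map_add, map_smul, LinearMap.add_apply, LinearMap.smul_apply] <;> module)
    (by intros; constructor <;> intros <;>
      simp only [map_add, map_smul, LinearMap.add_apply, LinearMap.smul_apply] <;> module)
    ?_ hx hy
  rintro m n rfl rfl
  simp only [bilinExt_toFree]
  exact subset_relSpan (PRel.mul_comm m n)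

lemma antisymm_rel {d d' : ℕ} {e e' : ℤ} {x y : PFree 𝒜} (hx : x ∈ monSpan 𝒜 d e)
    (hy : y ∈ monSpan 𝒜 d' e') :
    bilinExt .br x y - (-sgn e e') • bilinExt .br y x ∈ relSpan 𝒜 := by
  refine mem_of_monomials₂ (fun x y => bilinExt .br x y - (-sgn e e') • bilinExt .br y x)
    (by intros; constructor <;> intros <;>
      simp only [map_add, map_smul, LinearMap.add_apply, LinearMap.smul_apply] <;> module)
    (by intros; constructor <;> intros <;>
      simp only [map_add, map_smul, LinearMap.add_apply, LinearMap.smul_apply] <;> module)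
    ?_ hx hy
  rintro m n rfl rfl
  simp only [bilinExt_toFree]
  exact subset_relSpan (PRel.antisymm m n)

lemma jacobi_rel {d d' d'' : ℕ} {e e' e'' : ℤ} {x y z : PFree 𝒜} (hx : x ∈ monSpan 𝒜 d e)
    (hy : y ∈ monSpan 𝒜 d' e') (hz : z ∈ monSpan 𝒜 d'' e'') :
    bilinExt .br x (bilinExt .br y z) -
      (bilinExt .br (bilinExt .br x y) z + sgn e e' • bilinExt .br y (bilinExt .br x z)) ∈ relSpan 𝒜 := by
  refine mem_of_monomials₃ (fun x y z => bilinExt .br x (bilinExt .br y z) -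
      (bilinExt .br (bilinExt .br x y) z + sgn e e' • bilinExt .br y (bilinExt .br x z)))
    (by intros; constructor <;> intros <;>
      simp only [map_add, map_smul, LinearMap.add_apply, LinearMap.smul_apply] <;> module)
    (by intros; constructor <;> intros <;>
      simp only [map_add, map_smul, LinearMap.add_apply, LinearMap.smul_apply] <;> module)
    (by intros; constructor <;> intros <;>
      simp only [map_add, map_smul, LinearMap.add_apply, LinearMap.smul_apply] <;> module)
    ?_ hx hy hz
  rintro m n p rfl rfl rfl
  simp only [bilinExt_toFree]
  exact subset_relSpan (PRel.jacobi m n p)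

lemma leibniz_rel {d d' d'' : ℕ} {e e' e'' : ℤ} {x y z : PFree 𝒜} (hx : x ∈ monSpan 𝒜 d e)
    (hy : y ∈ monSpan 𝒜 d' e') (hz : z ∈ monSpan 𝒜 d'' e'') :
    bilinExt .br x (bilinExt .mul y z) -
      (bilinExt .mul (bilinExt .br x y) z + sgn e e' • bilinExt .mul y (bilinExt .br x z)) ∈ relSpan 𝒜 := by
  refine mem_of_monomials₃ (fun x y z => bilinExt .br x (bilinExt .mul y z) -
      (bilinExt .mul (bilinExt .br x y) z + sgn e e' • bilinExt .mul y (bilinExt .br x z)))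
    (by intros; constructor <;> intros <;>
      simp only [map_add, map_smul, LinearMap.add_apply, LinearMap.smul_apply] <;> module)
    (by intros; constructor <;> intros <;>
      simp only [map_add, map_smul, LinearMap.add_apply, LinearMap.smul_apply] <;> module)
    (by intros; constructor <;> intros <;>
      simp only [map_add, map_smul, LinearMap.add_apply, LinearMap.smul_apply] <;> module)
    ?_ hx hy hz
  rintro m n p rfl rfl rfl
  simp only [bilinExt_toFree]
  exact subset_relSpan (PRel.leibniz m n p)

variable (𝒜)

/-- The piece `P(A)^d_e`: combinations of monomials of bidegree `(d, e)` modulo the relations. -/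
abbrev envPiece (d : ℕ) (e : ℤ) : Type u := SubQ (monSpan 𝒜 d e) (relSpan 𝒜)

/-- The product of the Poisson envelope. -/
noncomputable def envMul (d : ℕ) (e : ℤ) (d' : ℕ) (e' : ℤ) :
    envPiece 𝒜 d e →ₗ[ℂ] envPiece 𝒜 d' e' →ₗ[ℂ] envPiece 𝒜 (d + d') (e + e') :=
  SubQ.map₂ (bilinExt .mul) _ _ _ _ _ _
    (fun _ hx _ hy => mul_mem_monSpan hx hy)
    (fun _ _ hx' y _ => mul_right_mem y hx')
    (fun x _ _ _ hy' => mul_left_mem x hy')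

/-- The bracket of the Poisson envelope. -/
noncomputable def envBracket (d : ℕ) (e : ℤ) (d' : ℕ) (e' : ℤ) :
    envPiece 𝒜 d e →ₗ[ℂ] envPiece 𝒜 d' e' →ₗ[ℂ] envPiece 𝒜 (d + d' + 1) (e + e') :=
  SubQ.map₂ (bilinExt .br) _ _ _ _ _ _
    (fun _ hx _ hy => br_mem_monSpan hx hy)
    (fun _ _ hx' y _ => br_right_mem y hx')
    (fun x _ _ _ hy' => br_left_mem x hy')

/-- The canonical map `A_e → P(A)^0_e`. -/
noncomputable def envOf (e : ℤ) (a : 𝒜 e) : envPiece 𝒜 0 e :=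
  SubQ.mk _ ⟨(PMon.of e a).toFree, toFree_mem (PMon.of e a)⟩

/-- The bigraded Poisson envelope `P(A)` of a (super commutative) graded algebra `A`: the free
graded Poisson algebra on the graded vector space `A`, modulo the Poisson ideal generated by the
differences of the formal and the actual products of elements of `A` (and of the units). It is
the value at `A` of the left adjoint of the functor forgetting the bracket. The upper degree
counts brackets. -/
noncomputable def poissonEnvelope : BigradedPoissonAlgebra.{u} where
  obj := envPiece 𝒜
  acg := fun d e => inferInstanceAs (AddCommGroup (envPiece 𝒜 d e))
  mod := fun d e => inferInstanceAs (Module ℂ (envPiece 𝒜 d e))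
  one := envOf 𝒜 0 ⟨1, SetLike.one_mem_graded 𝒜⟩
  mul := envMul 𝒜
  bracket := envBracket 𝒜
  one_mul := by
    rintro d e ⟨x⟩
    exact inc_eq (monSpan 𝒜) (fun _ _ => relSpan 𝒜) (by omega) (by ring)
      ⟨_, mul_mem_monSpan (d := 0) (e := 0)
        (toFree_mem (PMon.of 0 ⟨1, SetLike.one_mem_graded 𝒜⟩)) x.2⟩ x
      (one_mul_rel x.2)
  mul_assoc := by
    rintro d e d' e' d'' e'' ⟨x⟩ ⟨y⟩ ⟨z⟩
    exact inc_eq (monSpan 𝒜) (fun _ _ => relSpan 𝒜) (by omega) (by ring)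
      ⟨_, mul_mem_monSpan (mul_mem_monSpan x.2 y.2) z.2⟩
      ⟨_, mul_mem_monSpan x.2 (mul_mem_monSpan y.2 z.2)⟩
      (mul_assoc_rel x.2 y.2 z.2)
  mul_comm := by
    rintro d e d' e' ⟨x⟩ ⟨y⟩
    exact inc_eq_smul (monSpan 𝒜) (fun _ _ => relSpan 𝒜) (by omega) (by ring) _
      ⟨_, mul_mem_monSpan x.2 y.2⟩ ⟨_, mul_mem_monSpan y.2 x.2⟩
      (mul_comm_rel x.2 y.2)
  bracket_antisymm := by
    rintro d e d' e' ⟨x⟩ ⟨y⟩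
    exact inc_eq_smul (monSpan 𝒜) (fun _ _ => relSpan 𝒜) (by omega) (by ring) _
      ⟨_, br_mem_monSpan x.2 y.2⟩ ⟨_, br_mem_monSpan y.2 x.2⟩
      (antisymm_rel x.2 y.2)
  jacobi := by
    rintro d e d' e' d'' e'' ⟨x⟩ ⟨y⟩ ⟨z⟩
    exact inc_eq_add_smul (monSpan 𝒜) (fun _ _ => relSpan 𝒜) (by omega) (by ring)
      (by omega) (by ring) _
      ⟨_, br_mem_monSpan x.2 (br_mem_monSpan y.2 z.2)⟩
      ⟨_, br_mem_monSpan (br_mem_monSpan x.2 y.2) z.2⟩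
      ⟨_, br_mem_monSpan y.2 (br_mem_monSpan x.2 z.2)⟩
      (jacobi_rel x.2 y.2 z.2)
  leibniz := by
    rintro d e d' e' d'' e'' ⟨x⟩ ⟨y⟩ ⟨z⟩
    exact inc_eq_add_smul (monSpan 𝒜) (fun _ _ => relSpan 𝒜) (by omega) (by ring)
      (by omega) (by ring) _
      ⟨_, br_mem_monSpan x.2 (mul_mem_monSpan y.2 z.2)⟩
      ⟨_, mul_mem_monSpan (br_mem_monSpan x.2 y.2) z.2⟩
      ⟨_, mul_mem_monSpan y.2 (br_mem_monSpan x.2 z.2)⟩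
      (leibniz_rel x.2 y.2 z.2)

end Envelope

/-! ### The algebra `Λ = R ∗ T(W)` -/

section FreeProduct

/-- The two factors `R` and `T(W)` of the free product. -/
def Factor (R W : Type u) [Ring R] [Algebra ℂ R] [AddCommGroup W] [Module ℂ W] : Bool → Type u
  | true => R
  | false => TensorAlgebra ℂ W

instance (R W : Type u) [Ring R] [Algebra ℂ R] [AddCommGroup W] [Module ℂ W] :
    ∀ b, Ring (Factor R W b)
  | true => inferInstanceAs (Ring R)
  | false => inferInstanceAs (Ring (TensorAlgebra ℂ W))

instance (R W : Type u) [Ring R] [Algebra ℂ R] [AddCommGroup W] [Module ℂ W] :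
    ∀ b, Algebra ℂ (Factor R W b)
  | true => inferInstanceAs (Algebra ℂ R)
  | false => inferInstanceAs (Algebra ℂ (TensorAlgebra ℂ W))

/-- `Λ = R ∗ T(W)`, the free product (coproduct) of `ℂ`-algebras. -/
abbrev Lam (R W : Type u) [Ring R] [Algebra ℂ R] [AddCommGroup W] [Module ℂ W] : Type u :=
  LinearAlgebra.FreeProduct ℂ (Factor R W)

variable {R W : Type u} [Ring R] [Algebra ℂ R] [AddCommGroup W] [Module ℂ W]

/-- The inclusion `R → R ∗ T(W)`. -/
noncomputable def inR (R W : Type u) [Ring R] [Algebra ℂ R] [AddCommGroup W] [Module ℂ W] :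
    R →ₐ[ℂ] Lam R W :=
  LinearAlgebra.FreeProduct.ι ℂ (Factor R W) true

/-- The inclusion `T(W) → R ∗ T(W)`. -/
noncomputable def inT (R W : Type u) [Ring R] [Algebra ℂ R] [AddCommGroup W] [Module ℂ W] :
    TensorAlgebra ℂ W →ₐ[ℂ] Lam R W :=
  LinearAlgebra.FreeProduct.ι ℂ (Factor R W) false

/-- The inclusion `W → R ∗ T(W)`. -/
noncomputable def inW (R W : Type u) [Ring R] [Algebra ℂ R] [AddCommGroup W] [Module ℂ W] :
    W →ₗ[ℂ] Lam R W :=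
  (inT R W).toLinearMap ∘ₗ TensorAlgebra.ι ℂ

/-- The homomorphism out of `R ∗ T(W)` given by its restrictions to `R` and `W`. -/
noncomputable def lamLift {B : Type u} [Semiring B] [Algebra ℂ B] (f : R →ₐ[ℂ] B) (g : W →ₗ[ℂ] B) :
    Lam R W →ₐ[ℂ] B :=
  LinearAlgebra.FreeProduct.lift ℂ (Factor R W) fun {b} => match b with
    | true => f
    | false => TensorAlgebra.lift ℂ g

lemma lamLift_inR {B : Type u} [Semiring B] [Algebra ℂ B] (f : R →ₐ[ℂ] B) (g : W →ₗ[ℂ] B) (r : R) :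
    lamLift f g (inR R W r) = f r :=
  AlgHom.congr_fun (LinearAlgebra.FreeProduct.lift_comp_ι ℂ (Factor R W) (i := true)
    (fun {b} => match b with
      | true => f
      | false => TensorAlgebra.lift ℂ g)) r

lemma lamLift_inW {B : Type u} [Semiring B] [Algebra ℂ B] (f : R →ₐ[ℂ] B) (g : W →ₗ[ℂ] B) (w : W) :
    lamLift f g (inW R W w) = g w :=
  (AlgHom.congr_fun (LinearAlgebra.FreeProduct.lift_comp_ι ℂ (Factor R W) (i := false)
    (fun {b} => match b with
      | true => f
      | false => TensorAlgebra.lift ℂ g)) (TensorAlgebra.ι ℂ w)).trans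
    (TensorAlgebra.lift_ι_apply g w)

lemma lam_hom_ext {B : Type u} [Semiring B] [Algebra ℂ B] {f g : Lam R W →ₐ[ℂ] B}
    (h : ∀ r, f (inR R W r) = g (inR R W r)) (h' : ∀ w, f (inW R W w) = g (inW R W w)) :
    f = g := by
  apply (LinearAlgebra.FreeProduct.lift ℂ (Factor R W)).symm.injective
  funext b
  cases b with
  | true => exact AlgHom.ext h
  | false => exact TensorAlgebra.hom_ext (LinearMap.ext h')

/-- Words `r₀ w₁ r₁ w₂ ⋯ wₙ rₙ` in `R ∗ T(W)` with `wᵢ` homogeneous; `e` is the sum of the degrees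
of the `wᵢ`. -/
inductive IsWord (R : Type u) {W : Type u} [Ring R] [Algebra ℂ R] [AddCommGroup W] [Module ℂ W]
    (𝒲 : ℤ → Submodule ℂ W) : ℤ → Lam R W → Prop
  | base (r : R) : IsWord R 𝒲 0 (inR R W r)
  | step {e a : ℤ} {x : Lam R W} {w : W} (hx : IsWord R 𝒲 e x) (hw : w ∈ 𝒲 a) (r : R) :
      IsWord R 𝒲 (e + a) (x * inW R W w * inR R W r)

/-- The grading of `R ∗ T(W)` induced by a grading of `W`, with `R` in degree `0`. -/
def lamGrading (R : Type u) {W : Type u} [Ring R] [Algebra ℂ R] [AddCommGroup W] [Module ℂ W]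
    (𝒲 : ℤ → Submodule ℂ W) (e : ℤ) : Submodule ℂ (Lam R W) :=
  Submodule.span ℂ {x | IsWord R 𝒲 e x}

variable {𝒲 : ℤ → Submodule ℂ W}

lemma IsWord.cast {e e' : ℤ} {x x' : Lam R W} (h : IsWord R 𝒲 e x) (he : e = e') (hx : x = x') :
    IsWord R 𝒲 e' x' := by subst he hx; exact h

lemma IsWord.mul {e e' : ℤ} {x y : Lam R W} (hx : IsWord R 𝒲 e x) (hy : IsWord R 𝒲 e' y) :
    IsWord R 𝒲 (e + e') (x * y) := by
  induction hy with
  | base s =>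
    cases hx with
    | base r => exact (IsWord.base (r * s)).cast (by ring) (map_mul _ _ _)
    | step hx hw r =>
      exact (IsWord.step hx hw (r * s)).cast (by ring) (by simp only [map_mul, mul_assoc])
  | step hy hw r ih =>
    exact (IsWord.step ih hw r).cast (by ring) (by simp only [mul_assoc])

instance : SetLike.GradedMonoid (lamGrading R 𝒲) where
  one_mem := Submodule.subset_span ((IsWord.base (1 : R)).cast rfl (map_one _))
  mul_mem := by
    intro e e' x y hx hy
    have h := Submodule.mul_mem_mul hx hy
    rw [lamGrading, lamGrading, Submodule.span_mul_span] at h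
    refine Submodule.span_mono ?_ h
    rintro _ ⟨a, ha, b, hb, rfl⟩
    exact IsWord.mul ha hb

lemma inR_mem (r : R) : inR R W r ∈ lamGrading R 𝒲 0 := Submodule.subset_span (IsWord.base r)

lemma inW_mem {a : ℤ} {w : W} (hw : w ∈ 𝒲 a) : inW R W w ∈ lamGrading R 𝒲 a :=
  Submodule.subset_span (((IsWord.base (1 : R)).step hw 1).cast (by ring) (by simp))

variable (R 𝒲)

/-- The inclusion of `R` in the degree `0` part, as an algebra homomorphism. -/
noncomputable def decR : R →ₐ[ℂ] ⨁ e, lamGrading R 𝒲 e :=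
  AlgHom.ofLinearMap
    (DirectSum.lof ℂ ℤ (fun e => lamGrading R 𝒲 e) 0 ∘ₗ
      (inR R W).toLinearMap.codRestrict (lamGrading R 𝒲 0) inR_mem)
    (by
      refine DirectSum.of_eq_of_gradedMonoid_eq (Sigma.subtype_ext rfl ?_)
      exact map_one (inR R W))
    (by
      intro x y
      refine Eq.symm ((DirectSum.of_mul_of _ _).trans ?_)
      refine DirectSum.of_eq_of_gradedMonoid_eq (Sigma.subtype_ext (add_zero 0) ?_)
      exact (map_mul (inR R W) x y).symm)

/-- The decomposition of `W` into homogeneous parts, inside the graded pieces of `R ∗ T(W)`. -/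
noncomputable def decW [DirectSum.Decomposition 𝒲] : W →ₗ[ℂ] ⨁ e, lamGrading R 𝒲 e :=
  (DirectSum.toModule ℂ ℤ _ fun a =>
    DirectSum.lof ℂ ℤ (fun e => lamGrading R 𝒲 e) a ∘ₗ
      ((inW R W) ∘ₗ (𝒲 a).subtype).codRestrict (lamGrading R 𝒲 a) fun w => inW_mem w.2) ∘ₗ
  (DirectSum.decomposeLinearEquiv 𝒲).toLinearMap

lemma decW_of [DirectSum.Decomposition 𝒲] {a : ℤ} {w : W} (hw : w ∈ 𝒲 a) :
    decW R 𝒲 w = DirectSum.of (fun e => lamGrading R 𝒲 e) a ⟨inW R W w, inW_mem hw⟩ := by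
  simp only [decW, LinearMap.comp_apply, LinearEquiv.coe_coe,
    DirectSum.decomposeLinearEquiv_apply, DirectSum.decompose_of_mem 𝒲 hw]
  exact DirectSum.toModule_lof ℂ a _

lemma dec_word [DirectSum.Decomposition 𝒲] {e : ℤ} {x : Lam R W} (hx : IsWord R 𝒲 e x) :
    lamLift (decR R 𝒲) (decW R 𝒲) x =
      DirectSum.of (fun e => lamGrading R 𝒲 e) e ⟨x, Submodule.subset_span hx⟩ := by
  induction hx with
  | base r => rw [lamLift_inR]; rfl
  | step hx hw r ih =>
    rw [map_mul, map_mul, ih, lamLift_inR, lamLift_inW, decW_of R 𝒲 hw, DirectSum.of_mul_of]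
    refine (DirectSum.of_mul_of _ _).trans ?_
    exact DirectSum.of_eq_of_gradedMonoid_eq (Sigma.subtype_ext (add_zero _) rfl)

noncomputable instance [DirectSum.Decomposition 𝒲] : GradedAlgebra (lamGrading R 𝒲) :=
  GradedAlgebra.ofAlgHom _ (lamLift (decR R 𝒲) (decW R 𝒲))
    (by
      refine lam_hom_ext (fun r => ?_) (fun w => ?_)
      · rw [AlgHom.comp_apply, lamLift_inR]
        exact DirectSum.coeAlgHom_of (lamGrading R 𝒲) 0 ⟨_, inR_mem r⟩
      · rw [AlgHom.comp_apply, lamLift_inW, AlgHom.id_apply]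
        induction w using DirectSum.Decomposition.inductionOn 𝒲 with
        | zero => simp
        | homogeneous w =>
          rw [decW_of R 𝒲 w.2]
          exact DirectSum.coeAlgHom_of (lamGrading R 𝒲) _ ⟨_, inW_mem w.2⟩
        | add w w' h h' => rw [map_add, map_add, map_add, h, h'])
    (by
      rintro e ⟨x, hx⟩
      induction hx using Submodule.span_induction with
      | mem x h => exact dec_word R 𝒲 h
      | zero => exact (map_zero _).trans (map_zero _).symm
      | add x y _ _ hx hy =>
        exact (map_add _ x y).trans ((congrArg₂ (· + ·) hx hy).trans (map_add _ _ _).symm)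
      | smul c x _ hx =>
        exact (map_smul _ c x).trans ((congrArg (c • ·) hx).trans
          (map_smul (DirectSum.lof ℂ ℤ (fun e => lamGrading R 𝒲 e) e) c _).symm))

end FreeProduct

end NCPoisson

/-! Replacing formal products and brackets of classes in `Λ^{ab}` by products and super commutators
of representatives in `Λ` gives the comparison map `P(Λ^{ab}) → gr_F(Λ)`. Another choice of
representatives, or a Poisson relation, changes the value only by something one filtration step
deeper (`ev_mem_of_PRel`). The map is onto because `F^d` is spanned by products of homogeneous
elements and Lie monomials, and it is the only candidate because the envelope is generated by its
part without brackets (`iso_ext`). What remains is injectivity (`existsUnique_iso_of_injective`).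

Injectivity is tested at one character `χ` of `R` at a time; let `𝔪` be its kernel. Smoothness lifts
the first order Taylor expansion at `χ` to a homomorphism from `R` to the tensor algebra of `𝔪/𝔪²`
modulo the `n`-th power of the augmentation ideal (`exists_coordinates`): up to order `n`, the
algebra `R` looks free at `χ`. For `p` in the envelope put `D_k(p) = k p · + {p, ·}`. Then the super
commutator of `D_1(g)` and `D_k(p)` is `D_{k+1}({g, p})` (`op_superBracket`). Hence, if coordinates
and elements of `W` act by `D_1`, a Lie monomial of length `k` in them acts by `D_k` of the
corresponding Lie monomial of the envelope. This action is defined on a truncation of the envelope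
in which elements of `𝔪` have weight 1 and brackets weight 2: there the `n`-th power of the
augmentation ideal acts by zero, so that `R`, and with it `R ∗ T(W)`, acts.

Applied to 1, a product of Lie monomials of lengths `k_1, …, k_m` gives `k_1 ⋯ k_m` times the same
product in the envelope, plus terms with more brackets (`prodVal_genOp_one`), whereas `F^{d+1}` only
produces terms with more than `d` brackets. So evaluating in `Λ` and acting on 1 induces, on the
classes with `d` brackets, a diagonalizable map with nonzero eigenvalues, which is injective
(`ker_le_ker_of_eigen`). The kernel of the comparison map therefore lies in `𝔪^N P` for all `N` and
all `χ` (`IsSmooth.mk_mem_adic`).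

Finally, the part with `d` brackets lies in a finitely generated module over a finitely generated
commutative algebra, so that the Nullstellensatz and Krull's intersection theorem leave only zero
(`IsSmooth.eq_zero_of_mem_adic`). -/

namespace NCPoisson

/-! ### The total space of the Poisson envelope -/

section Total

variable {A : Type u} [Ring A] [Algebra ℂ A] (𝒜 : ℤ → Submodule ℂ A) [SetLike.GradedMonoid 𝒜]

/-- The total space of the Poisson envelope, an associative unital algebra. -/
def PTot : Type u := PFree 𝒜 ⧸ relSpan 𝒜

noncomputable instance : AddCommGroup (PTot 𝒜) :=
  inferInstanceAs (AddCommGroup (PFree 𝒜 ⧸ relSpan 𝒜))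

noncomputable instance : Module ℂ (PTot 𝒜) :=
  inferInstanceAs (Module ℂ (PFree 𝒜 ⧸ relSpan 𝒜))

namespace PTot

/-- The quotient map from formal combinations of monomials. -/
noncomputable def mk : PFree 𝒜 →ₗ[ℂ] PTot 𝒜 := Submodule.mkQ _

variable {𝒜}

lemma mk_surjective : Function.Surjective (mk 𝒜) := Submodule.mkQ_surjective _

lemma mk_eq_zero {x : PFree 𝒜} : mk 𝒜 x = 0 ↔ x ∈ relSpan 𝒜 :=
  Submodule.Quotient.mk_eq_zero _

/-- The class of a monomial. -/
noncomputable def mon (m : PMon 𝒜) : PTot 𝒜 := mk 𝒜 m.toFree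

lemma span_mon : Submodule.span ℂ (Set.range (mon (𝒜 := 𝒜))) = ⊤ := by
  refine top_le_iff.1 fun x _ => ?_
  obtain ⟨x, rfl⟩ := mk_surjective x
  have := Submodule.mem_map_of_mem (f := mk 𝒜) (mem_span_toFree x)
  rw [Submodule.map_span, ← Set.range_comp] at this
  exact this

lemma induction {p : PTot 𝒜 → Prop} (x : PTot 𝒜) (hm : ∀ m, p (mon m)) (h0 : p 0)
    (ha : ∀ x y, p x → p y → p (x + y)) (hs : ∀ (c : ℂ) x, p x → p (c • x)) : p x := by
  have hx : x ∈ Submodule.span ℂ (Set.range (mon (𝒜 := 𝒜))) := by rw [span_mon]; trivial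
  induction hx using Submodule.span_induction with
  | mem x h => obtain ⟨m, rfl⟩ := h; exact hm m
  | zero => exact h0
  | add x y _ _ hx hy => exact ha x y hx hy
  | smul c x _ hx => exact hs c x hx

/-- The operation on the quotient induced by a bilinear operation on `PFree`. -/
noncomputable def descend (B : PFree 𝒜 →ₗ[ℂ] PFree 𝒜 →ₗ[ℂ] PFree 𝒜)
    (hl : ∀ x, ∀ y ∈ relSpan 𝒜, B x y ∈ relSpan 𝒜)
    (hr : ∀ x, ∀ y ∈ relSpan 𝒜, B y x ∈ relSpan 𝒜) :
    PTot 𝒜 →ₗ[ℂ] PTot 𝒜 →ₗ[ℂ] PTot 𝒜 :=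
  Submodule.liftQ (relSpan 𝒜)
    { toFun := fun x => Submodule.mapQ (relSpan 𝒜) (relSpan 𝒜) (B x) (hl x)
      map_add' := fun x y => by
        refine LinearMap.ext fun z => ?_
        obtain ⟨z, rfl⟩ := Submodule.Quotient.mk_surjective _ z
        exact congrArg (mk 𝒜) (LinearMap.congr_fun (map_add B x y) z)
      map_smul' := fun c x => by
        refine LinearMap.ext fun z => ?_
        obtain ⟨z, rfl⟩ := Submodule.Quotient.mk_surjective _ z
        exact congrArg (mk 𝒜) (LinearMap.congr_fun (map_smul B c x) z) }
    (fun x hx => by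
      rw [LinearMap.mem_ker]
      refine LinearMap.ext fun y => ?_
      obtain ⟨y, rfl⟩ := Submodule.Quotient.mk_surjective _ y
      exact (Submodule.Quotient.mk_eq_zero _).2 (hr y x hx))

/-- The product of the Poisson envelope. -/
noncomputable def pmul : PTot 𝒜 →ₗ[ℂ] PTot 𝒜 →ₗ[ℂ] PTot 𝒜 :=
  descend (bilinExt .mul) (fun x _ hy => mul_left_mem x hy) (fun x _ hy => mul_right_mem x hy)

/-- The bracket of the Poisson envelope. -/
noncomputable def pbr : PTot 𝒜 →ₗ[ℂ] PTot 𝒜 →ₗ[ℂ] PTot 𝒜 :=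
  descend (bilinExt .br) (fun x _ hy => br_left_mem x hy) (fun x _ hy => br_right_mem x hy)

noncomputable instance : Mul (PTot 𝒜) := ⟨fun x y => pmul x y⟩

lemma pmul_apply (x y : PTot 𝒜) : pmul x y = x * y := rfl

noncomputable instance : One (PTot 𝒜) := ⟨mon (.of 0 ⟨1, SetLike.one_mem_graded 𝒜⟩)⟩

lemma one_def : (1 : PTot 𝒜) = mon (.of 0 ⟨1, SetLike.one_mem_graded 𝒜⟩) := rfl

lemma mk_mul (x y : PFree 𝒜) : mk 𝒜 (bilinExt .mul x y) = mk 𝒜 x * mk 𝒜 y := rfl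

lemma mk_br (x y : PFree 𝒜) : mk 𝒜 (bilinExt .br x y) = pbr (mk 𝒜 x) (mk 𝒜 y) := rfl

lemma mon_mul (m n : PMon 𝒜) : mon (.mul m n) = mon m * mon n := by
  rw [mon, ← bilinExt_toFree, mk_mul]; rfl

lemma mon_br (m n : PMon 𝒜) : mon (.br m n) = pbr (mon m) (mon n) := by
  rw [mon, ← bilinExt_toFree, mk_br]; rfl

lemma rel {x y : PFree 𝒜} (h : PRel 𝒜 (x - y)) : mk 𝒜 x = mk 𝒜 y := by
  rw [← sub_eq_zero, ← map_sub]
  exact mk_eq_zero.2 (subset_relSpan h)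

lemma mon_mul_comm (m n : PMon 𝒜) : mon m * mon n = sgn m.low n.low • (mon n * mon m) := by
  rw [← mon_mul, ← mon_mul]
  exact (rel (PRel.mul_comm m n)).trans (map_smul _ _ _)

protected lemma one_mul' (x : PTot 𝒜) : 1 * x = x := by
  simp only [← pmul_apply]
  induction x using PTot.induction with
  | hm m => exact (mon_mul _ _).symm.trans (rel (PRel.one_mul m))
  | h0 => exact map_zero _
  | ha x y hx hy => rw [map_add, hx, hy]
  | hs c x hx => rw [map_smul, hx]

noncomputable instance : Ring (PTot 𝒜) where
  __ := (inferInstance : AddCommGroup (PTot 𝒜))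
  left_distrib x y z := map_add (pmul x) y z
  right_distrib x y z := LinearMap.congr_fun (map_add pmul x y) z
  zero_mul x := LinearMap.congr_fun (map_zero pmul) x
  mul_zero x := map_zero (pmul x)
  one_mul := PTot.one_mul'
  mul_one x := by
    simp only [← pmul_apply]
    induction x using PTot.induction with
    | hm m =>
      -- The relations contain only the left unit law; the right one follows by super commutativity,
      -- with trivial sign because the unit has lower degree 0.
      rw [pmul_apply, one_def, mon_mul_comm, ← one_def, PTot.one_mul', PMon.low, sgn_zero_right,
        one_smul]
    | h0 => exact LinearMap.congr_fun (map_zero pmul) 1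
    | ha x y hx hy => rw [map_add, LinearMap.add_apply, hx, hy]
    | hs c x hx => rw [map_smul, LinearMap.smul_apply, hx]
  mul_assoc x y z := by
    simp only [← pmul_apply]
    induction x using PTot.induction with
    | h0 => simp only [map_zero, LinearMap.zero_apply]
    | ha x y hx hy => simp only [map_add, LinearMap.add_apply, hx, hy]
    | hs c x hx => simp only [map_smul, LinearMap.smul_apply, hx]
    | hm m =>
      induction y using PTot.induction with
      | h0 => simp only [map_zero, LinearMap.zero_apply]
      | ha x y hx hy => simp only [map_add, LinearMap.add_apply, hx, hy]
      | hs c x hx => simp only [map_smul, LinearMap.smul_apply, hx]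
      | hm n =>
        induction z using PTot.induction with
        | h0 => simp only [map_zero]
        | ha x y hx hy => simp only [map_add, hx, hy]
        | hs c x hx => simp only [map_smul, hx]
        | hm p =>
          simp only [pmul_apply, ← mon_mul]
          exact rel (PRel.mul_assoc m n p)

noncomputable instance : Algebra ℂ (PTot 𝒜) :=
  Algebra.ofModule (fun c x y => LinearMap.congr_fun (map_smul pmul c x) y)
    (fun c x y => map_smul (pmul x) c y)

/-! #### The lower degree -/

variable (𝒜)

/-- The part of lower degree `e`. -/
noncomputable def Pl (e : ℤ) : Submodule ℂ (PTot 𝒜) := Submodule.span ℂ {x | ∃ m : PMon 𝒜, m.low = e ∧ mon m = x}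

/-- The part of upper degree `d`. -/
noncomputable def Pu (d : ℕ) : Submodule ℂ (PTot 𝒜) := Submodule.span ℂ {x | ∃ m : PMon 𝒜, m.up = d ∧ mon m = x}

variable {𝒜}

lemma mon_mem_Pl (m : PMon 𝒜) : mon m ∈ Pl 𝒜 m.low := Submodule.subset_span ⟨m, rfl, rfl⟩

lemma mon_mem_Pu (m : PMon 𝒜) : mon m ∈ Pu 𝒜 m.up := Submodule.subset_span ⟨m, rfl, rfl⟩

lemma one_mem_Pl : (1 : PTot 𝒜) ∈ Pl 𝒜 0 := mon_mem_Pl (.of 0 ⟨1, SetLike.one_mem_graded 𝒜⟩)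

lemma one_mem_Pu : (1 : PTot 𝒜) ∈ Pu 𝒜 0 := mon_mem_Pu (.of 0 ⟨1, SetLike.one_mem_graded 𝒜⟩)

lemma mul_mem_Pl {e e' : ℤ} {x y : PTot 𝒜} (hx : x ∈ Pl 𝒜 e) (hy : y ∈ Pl 𝒜 e') :
    x * y ∈ Pl 𝒜 (e + e') := by
  rw [← pmul_apply]
  refine bilin_mem_of_span _ ?_ hx hy
  rintro _ ⟨m, rfl, rfl⟩ _ ⟨n, rfl, rfl⟩
  rw [pmul_apply, ← mon_mul]
  exact mon_mem_Pl (.mul m n)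

lemma br_mem_Pl {e e' : ℤ} {x y : PTot 𝒜} (hx : x ∈ Pl 𝒜 e) (hy : y ∈ Pl 𝒜 e') :
    pbr x y ∈ Pl 𝒜 (e + e') := by
  refine bilin_mem_of_span _ ?_ hx hy
  rintro _ ⟨m, rfl, rfl⟩ _ ⟨n, rfl, rfl⟩
  rw [← mon_br]
  exact mon_mem_Pl (.br m n)

lemma mul_mem_Pu {e e' : ℕ} {x y : PTot 𝒜} (hx : x ∈ Pu 𝒜 e) (hy : y ∈ Pu 𝒜 e') :
    x * y ∈ Pu 𝒜 (e + e') := by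
  rw [← pmul_apply]
  refine bilin_mem_of_span _ ?_ hx hy
  rintro _ ⟨m, rfl, rfl⟩ _ ⟨n, rfl, rfl⟩
  rw [pmul_apply, ← mon_mul]
  exact mon_mem_Pu (.mul m n)

lemma br_mem_Pu {e e' : ℕ} {x y : PTot 𝒜} (hx : x ∈ Pu 𝒜 e) (hy : y ∈ Pu 𝒜 e') :
    pbr x y ∈ Pu 𝒜 (e + e' + 1) := by
  refine bilin_mem_of_span _ ?_ hx hy
  rintro _ ⟨m, rfl, rfl⟩ _ ⟨n, rfl, rfl⟩
  rw [← mon_br]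
  exact mon_mem_Pu (.br m n)

lemma mul_comm_of_mem {e e' : ℤ} {x y : PTot 𝒜} (hx : x ∈ Pl 𝒜 e) (hy : y ∈ Pl 𝒜 e') :
    x * y = sgn e e' • (y * x) := by
  rw [← sub_eq_zero]
  -- As the vanishing of a single bilinear map, the identity may be checked on monomials.
  change ((pmul - sgn e e' • pmul.flip : PTot 𝒜 →ₗ[ℂ] PTot 𝒜 →ₗ[ℂ] PTot 𝒜) x) y = 0
  rw [← Submodule.mem_bot ℂ]
  refine bilin_mem_of_span _ ?_ hx hy
  rintro _ ⟨m, rfl, rfl⟩ _ ⟨n, rfl, rfl⟩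
  rw [Submodule.mem_bot]
  exact sub_eq_zero.2 (mon_mul_comm m n)

lemma br_antisymm {e e' : ℤ} {x y : PTot 𝒜} (hx : x ∈ Pl 𝒜 e) (hy : y ∈ Pl 𝒜 e') :
    pbr x y = (-sgn e e') • pbr y x := by
  rw [← sub_eq_zero]
  change ((pbr - (-sgn e e') • pbr.flip : PTot 𝒜 →ₗ[ℂ] PTot 𝒜 →ₗ[ℂ] PTot 𝒜) x) y = 0
  rw [← Submodule.mem_bot ℂ]
  refine bilin_mem_of_span _ ?_ hx hy
  rintro _ ⟨m, rfl, rfl⟩ _ ⟨n, rfl, rfl⟩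
  rw [Submodule.mem_bot]
  refine (sub_eq_zero (G := PTot 𝒜)).2 ?_
  simp only [LinearMap.smul_apply, LinearMap.flip_apply, ← mon_br]
  exact (rel (PRel.antisymm m n)).trans (map_smul _ _ _)

/-- The sign involves only the degrees of `x` and `y`, so `z` need not be homogeneous. -/
lemma jacobi {e e' : ℤ} {x y : PTot 𝒜} (z : PTot 𝒜) (hx : x ∈ Pl 𝒜 e) (hy : y ∈ Pl 𝒜 e') :
    pbr x (pbr y z) = pbr (pbr x y) z + sgn e e' • pbr y (pbr x z) := by
  induction hx using Submodule.span_induction with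
  | zero => simp
  | add x y _ _ hx hy => simp only [map_add, LinearMap.add_apply, hx, hy]; module
  | smul c x _ hx => simp only [map_smul, LinearMap.smul_apply, hx]; module
  | mem x h =>
    obtain ⟨m, rfl, rfl⟩ := h
    induction hy using Submodule.span_induction with
    | zero => simp
    | add x y _ _ hx hy => simp only [map_add, LinearMap.add_apply, hx, hy]; module
    | smul c x _ hx => simp only [map_smul, LinearMap.smul_apply, hx]; module
    | mem x h =>
      obtain ⟨n, rfl, rfl⟩ := h
      induction z using PTot.induction with
      | h0 => simp
      | ha x y hx hy => simp only [map_add, hx, hy]; module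
      | hs c x hx => simp only [map_smul, hx]; module
      | hm p =>
        simp only [← mon_br]
        refine (rel (PRel.jacobi m n p)).trans ?_
        rw [map_add, map_smul]; rfl

lemma leibniz {e e' : ℤ} {x y : PTot 𝒜} (z : PTot 𝒜) (hx : x ∈ Pl 𝒜 e) (hy : y ∈ Pl 𝒜 e') :
    pbr x (y * z) = pbr x y * z + sgn e e' • (y * pbr x z) := by
  induction hx using Submodule.span_induction with
  | zero => simp
  | add x y _ _ hx hy => simp only [map_add, LinearMap.add_apply, hx, hy, add_mul, mul_add]; module
  | smul c x _ hx =>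
    simp only [map_smul, LinearMap.smul_apply, hx, smul_mul_assoc, mul_smul_comm]; module
  | mem x h =>
    obtain ⟨m, rfl, rfl⟩ := h
    induction hy using Submodule.span_induction with
    | zero => simp
    | add x y _ _ hx hy => simp only [map_add, hx, hy, add_mul]; module
    | smul c x _ hx => simp only [map_smul, hx, smul_mul_assoc]; module
    | mem x h =>
      obtain ⟨n, rfl, rfl⟩ := h
      induction z using PTot.induction with
      | h0 => simp
      | ha x y hx hy => simp only [map_add, hx, hy, mul_add]; module
      | hs c x hx => simp only [map_smul, hx, mul_smul_comm]; module
      | hm p =>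
        simp only [← mon_br, ← mon_mul]
        refine (rel (PRel.leibniz m n p)).trans ?_
        rw [map_add, map_smul]; rfl

/-- Antisymmetry turns the derivation property in the second argument into one in the first. -/
lemma leibniz_left {e e' e'' : ℤ} {x y z : PTot 𝒜} (hx : x ∈ Pl 𝒜 e) (hy : y ∈ Pl 𝒜 e')
    (hz : z ∈ Pl 𝒜 e'') : pbr (x * y) z = x * pbr y z + sgn e' e'' • (pbr x z * y) := by
  rw [br_antisymm (mul_mem_Pl hx hy) hz, leibniz y hz hx, br_antisymm hz hx, br_antisymm hz hy]
  simp only [smul_mul_assoc, mul_smul_comm, smul_add, smul_smul, sgn_add_left, sgn_comm e'' e,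
    sgn_comm e'' e']
  rcases sgn_eq e e'' with h | h <;> rcases sgn_eq e' e'' with h' | h' <;> rw [h, h'] <;> module

/-- Elements of lower degree `0` are central. -/
lemma comm_of_mem_zero {x : PTot 𝒜} (hx : x ∈ Pl 𝒜 0) (y : PTot 𝒜) : x * y = y * x := by
  induction y using PTot.induction with
  | h0 => simp
  | ha x y hx hy => rw [mul_add, add_mul, hx, hy]
  | hs c x hx => rw [mul_smul_comm, smul_mul_assoc, hx]
  | hm m => rw [mul_comm_of_mem hx (mon_mem_Pl m), sgn_zero_left, one_smul]

lemma leibniz_zero {y : PTot 𝒜} (hy : y ∈ Pl 𝒜 0) (x z : PTot 𝒜) :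
    pbr x (y * z) = pbr x y * z + y * pbr x z := by
  induction x using PTot.induction with
  | h0 => simp
  | ha x y hx hy => simp only [map_add, LinearMap.add_apply, hx, hy, add_mul, mul_add]; abel
  | hs c x hx => simp only [map_smul, LinearMap.smul_apply, hx, smul_mul_assoc, mul_smul_comm, smul_add]
  | hm m => rw [leibniz z (mon_mem_Pl m) hy, sgn_zero_right, one_smul]

/-- Writing the last term as `y * pbr x z` absorbs the sign, which makes the formula valid for
inhomogeneous `y` and `z`. -/
lemma leibniz_left_zero {x : PTot 𝒜} (hx : x ∈ Pl 𝒜 0) (y z : PTot 𝒜) :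
    pbr (x * y) z = x * pbr y z + y * pbr x z := by
  induction y using PTot.induction with
  | h0 => simp
  | ha x y hx hy => simp only [map_add, LinearMap.add_apply, hx, hy, add_mul, mul_add]; abel
  | hs c x hx => simp only [map_smul, LinearMap.smul_apply, hx, smul_mul_assoc, mul_smul_comm, smul_add]
  | hm m =>
    induction z using PTot.induction with
    | h0 => simp
    | ha x y hx hy => simp only [map_add, hx, hy, mul_add]; abel
    | hs c x hx => simp only [map_smul, hx, mul_smul_comm, smul_add]
    | hm n =>
      rw [leibniz_left hx (mon_mem_Pl m) (mon_mem_Pl n),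
        mul_comm_of_mem (br_mem_Pl hx (mon_mem_Pl n)) (mon_mem_Pl m), smul_smul, zero_add,
        sgn_comm, sgn_mul_self, one_smul]

/-! #### The upper degree -/

variable (𝒜) in
/-- Projection to the part of upper degree `d`, on formal combinations of monomials. -/
noncomputable def projF (d : ℕ) : PFree 𝒜 →ₗ[ℂ] PFree 𝒜 :=
  Finsupp.linearCombination ℂ fun m => if m.up = d then m.toFree else 0

omit [SetLike.GradedMonoid 𝒜] in
lemma projF_toFree (d : ℕ) (m : PMon 𝒜) :
    projF 𝒜 d m.toFree = if m.up = d then m.toFree else 0 := by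
  rw [projF, PMon.toFree, Finsupp.linearCombination_single, one_smul]; rfl

omit [SetLike.GradedMonoid 𝒜] in
lemma toFree_mem_monSpan {m : PMon 𝒜} {d : ℕ} {e : ℤ} (h : m.up = d) (h' : m.low = e) :
    m.toFree ∈ monSpan 𝒜 d e := Submodule.subset_span ⟨m, h, h', rfl⟩

omit [SetLike.GradedMonoid 𝒜] in
lemma projF_of_mem {d d' : ℕ} {e : ℤ} {x : PFree 𝒜} (hx : x ∈ monSpan 𝒜 d e) :
    projF 𝒜 d' x = if d = d' then x else 0 := by
  induction hx using Submodule.span_induction with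
  | zero => simp
  | add x y _ _ hx hy => rw [map_add, hx, hy]; split_ifs <;> simp
  | smul c x _ hx => rw [map_smul, hx]; split_ifs <;> simp
  | mem x h => obtain ⟨m, rfl, rfl, rfl⟩ := h; exact projF_toFree d' m

/-- Both sides of every relation have the same bidegree. Hence the span of the relations is stable
under the projections to a fixed number of brackets, and these descend to the quotient. -/
lemma _root_.NCPoisson.PRel.homogeneous {x : PFree 𝒜} (h : PRel 𝒜 x) :
    ∃ d e, x ∈ monSpan 𝒜 d e := by
  induction h with
  | of_add e a b =>
    exact ⟨0, e, Submodule.sub_mem _ (toFree_mem (.of e _))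
      (Submodule.add_mem _ (toFree_mem (.of e _)) (toFree_mem (.of e _)))⟩
  | of_smul e c a =>
    exact ⟨0, e, Submodule.sub_mem _ (toFree_mem (.of e _))
      (Submodule.smul_mem _ _ (toFree_mem (.of e _)))⟩
  | of_mul e e' a b =>
    exact ⟨0, e + e', Submodule.sub_mem _ (toFree_mem (.mul (.of e _) (.of e' _)))
      (toFree_mem (.of _ _))⟩
  | one_mul m =>
    exact ⟨m.up, m.low, Submodule.sub_mem _ (toFree_mem_monSpan (by simp [PMon.up])
      (by simp [PMon.low])) (toFree_mem m)⟩
  | mul_assoc m n p =>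
    exact ⟨_, _, Submodule.sub_mem _ (toFree_mem _)
      (toFree_mem_monSpan (by simp [PMon.up]; omega) (by simp [PMon.low]; ring))⟩
  | mul_comm m n =>
    exact ⟨_, _, Submodule.sub_mem _ (toFree_mem _) (Submodule.smul_mem _ _
      (toFree_mem_monSpan (by simp [PMon.up]; omega) (by simp [PMon.low]; ring)))⟩
  | antisymm m n =>
    exact ⟨_, _, Submodule.sub_mem _ (toFree_mem _) (Submodule.smul_mem _ _
      (toFree_mem_monSpan (by simp [PMon.up]; omega) (by simp [PMon.low]; ring)))⟩
  | jacobi m n p =>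
    exact ⟨_, _, Submodule.sub_mem _ (toFree_mem _) (Submodule.add_mem _
      (toFree_mem_monSpan (by simp [PMon.up]; omega) (by simp [PMon.low]; ring))
      (Submodule.smul_mem _ _
      (toFree_mem_monSpan (by simp [PMon.up]; omega) (by simp [PMon.low]; ring))))⟩
  | leibniz m n p =>
    exact ⟨_, _, Submodule.sub_mem _ (toFree_mem _) (Submodule.add_mem _
      (toFree_mem_monSpan (by simp [PMon.up]; omega) (by simp [PMon.low]; ring))
      (Submodule.smul_mem _ _
      (toFree_mem_monSpan (by simp [PMon.up]; omega) (by simp [PMon.low]; ring))))⟩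
  | mul_left m hx ih =>
    obtain ⟨d, e, ih⟩ := ih
    exact ⟨_, _, mul_mem_monSpan (toFree_mem m) ih⟩
  | mul_right m hx ih =>
    obtain ⟨d, e, ih⟩ := ih
    exact ⟨_, _, mul_mem_monSpan ih (toFree_mem m)⟩
  | br_left m hx ih =>
    obtain ⟨d, e, ih⟩ := ih
    exact ⟨_, _, br_mem_monSpan (toFree_mem m) ih⟩
  | br_right m hx ih =>
    obtain ⟨d, e, ih⟩ := ih
    exact ⟨_, _, br_mem_monSpan ih (toFree_mem m)⟩

lemma projF_mem_relSpan (d : ℕ) {x : PFree 𝒜} (hx : x ∈ relSpan 𝒜) : projF 𝒜 d x ∈ relSpan 𝒜 := by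
  induction hx using Submodule.span_induction with
  | zero => simp
  | add x y _ _ hx hy => rw [map_add]; exact Submodule.add_mem _ hx hy
  | smul c x _ hx => rw [map_smul]; exact Submodule.smul_mem _ c hx
  | mem x h =>
    obtain ⟨d', e, h'⟩ := PRel.homogeneous h
    rw [projF_of_mem h']
    split_ifs
    · exact subset_relSpan h
    · exact Submodule.zero_mem _

variable (𝒜) in
/-- Projection to the part of upper degree `d`. -/
noncomputable def proj (d : ℕ) : PTot 𝒜 →ₗ[ℂ] PTot 𝒜 :=
  Submodule.mapQ (relSpan 𝒜) (relSpan 𝒜) (projF 𝒜 d) fun _ hx => projF_mem_relSpan d hx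

lemma proj_mk (d : ℕ) (x : PFree 𝒜) : proj 𝒜 d (mk 𝒜 x) = mk 𝒜 (projF 𝒜 d x) := rfl

lemma proj_mon (d : ℕ) (m : PMon 𝒜) : proj 𝒜 d (mon m) = if m.up = d then mon m else 0 := by
  rw [mon, proj_mk, projF_toFree]; split_ifs <;> simp

lemma proj_of_mem {d d' : ℕ} {x : PTot 𝒜} (hx : x ∈ Pu 𝒜 d) :
    proj 𝒜 d' x = if d = d' then x else 0 := by
  induction hx using Submodule.span_induction with
  | zero => simp
  | add x y _ _ hx hy => rw [map_add, hx, hy]; split_ifs <;> simp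
  | smul c x _ hx => rw [map_smul, hx]; split_ifs <;> simp
  | mem x h => obtain ⟨m, rfl, rfl⟩ := h; exact proj_mon d' m

lemma proj_self {d : ℕ} {x : PTot 𝒜} (hx : x ∈ Pu 𝒜 d) : proj 𝒜 d x = x := by
  rw [proj_of_mem hx, if_pos rfl]

lemma proj_mem (d : ℕ) (x : PTot 𝒜) : proj 𝒜 d x ∈ Pu 𝒜 d := by
  induction x using PTot.induction with
  | h0 => simp
  | ha x y hx hy => rw [map_add]; exact Submodule.add_mem _ hx hy
  | hs c x hx => rw [map_smul]; exact Submodule.smul_mem _ _ hx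
  | hm m =>
    rw [proj_mon]
    split_ifs with h
    · exact h ▸ mon_mem_Pu m
    · exact Submodule.zero_mem _

/-- The product with an element of upper degree `i` shifts the upper degree by `i`. -/
lemma proj_mul {i : ℕ} {p : PTot 𝒜} (hp : p ∈ Pu 𝒜 i) (q : PTot 𝒜) (j : ℕ) :
    proj 𝒜 j (p * q) = if i ≤ j then p * proj 𝒜 (j - i) q else 0 := by
  induction q using PTot.induction with
  | h0 => simp
  | ha x y hx hy => rw [mul_add, map_add, hx, hy]; split_ifs <;> simp [mul_add]
  | hs c x hx => rw [mul_smul_comm, map_smul, hx]; split_ifs <;> simp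
  | hm m =>
    rw [proj_of_mem (mul_mem_Pu hp (mon_mem_Pu m)), proj_mon]
    split_ifs <;> first | omega | simp

/-- The bracket with an element of upper degree `i` shifts the upper degree by `i + 1`. -/
lemma proj_br {i : ℕ} {p : PTot 𝒜} (hp : p ∈ Pu 𝒜 i) (q : PTot 𝒜) (j : ℕ) :
    proj 𝒜 j (pbr p q) = if i + 1 ≤ j then pbr p (proj 𝒜 (j - (i + 1)) q) else 0 := by
  induction q using PTot.induction with
  | h0 => simp
  | ha x y hx hy => rw [map_add, map_add, hx, hy]; split_ifs <;> simp
  | hs c x hx => rw [map_smul, map_smul, hx]; split_ifs <;> simp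
  | hm m =>
    rw [proj_of_mem (br_mem_Pu hp (mon_mem_Pu m)), proj_mon]
    split_ifs <;> first | omega | simp

end PTot

end Total

end NCPoisson

namespace NCPoisson

/-! ### Products of Lie monomials -/

section LieProducts

/-- A family of brackets `br e e'` on an algebra that satisfies the super Leibniz and Jacobi
identities on the elements of the given parts. -/
structure SuperLeibniz {X : Type*} [Ring X] [Algebra ℂ X] (H : ℤ → Submodule ℂ X)
    (br : ℤ → ℤ → X →ₗ[ℂ] X →ₗ[ℂ] X) : Prop where
  one_mem : (1 : X) ∈ H 0
  mul_mem : ∀ {e e' : ℤ} {x y : X}, x ∈ H e → y ∈ H e' → x * y ∈ H (e + e')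
  br_mem : ∀ {e e' : ℤ} {x y : X}, x ∈ H e → y ∈ H e' → br e e' x y ∈ H (e + e')
  leib : ∀ {e e' e'' : ℤ} {x y z : X}, x ∈ H e → y ∈ H e' → z ∈ H e'' →
    br e (e' + e'') x (y * z) = br e e' x y * z + sgn e e' • (y * br e e'' x z)
  leib_left : ∀ {e e' e'' : ℤ} {x y z : X}, x ∈ H e → y ∈ H e' → z ∈ H e'' →
    br (e + e') e'' (x * y) z = x * br e' e'' y z + sgn e' e'' • (br e e'' x z * y)
  jacobi : ∀ {e e' e'' : ℤ} {x y z : X}, x ∈ H e → y ∈ H e' → z ∈ H e'' →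
    br e (e' + e'') x (br e' e'' y z) =
      br (e + e') e'' (br e e' x y) z + sgn e e' • br e' (e + e'') y (br e e'' x z)

/-- The identities for `x y - (±1) y x` are formal in the signs, whatever the elements are, so all
parts may be taken to be the whole algebra. -/
lemma superLeibniz_superBracket (X : Type*) [Ring X] [Algebra ℂ X] :
    SuperLeibniz (fun _ => (⊤ : Submodule ℂ X)) (superBracket X) where
  one_mem := trivial
  mul_mem := fun _ _ => trivial
  br_mem := fun _ _ => trivial
  leib := by
    intro e e' e'' x y z _ _ _
    simp only [superBracket_apply, sgn_add_right, mul_sub, sub_mul,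
      mul_smul_comm, smul_mul_assoc, mul_assoc]
    module
  leib_left := by
    intro e e' e'' x y z _ _ _
    simp only [superBracket_apply, sgn_add_left, mul_sub, sub_mul,
      mul_smul_comm, smul_mul_assoc, mul_assoc]
    module
  jacobi := by
    intro e e' e'' x y z _ _ _
    simp only [superBracket_apply, sgn_add_left, sgn_add_right, sgn_comm e' e, mul_sub, sub_mul,
      mul_smul_comm, smul_mul_assoc, mul_assoc]
    rcases sgn_eq e e' with h | h <;> rw [h] <;> module

lemma superLeibniz_PTot {A : Type u} [Ring A] [Algebra ℂ A] (𝒜 : ℤ → Submodule ℂ A)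
    [SetLike.GradedMonoid 𝒜] : SuperLeibniz (PTot.Pl 𝒜) (fun _ _ => PTot.pbr) where
  one_mem := PTot.one_mem_Pl
  mul_mem := PTot.mul_mem_Pl
  br_mem := PTot.br_mem_Pl
  leib := fun hx hy _ => PTot.leibniz _ hx hy
  leib_left := PTot.leibniz_left
  jacobi := fun hx hy _ => PTot.jacobi _ hx hy

variable {Γ : Type*} (deg : Γ → ℤ)

/-- The degree of the Lie monomial with the entries of `l` followed by `x`. -/
def lieDeg (x : Γ) : List Γ → ℤ
  | [] => deg x
  | y :: l => deg y + lieDeg x l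

/-- The total degree of a product of Lie monomials. -/
def prodDeg : List (Γ × List Γ) → ℤ
  | [] => 0
  | p :: M => lieDeg deg p.1 p.2 + prodDeg M

/-- The number of brackets in a product of Lie monomials. -/
def prodUp : List (Γ × List Γ) → ℕ
  | [] => 0
  | p :: M => p.2.length + prodUp M

/-- The product of the lengths of the factors of a product of Lie monomials. -/
def prodLen : List (Γ × List Γ) → ℕ
  | [] => 1
  | p :: M => (p.2.length + 1) * prodLen M

lemma prodLen_ne_zero (M : List (Γ × List Γ)) : prodLen M ≠ 0 := by
  induction M with
  | nil => simp [prodLen]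
  | cons p M ih => simp [prodLen, ih]

variable {X : Type*} [Ring X] [Algebra ℂ X] (br : ℤ → ℤ → X →ₗ[ℂ] X →ₗ[ℂ] X) (g : Γ → X)

/-- The right normed Lie monomial `[l₁, [l₂, …, [lₙ, x]…]]` in the generators `g`. -/
def lieVal (x : Γ) : List Γ → X
  | [] => g x
  | y :: l => br (deg y) (lieDeg deg x l) (g y) (lieVal x l)

/-- A product of Lie monomials. -/
def prodVal : List (Γ × List Γ) → X
  | [] => 1
  | p :: M => lieVal deg br g p.1 p.2 * prodVal M

lemma prodDeg_append (M N : List (Γ × List Γ)) :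
    prodDeg deg (M ++ N) = prodDeg deg M + prodDeg deg N := by
  induction M with
  | nil => simp [prodDeg]
  | cons p M ih => simp [prodDeg, ih, add_assoc]

lemma prodUp_append (M N : List (Γ × List Γ)) : prodUp (M ++ N) = prodUp M + prodUp N := by
  induction M with
  | nil => simp [prodUp]
  | cons p M ih => simp [prodUp, ih, add_assoc]

lemma prodVal_append (M N : List (Γ × List Γ)) :
    prodVal deg br g (M ++ N) = prodVal deg br g M * prodVal deg br g N := by
  induction M with
  | nil => simp [prodVal]
  | cons p M ih => simp [prodVal, ih, mul_assoc]

/-- The span of the Lie monomials of degree `e` with `k` brackets. -/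
def lieGen (k : ℕ) (e : ℤ) : Submodule ℂ X :=
  Submodule.span ℂ {z | ∃ x l, l.length = k ∧ lieDeg deg x l = e ∧ lieVal deg br g x l = z}

/-- The span of the products of Lie monomials of degree `e` with `d` brackets. -/
def prodGen (d : ℕ) (e : ℤ) : Submodule ℂ X :=
  Submodule.span ℂ {z | ∃ M, prodUp M = d ∧ prodDeg deg M = e ∧ prodVal deg br g M = z}

variable {deg br g}

lemma lieGen_cast {k k' : ℕ} {e e' : ℤ} {x : X} (h : x ∈ lieGen deg br g k e) (hk : k = k')
    (he : e = e') : x ∈ lieGen deg br g k' e' := by subst hk he; exact h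

lemma prodGen_cast {k k' : ℕ} {e e' : ℤ} {x : X} (h : x ∈ prodGen deg br g k e) (hk : k = k')
    (he : e = e') : x ∈ prodGen deg br g k' e' := by subst hk he; exact h

lemma prodVal_mem_prodGen (M : List (Γ × List Γ)) :
    prodVal deg br g M ∈ prodGen deg br g (prodUp M) (prodDeg deg M) :=
  Submodule.subset_span ⟨M, rfl, rfl, rfl⟩

lemma one_mem_prodGen : (1 : X) ∈ prodGen deg br g 0 0 := prodVal_mem_prodGen []

lemma lieGen_le_prodGen (k : ℕ) (e : ℤ) : lieGen deg br g k e ≤ prodGen deg br g k e := by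
  refine Submodule.span_mono ?_
  rintro _ ⟨x, l, rfl, rfl, rfl⟩
  exact ⟨[(x, l)], by simp [prodUp], by simp [prodDeg], by simp [prodVal]⟩

lemma gen_mem_prodGen (x : Γ) : g x ∈ prodGen deg br g 0 (deg x) :=
  lieGen_le_prodGen _ _ (Submodule.subset_span ⟨x, [], rfl, rfl, rfl⟩)

lemma mul_mem_prodGen {d d' : ℕ} {e e' : ℤ} {x y : X} (hx : x ∈ prodGen deg br g d e)
    (hy : y ∈ prodGen deg br g d' e') : x * y ∈ prodGen deg br g (d + d') (e + e') := by
  refine bilin_mem_of_span (LinearMap.mul ℂ X) ?_ hx hy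
  rintro _ ⟨M, rfl, rfl, rfl⟩ _ ⟨N, rfl, rfl, rfl⟩
  exact Submodule.subset_span ⟨M ++ N, prodUp_append M N, prodDeg_append deg M N,
    prodVal_append deg br g M N⟩

variable {H : ℤ → Submodule ℂ X} (hH : SuperLeibniz H br) (hg : ∀ x, g x ∈ H (deg x))

include hH

/-- The Leibniz rule for `1 * 1` reads `{x, 1} = {x, 1} + {x, 1}`. -/
lemma SuperLeibniz.br_one {e : ℤ} {x : X} (hx : x ∈ H e) : br e 0 x 1 = 0 := by
  have h := hH.leib hx hH.one_mem hH.one_mem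
  simpa using h

lemma SuperLeibniz.one_br {e : ℤ} {x : X} (hx : x ∈ H e) : br 0 e 1 x = 0 := by
  have h := hH.leib_left hH.one_mem hH.one_mem hx
  simpa using h

include hg

lemma lieVal_mem (x : Γ) (l : List Γ) : lieVal deg br g x l ∈ H (lieDeg deg x l) := by
  induction l with
  | nil => exact hg x
  | cons y l ih => exact hH.br_mem (hg y) ih

lemma lieGen_le (k : ℕ) (e : ℤ) : lieGen deg br g k e ≤ H e := by
  refine Submodule.span_le.2 ?_
  rintro _ ⟨x, l, rfl, rfl, rfl⟩
  exact lieVal_mem hH hg x l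

lemma prodVal_mem (M : List (Γ × List Γ)) : prodVal deg br g M ∈ H (prodDeg deg M) := by
  induction M with
  | nil => exact hH.one_mem
  | cons p M ih => exact hH.mul_mem (lieVal_mem hH hg _ _) ih

omit hH hg in
lemma br_gen_lieGen (x : Γ) {k : ℕ} {e : ℤ} {y : X} (hy : y ∈ lieGen deg br g k e) :
    br (deg x) e (g x) y ∈ lieGen deg br g (k + 1) (deg x + e) := by
  induction hy using Submodule.span_induction with
  | zero => simp
  | add y z _ _ hy hz => rw [map_add]; exact Submodule.add_mem _ hy hz
  | smul c y _ hy => rw [map_smul]; exact Submodule.smul_mem _ c hy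
  | mem y h =>
    obtain ⟨z, l, rfl, rfl, rfl⟩ := h
    exact Submodule.subset_span ⟨z, x :: l, rfl, rfl, rfl⟩

/-- Right normed monomials suffice because Jacobi rewrites `{{z, v}, y}` as `{z, {v, y}} ∓ {v, {z,
y}}`, where the left entry `v` is shorter; the induction is on the left entry for all `y`. -/
lemma br_lieVal_lieGen (x : Γ) (l : List Γ) {k : ℕ} {e : ℤ} {y : X}
    (hy : y ∈ lieGen deg br g k e) :
    br (lieDeg deg x l) e (lieVal deg br g x l) y ∈
      lieGen deg br g (l.length + k + 1) (lieDeg deg x l + e) := by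
  induction l generalizing k e y with
  | nil => exact lieGen_cast (br_gen_lieGen x hy) (by simp) rfl
  | cons z l ih =>
    have hj := hH.jacobi (hg z) (lieVal_mem hH hg x l) (lieGen_le hH hg k e hy)
    rw [← sub_eq_iff_eq_add] at hj
    rw [lieVal, lieDeg, ← hj]
    refine Submodule.sub_mem _ ?_ (Submodule.smul_mem _ _ ?_)
    · exact lieGen_cast (br_gen_lieGen z (ih hy)) (by simp; omega) (by ring)
    · exact lieGen_cast (ih (br_gen_lieGen z hy)) (by simp; omega) (by ring)

lemma br_lieVal_prodVal (x : Γ) (l : List Γ) (M : List (Γ × List Γ)) :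
    br (lieDeg deg x l) (prodDeg deg M) (lieVal deg br g x l) (prodVal deg br g M) ∈
      prodGen deg br g (l.length + prodUp M + 1) (lieDeg deg x l + prodDeg deg M) := by
  induction M with
  | nil =>
    rw [prodDeg, prodVal, hH.br_one (lieVal_mem hH hg x l)]
    exact Submodule.zero_mem _
  | cons p M ih =>
    rw [prodDeg, prodVal, hH.leib (lieVal_mem hH hg x l) (lieVal_mem hH hg _ _)
      (prodVal_mem hH hg M)]
    have hp : lieVal deg br g p.1 p.2 ∈ lieGen deg br g p.2.length (lieDeg deg p.1 p.2) :=
      Submodule.subset_span ⟨_, _, rfl, rfl, rfl⟩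
    refine Submodule.add_mem _ ?_ (Submodule.smul_mem _ _ ?_)
    · exact prodGen_cast (mul_mem_prodGen (lieGen_le_prodGen _ _ (br_lieVal_lieGen hH hg x l hp))
        (prodVal_mem_prodGen M)) (by simp [prodUp]; omega) (by ring)
    · exact prodGen_cast (mul_mem_prodGen (lieGen_le_prodGen _ _ hp) ih)
        (by simp [prodUp]; omega) (by ring)

lemma br_prodVal_prodVal (M N : List (Γ × List Γ)) :
    br (prodDeg deg M) (prodDeg deg N) (prodVal deg br g M) (prodVal deg br g N) ∈
      prodGen deg br g (prodUp M + prodUp N + 1) (prodDeg deg M + prodDeg deg N) := by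
  induction M with
  | nil =>
    rw [prodDeg, prodVal, hH.one_br (prodVal_mem hH hg N)]
    exact Submodule.zero_mem _
  | cons p M ih =>
    rw [prodDeg, prodVal, hH.leib_left (lieVal_mem hH hg _ _) (prodVal_mem hH hg M)
      (prodVal_mem hH hg N)]
    have hp : lieVal deg br g p.1 p.2 ∈ lieGen deg br g p.2.length (lieDeg deg p.1 p.2) :=
      Submodule.subset_span ⟨_, _, rfl, rfl, rfl⟩
    refine Submodule.add_mem _ ?_ (Submodule.smul_mem _ _ ?_)
    · exact prodGen_cast (mul_mem_prodGen (lieGen_le_prodGen _ _ hp) ih)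
        (by simp [prodUp]; omega) (by ring)
    · exact prodGen_cast (mul_mem_prodGen (br_lieVal_prodVal hH hg p.1 p.2 N)
        (prodVal_mem_prodGen M)) (by simp [prodUp]; omega) (by ring)

/-- The products of Lie monomials span a subspace that is closed under the bracket. -/
lemma br_mem_prodGen {d d' : ℕ} {e e' : ℤ} {x y : X} (hx : x ∈ prodGen deg br g d e)
    (hy : y ∈ prodGen deg br g d' e') :
    br e e' x y ∈ prodGen deg br g (d + d' + 1) (e + e') := by
  refine bilin_mem_of_span (br e e') ?_ hx hy
  rintro _ ⟨M, rfl, rfl, rfl⟩ _ ⟨N, rfl, rfl, rfl⟩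
  exact br_prodVal_prodVal hH hg M N

end LieProducts

end NCPoisson

namespace NCPoisson

/-! ### Evaluation of Poisson monomials in the filtered algebra -/

section Evaluation

/-- Two bilinear maps that agree on spanning sets are equal. -/
lemma bilin_eq_of_span {M N : Type*} [AddCommGroup M] [Module ℂ M] [AddCommGroup N] [Module ℂ N]
    (B C : M →ₗ[ℂ] M →ₗ[ℂ] N) {s t : Set M} (h : ∀ x ∈ s, ∀ y ∈ t, B x y = C x y) {x y : M}
    (hx : x ∈ Submodule.span ℂ s) (hy : y ∈ Submodule.span ℂ t) : B x y = C x y := by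
  induction hx using Submodule.span_induction with
  | zero => simp
  | add x x' _ _ hx hx' => simp only [map_add, LinearMap.add_apply, hx, hx']
  | smul c x _ hx => simp only [map_smul, LinearMap.smul_apply, hx]
  | mem x hx =>
    induction hy using Submodule.span_induction with
    | zero => simp
    | add x x' _ _ hx hx' => simp only [map_add, hx, hx']
    | smul c x _ hx => simp only [map_smul, hx]
    | mem y hy => exact h x hx y hy

variable {Λ : Type u} [Ring Λ] [Algebra ℂ Λ] {𝒜 : ℤ → Submodule ℂ Λ} [GradedAlgebra 𝒜]

/-- A homogeneous representative of an element of the abelianization. -/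
noncomputable def abelSec {e : ℤ} (a : abelGrading 𝒜 e) : 𝒜 e :=
  ⟨a.2.choose, a.2.choose_spec.1⟩

omit [GradedAlgebra 𝒜] in
lemma mk_abelSec {e : ℤ} (a : abelGrading 𝒜 e) :
    Ideal.Quotient.mkₐ ℂ (ncIdeal 𝒜 1) (abelSec a : Λ) = a := a.2.choose_spec.2

/-- This makes the arbitrary choice of representatives in `abelSec` harmless: it affects values only
one filtration step deeper. -/
lemma sub_mem_ncSp_one {e : ℤ} {x y : Λ} (hx : x ∈ 𝒜 e) (hy : y ∈ 𝒜 e)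
    (h : Ideal.Quotient.mkₐ ℂ (ncIdeal 𝒜 1) x = Ideal.Quotient.mkₐ ℂ (ncIdeal 𝒜 1) y) :
    x - y ∈ ncSp 𝒜 1 e :=
  ncSp_of ⟨Ideal.Quotient.eq.1 h, Submodule.sub_mem _ hx hy⟩

/-- The value in `Λ` of a Poisson monomial, for chosen representatives of the generators. -/
noncomputable def evMon : PMon (abelGrading 𝒜) → Λ
  | .of _ a => abelSec a
  | .mul m n => evMon m * evMon n
  | .br m n => superBracket Λ m.low n.low (evMon m) (evMon n)

variable (𝒜) in
/-- The linear extension of `evMon`. -/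
noncomputable def ev : PFree (abelGrading 𝒜) →ₗ[ℂ] Λ := Finsupp.linearCombination ℂ evMon

omit [GradedAlgebra 𝒜] in
lemma ev_toFree (m : PMon (abelGrading 𝒜)) : ev 𝒜 m.toFree = evMon m := by
  rw [ev, PMon.toFree, Finsupp.linearCombination_single, one_smul]

lemma evMon_mem (m : PMon (abelGrading 𝒜)) : evMon m ∈ ncSp 𝒜 m.up m.low := by
  induction m with
  | of e a => exact mem_ncSp_of_mem (abelSec a).2
  | mul m n hm hn => exact mem_ncSp_mul hm hn
  | br m n hm hn => exact bracket_ncSp hm hn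

lemma ev_mem {d : ℕ} {e : ℤ} {x : PFree (abelGrading 𝒜)} (hx : x ∈ monSpan (abelGrading 𝒜) d e) :
    ev 𝒜 x ∈ ncSp 𝒜 d e := by
  have : monSpan (abelGrading 𝒜) d e ≤ (ncSp 𝒜 d e).comap (ev 𝒜) := by
    refine Submodule.span_le.2 ?_
    rintro _ ⟨m, rfl, rfl, rfl⟩
    rw [SetLike.mem_coe, Submodule.mem_comap, ev_toFree]
    exact evMon_mem m
  exact this hx

omit [GradedAlgebra 𝒜] in
lemma ev_mul (x y : PFree (abelGrading 𝒜)) : ev 𝒜 (bilinExt .mul x y) = ev 𝒜 x * ev 𝒜 y := by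
  refine bilin_eq_of_span ((bilinExt .mul).compr₂ (ev 𝒜))
    ((LinearMap.mul ℂ Λ).compl₁₂ (ev 𝒜) (ev 𝒜)) ?_ (mem_span_toFree x) (mem_span_toFree y)
  rintro _ ⟨m, rfl⟩ _ ⟨n, rfl⟩
  simp [bilinExt_toFree, ev_toFree, evMon]

omit [GradedAlgebra 𝒜] in
lemma ev_br {d d' : ℕ} {e e' : ℤ} {x y : PFree (abelGrading 𝒜)}
    (hx : x ∈ monSpan (abelGrading 𝒜) d e) (hy : y ∈ monSpan (abelGrading 𝒜) d' e') :
    ev 𝒜 (bilinExt .br x y) = superBracket Λ e e' (ev 𝒜 x) (ev 𝒜 y) := by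
  refine bilin_eq_of_span ((bilinExt .br).compr₂ (ev 𝒜))
    ((superBracket Λ e e').compl₁₂ (ev 𝒜) (ev 𝒜)) ?_ hx hy
  rintro _ ⟨m, rfl, rfl, rfl⟩ _ ⟨n, rfl, rfl, rfl⟩
  simp [bilinExt_toFree, ev_toFree, evMon]

/-- Associativity, antisymmetry, Jacobi and Leibniz hold exactly in `Λ`. The relations on generators
and the unit law fail by a factor in `F^1`, coming from the choice of representatives, and super
commutativity fails by a super commutator; each gains one filtration step. Products and brackets
preserve the gain. -/
lemma ev_mem_of_PRel {x : PFree (abelGrading 𝒜)} (h : PRel (abelGrading 𝒜) x) :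
    ∃ d e, x ∈ monSpan (abelGrading 𝒜) d e ∧ ev 𝒜 x ∈ ncSp 𝒜 (d + 1) e := by
  induction h with
  | of_add e a b =>
    refine ⟨0, e, Submodule.sub_mem _ (toFree_mem (.of e _))
      (Submodule.add_mem _ (toFree_mem (.of e _)) (toFree_mem (.of e _))), ?_⟩
    simp only [map_sub, map_add, ev_toFree, evMon]
    refine sub_mem_ncSp_one (abelSec _).2 (Submodule.add_mem _ (abelSec _).2 (abelSec _).2) ?_
    simp only [map_add, mk_abelSec]; rfl
  | of_smul e c a =>
    refine ⟨0, e, Submodule.sub_mem _ (toFree_mem (.of e _))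
      (Submodule.smul_mem _ _ (toFree_mem (.of e _))), ?_⟩
    simp only [map_sub, map_smul, ev_toFree, evMon]
    refine sub_mem_ncSp_one (abelSec _).2 (Submodule.smul_mem _ _ (abelSec _).2) ?_
    simp only [map_smul, mk_abelSec]; rfl
  | of_mul e e' a b =>
    refine ⟨0, e + e', Submodule.sub_mem _ (toFree_mem (.mul (.of e _) (.of e' _)))
      (toFree_mem (.of _ _)), ?_⟩
    simp only [map_sub, ev_toFree, evMon]
    refine sub_mem_ncSp_one (SetLike.mul_mem_graded (abelSec _).2 (abelSec _).2) (abelSec _).2 ?_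
    simp only [map_mul, mk_abelSec]
  | one_mul m =>
    refine ⟨m.up, m.low, Submodule.sub_mem _ (PTot.toFree_mem_monSpan (by simp [PMon.up])
      (by simp [PMon.low])) (toFree_mem m), ?_⟩
    simp only [map_sub, ev_toFree, evMon]
    rw [← sub_one_mul]
    refine ncSp_cast (mem_ncSp_mul (sub_mem_ncSp_one (abelSec _).2 (SetLike.one_mem_graded 𝒜) ?_)
      (evMon_mem m)) (add_comm _ _) (zero_add _)
    rw [mk_abelSec, map_one]
  | mul_assoc m n p =>
    refine ⟨_, _, Submodule.sub_mem _ (toFree_mem _)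
      (PTot.toFree_mem_monSpan (by simp [PMon.up]; omega) (by simp [PMon.low]; ring)), ?_⟩
    exact mem_of_eq_zero (by simp [ev_toFree, evMon, mul_assoc])
  | mul_comm m n =>
    refine ⟨_, _, Submodule.sub_mem _ (toFree_mem _) (Submodule.smul_mem _ _
      (PTot.toFree_mem_monSpan (by simp [PMon.up]; omega) (by simp [PMon.low]; ring))), ?_⟩
    simp only [map_sub, map_smul, ev_toFree, evMon]
    exact bracket_ncSp (evMon_mem m) (evMon_mem n)
  | antisymm m n =>
    refine ⟨_, _, Submodule.sub_mem _ (toFree_mem _) (Submodule.smul_mem _ _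
      (PTot.toFree_mem_monSpan (by simp [PMon.up]; omega) (by simp [PMon.low]; ring))), ?_⟩
    refine mem_of_eq_zero ?_
    simp only [map_sub, map_smul, ev_toFree, evMon, superBracket_apply, sgn_comm n.low m.low]
    rcases sgn_eq m.low n.low with h | h <;> rw [h] <;> module
  | jacobi m n p =>
    refine ⟨_, _, Submodule.sub_mem _ (toFree_mem _) (Submodule.add_mem _
      (PTot.toFree_mem_monSpan (by simp [PMon.up]; omega) (by simp [PMon.low]; ring))
      (Submodule.smul_mem _ _
      (PTot.toFree_mem_monSpan (by simp [PMon.up]; omega) (by simp [PMon.low]; ring)))), ?_⟩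
    refine mem_of_eq_zero ?_
    simp only [map_sub, map_add, map_smul, ev_toFree, evMon, PMon.low]
    rw [(superLeibniz_superBracket Λ).jacobi trivial trivial trivial, sub_self]
  | leibniz m n p =>
    refine ⟨_, _, Submodule.sub_mem _ (toFree_mem _) (Submodule.add_mem _
      (PTot.toFree_mem_monSpan (by simp [PMon.up]; omega) (by simp [PMon.low]; ring))
      (Submodule.smul_mem _ _
      (PTot.toFree_mem_monSpan (by simp [PMon.up]; omega) (by simp [PMon.low]; ring)))), ?_⟩
    refine mem_of_eq_zero ?_
    simp only [map_sub, map_add, map_smul, ev_toFree, evMon, PMon.low]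
    rw [(superLeibniz_superBracket Λ).leib trivial trivial trivial, sub_self]
  | mul_left m hx ih =>
    obtain ⟨d, e, ih, ih'⟩ := ih
    refine ⟨_, _, mul_mem_monSpan (toFree_mem m) ih, ?_⟩
    rw [ev_mul, ev_toFree]
    exact ncSp_cast (mem_ncSp_mul (evMon_mem m) ih') (by omega) rfl
  | mul_right m hx ih =>
    obtain ⟨d, e, ih, ih'⟩ := ih
    refine ⟨_, _, mul_mem_monSpan ih (toFree_mem m), ?_⟩
    rw [ev_mul, ev_toFree]
    exact ncSp_cast (mem_ncSp_mul ih' (evMon_mem m)) (by omega) rfl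
  | br_left m hx ih =>
    obtain ⟨d, e, ih, ih'⟩ := ih
    refine ⟨_, _, br_mem_monSpan (toFree_mem m) ih, ?_⟩
    rw [ev_br (toFree_mem m) ih, ev_toFree]
    exact ncSp_cast (bracket_ncSp (evMon_mem m) ih') (by omega) rfl
  | br_right m hx ih =>
    obtain ⟨d, e, ih, ih'⟩ := ih
    refine ⟨_, _, br_mem_monSpan ih (toFree_mem m), ?_⟩
    rw [ev_br ih (toFree_mem m), ev_toFree]
    exact ncSp_cast (bracket_ncSp ih' (evMon_mem m)) (by omega) rfl

/-- A combination of relations may mix numbers of brackets, so the gain is visible only component by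
component. -/
lemma ev_projF_mem {x : PFree (abelGrading 𝒜)} (hx : x ∈ relSpan (abelGrading 𝒜)) (d : ℕ) :
    ev 𝒜 (PTot.projF _ d x) ∈ ncFiltration 𝒜 (d + 1) := by
  induction hx using Submodule.span_induction with
  | zero => simp
  | add x y _ _ hx hy => rw [map_add, map_add]; exact Submodule.add_mem _ hx hy
  | smul c x _ hx => rw [map_smul, map_smul]; exact Submodule.smul_mem _ c hx
  | mem x h =>
    obtain ⟨d', e, h', h''⟩ := ev_mem_of_PRel h
    rw [PTot.projF_of_mem h']
    split_ifs with hd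
    · exact hd ▸ ncSp_le _ _ h''
    · simp

lemma ev_mem_of_relSpan {x : PFree (abelGrading 𝒜)} (hx : x ∈ relSpan (abelGrading 𝒜)) {d : ℕ}
    {e : ℤ} (hd : x ∈ monSpan (abelGrading 𝒜) d e) : ev 𝒜 x ∈ ncFiltration 𝒜 (d + 1) := by
  have := ev_projF_mem hx d
  rwa [PTot.projF_of_mem hd, if_pos rfl] at this

variable (𝒜) in
/-- The element `x` of `F^d Λ` represents the image in `gr_F Λ` of the element `p` of the
Poisson envelope. -/
def Represents (d : ℕ) (e : ℤ) (p : PTot (abelGrading 𝒜)) (x : Λ) : Prop :=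
  x ∈ ncSp 𝒜 d e ∧ ∃ y ∈ monSpan (abelGrading 𝒜) d e, PTot.mk _ y = p ∧
    ev 𝒜 y - x ∈ ncSp 𝒜 (d + 1) e

lemma Represents.of {e : ℤ} (x : 𝒜 e) :
    Represents 𝒜 0 e (PTot.mon (.of e (abelMk 𝒜 e x))) x := by
  refine ⟨mem_ncSp_of_mem x.2, _, toFree_mem (.of e (abelMk 𝒜 e x)), rfl, ?_⟩
  rw [ev_toFree]
  exact sub_mem_ncSp_one (abelSec _).2 x.2 (mk_abelSec _)

lemma Represents.one : Represents 𝒜 0 0 1 1 :=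
  Represents.of (𝒜 := 𝒜) ⟨1, SetLike.one_mem_graded 𝒜⟩

lemma Represents.mul {d d' : ℕ} {e e' : ℤ} {p p' : PTot (abelGrading 𝒜)} {x x' : Λ}
    (h : Represents 𝒜 d e p x) (h' : Represents 𝒜 d' e' p' x') :
    Represents 𝒜 (d + d') (e + e') (p * p') (x * x') := by
  obtain ⟨hx, y, hy, rfl, hyx⟩ := h
  obtain ⟨hx', y', hy', rfl, hyx'⟩ := h'
  refine ⟨mem_ncSp_mul hx hx', _, mul_mem_monSpan hy hy', rfl, ?_⟩
  have h1 := ncSp_cast (mem_ncSp_mul hyx (ev_mem hy')) (k' := d + d' + 1) (by omega) rfl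
  have h2 := ncSp_cast (mem_ncSp_mul hx hyx') (k' := d + d' + 1) (by omega) rfl
  convert Submodule.add_mem _ h1 h2 using 1
  rw [ev_mul]
  noncomm_ring

lemma Represents.br {d d' : ℕ} {e e' : ℤ} {p p' : PTot (abelGrading 𝒜)} {x x' : Λ}
    (h : Represents 𝒜 d e p x) (h' : Represents 𝒜 d' e' p' x') :
    Represents 𝒜 (d + d' + 1) (e + e') (PTot.pbr p p') (superBracket Λ e e' x x') := by
  obtain ⟨hx, y, hy, rfl, hyx⟩ := h
  obtain ⟨hx', y', hy', rfl, hyx'⟩ := h'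
  refine ⟨bracket_ncSp hx hx', _, br_mem_monSpan hy hy', rfl, ?_⟩
  have h1 := ncSp_cast (bracket_ncSp hyx (ev_mem hy')) (k' := d + d' + 1 + 1) (by omega) rfl
  have h2 := ncSp_cast (bracket_ncSp hx hyx') (k' := d + d' + 1 + 1) (by omega) rfl
  convert Submodule.add_mem _ h1 h2 using 1
  rw [ev_br hy hy']
  simp

lemma Represents.cast {d d' : ℕ} {e e' : ℤ} {p : PTot (abelGrading 𝒜)} {x : Λ}
    (h : Represents 𝒜 d e p x) (hd : d = d') (he : e = e') : Represents 𝒜 d' e' p x := by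
  subst hd he; exact h

lemma IsLieMonomial.represents {k : ℕ} {e : ℤ} {x : Λ} (h : IsLieMonomial 𝒜 k e x) :
    ∃ p, Represents 𝒜 (k - 1) e p x := by
  induction h with
  | base hx => exact ⟨_, Represents.of ⟨_, hx⟩⟩
  | step hx hy ih =>
    obtain ⟨p, hp⟩ := ih
    have := hy.pos
    exact ⟨_, ((Represents.of ⟨_, hx⟩).br hp).cast (by omega) rfl⟩

lemma IsNCMonomial.represents {k : ℕ} {e : ℤ} {x : Λ} (h : IsNCMonomial 𝒜 k e x) :
    ∃ p, Represents 𝒜 k e p x := by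
  induction h with
  | base hx => exact ⟨_, Represents.of ⟨_, hx⟩⟩
  | step hx hl hy ih =>
    obtain ⟨p, hp⟩ := ih
    obtain ⟨q, hq⟩ := hl.represents
    exact ⟨_, ((hp.mul hq).mul (Represents.of ⟨_, hy⟩)).cast rfl rfl⟩

lemma exists_ev_sub_mem {d : ℕ} {e : ℤ} {x : Λ} (hx : x ∈ ncSp 𝒜 d e) :
    ∃ y ∈ monSpan (abelGrading 𝒜) d e, ev 𝒜 y - x ∈ ncSp 𝒜 (d + 1) e := by
  induction hx using Submodule.span_induction with
  | zero => exact ⟨0, Submodule.zero_mem _, by simp⟩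
  | add x x' _ _ hx hx' =>
    obtain ⟨y, hy, h⟩ := hx
    obtain ⟨y', hy', h'⟩ := hx'
    refine ⟨y + y', Submodule.add_mem _ hy hy', ?_⟩
    convert Submodule.add_mem _ h h' using 1
    rw [map_add]; abel
  | smul c x _ hx =>
    obtain ⟨y, hy, h⟩ := hx
    refine ⟨c • y, Submodule.smul_mem _ c hy, ?_⟩
    convert Submodule.smul_mem _ c h using 1
    rw [map_smul, smul_sub]
  | mem x h =>
    obtain ⟨p, _, y, hy, _, h⟩ := h.represents
    exact ⟨y, hy, h⟩

/-! ### The comparison map -/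

variable (𝒜)

/-- The comparison map `P(Λ^{ab}) → gr_F(Λ)` on the pieces. -/
noncomputable def compare (d : ℕ) (e : ℤ) : envPiece (abelGrading 𝒜) d e →ₗ[ℂ] grPiece 𝒜 d e :=
  Submodule.mapQ _ _ (((ev 𝒜).comp (monSpan (abelGrading 𝒜) d e).subtype).codRestrict
    (filPart 𝒜 d e) fun x => of_ncSp (ev_mem x.2)) fun x hx => ev_mem_of_relSpan hx x.2

variable {𝒜}

lemma SubQ.mk_eq_mk {N : Type u} [AddCommGroup N] [Module ℂ N] {S K : Submodule ℂ N} {x y : S} :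
    SubQ.mk K x = SubQ.mk K y ↔ x.1 - y.1 ∈ K := Submodule.Quotient.eq _

lemma compare_surjective (d : ℕ) (e : ℤ) : Function.Surjective (compare 𝒜 d e) := by
  intro x
  obtain ⟨⟨x, hx⟩, rfl⟩ := Submodule.Quotient.mk_surjective _ x
  obtain ⟨y, hy, h⟩ := exists_ev_sub_mem (ncSp_of hx)
  exact ⟨SubQ.mk _ ⟨y, hy⟩, SubQ.mk_eq_mk.2 (ncSp_le _ _ h)⟩

/-- Every monomial is built from generators by products and brackets, and every generator is the
class of a homogeneous element of `Λ`. -/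
lemma iso_ext {φ ψ : BigradedPoissonIso (poissonEnvelope (abelGrading 𝒜)) (grPoisson 𝒜)}
    (h : ∀ e (x : 𝒜 e), φ.toEquiv 0 e (envOf _ e (abelMk 𝒜 e x)) =
      ψ.toEquiv 0 e (envOf _ e (abelMk 𝒜 e x))) : φ = ψ := by
  have hmon : ∀ m : PMon (abelGrading 𝒜),
      φ.toEquiv m.up m.low (SubQ.mk _ ⟨m.toFree, toFree_mem m⟩) =
      ψ.toEquiv m.up m.low (SubQ.mk _ ⟨m.toFree, toFree_mem m⟩) := by
    intro m
    induction m with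
    | of e a =>
      obtain ⟨_, x, hx, rfl⟩ := a
      exact h e ⟨x, hx⟩
    | mul m n hm hn =>
      have e1 : (SubQ.mk (relSpan (abelGrading 𝒜)) ⟨(PMon.mul m n).toFree, toFree_mem (PMon.mul m n)⟩ :
          envPiece (abelGrading 𝒜) (m.up + n.up) (m.low + n.low)) =
          (poissonEnvelope (abelGrading 𝒜)).mul _ _ _ _ (SubQ.mk _ ⟨m.toFree, toFree_mem m⟩)
          (SubQ.mk _ ⟨n.toFree, toFree_mem n⟩) :=
        congrArg (SubQ.mk _) (Subtype.ext (bilinExt_toFree _ m n).symm)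
      exact (congrArg (φ.toEquiv _ _) e1).trans ((φ.map_mul _ _ _ _ _ _).trans
        ((congrArg₂ (fun x y => (grPoisson 𝒜).mul _ _ _ _ x y) hm hn).trans
        ((ψ.map_mul _ _ _ _ _ _).symm.trans (congrArg (ψ.toEquiv _ _) e1.symm))))
    | br m n hm hn =>
      have e1 : (SubQ.mk (relSpan (abelGrading 𝒜)) ⟨(PMon.br m n).toFree, toFree_mem (PMon.br m n)⟩ :
          envPiece (abelGrading 𝒜) (m.up + n.up + 1) (m.low + n.low)) =
          (poissonEnvelope (abelGrading 𝒜)).bracket _ _ _ _ (SubQ.mk _ ⟨m.toFree, toFree_mem m⟩)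
          (SubQ.mk _ ⟨n.toFree, toFree_mem n⟩) :=
        congrArg (SubQ.mk _) (Subtype.ext (bilinExt_toFree _ m n).symm)
      exact (congrArg (φ.toEquiv _ _) e1).trans ((φ.map_bracket _ _ _ _ _ _).trans
        ((congrArg₂ (fun x y => (grPoisson 𝒜).bracket _ _ _ _ x y) hm hn).trans
        ((ψ.map_bracket _ _ _ _ _ _).symm.trans (congrArg (ψ.toEquiv _ _) e1.symm))))
  have heq : φ.toEquiv = ψ.toEquiv := by
    funext d e
    refine LinearEquiv.ext fun x => ?_
    obtain ⟨⟨x, hx⟩, rfl⟩ := Submodule.Quotient.mk_surjective _ x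
    refine Submodule.span_induction (p := fun x hx => φ.toEquiv d e (SubQ.mk _ ⟨x, hx⟩) =
      ψ.toEquiv d e (SubQ.mk _ ⟨x, hx⟩)) ?_ ?_ ?_ ?_ hx
    · rintro _ ⟨m, rfl, rfl, rfl⟩
      exact hmon m
    · exact (map_zero (φ.toEquiv d e)).trans (map_zero (ψ.toEquiv d e)).symm
    · intro x y hx hy h h'
      exact (map_add (φ.toEquiv d e) _ _).trans ((congrArg₂ (· + ·) h h').trans
        (map_add (ψ.toEquiv d e) (SubQ.mk _ ⟨x, hx⟩) (SubQ.mk _ ⟨y, hy⟩)).symm)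
    · intro c x hx h
      exact (map_smul (φ.toEquiv d e) _ _).trans ((congrArg (c • ·) h).trans
        (map_smul (ψ.toEquiv d e) c (SubQ.mk _ ⟨x, hx⟩)).symm)
  cases φ; cases ψ; cases heq; rfl

/-- If the comparison map is injective, it is the unique isomorphism that extends the
identification in filtration degree `0`. -/
theorem existsUnique_iso_of_injective
    (h : ∀ d e, ∀ x ∈ monSpan (abelGrading 𝒜) d e, ev 𝒜 x ∈ ncFiltration 𝒜 (d + 1) →
      x ∈ relSpan (abelGrading 𝒜)) :
    ∃! φ : BigradedPoissonIso (poissonEnvelope (abelGrading 𝒜)) (grPoisson 𝒜),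
      ∀ (e : ℤ) (x : 𝒜 e), φ.toEquiv 0 e (envOf (abelGrading 𝒜) e (abelMk 𝒜 e x)) = grMk 𝒜 e x := by
  have hinj : ∀ d e, Function.Injective (compare 𝒜 d e) := by
    intro d e
    rw [← LinearMap.ker_eq_bot, LinearMap.ker_eq_bot']
    intro x hx
    obtain ⟨⟨x, hx'⟩, rfl⟩ := Submodule.Quotient.mk_surjective _ x
    exact (Submodule.Quotient.mk_eq_zero _).2
      (h d e x hx' ((Submodule.Quotient.mk_eq_zero
        ((ncFiltration 𝒜 (d + 1)).submoduleOf (filPart 𝒜 d e))).1 hx))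
  have hof : ∀ (e : ℤ) (x : 𝒜 e),
      compare 𝒜 0 e (envOf (abelGrading 𝒜) e (abelMk 𝒜 e x)) = grMk 𝒜 e x := by
    intro e x
    refine SubQ.mk_eq_mk.2 (ncSp_le 1 e ?_)
    change ev 𝒜 (PMon.of e (abelMk 𝒜 e x)).toFree - _ ∈ _
    rw [ev_toFree]
    exact sub_mem_ncSp_one (abelSec _).2 x.2 (mk_abelSec _)
  refine ⟨⟨fun d e => LinearEquiv.ofBijective (compare 𝒜 d e) ⟨hinj d e, compare_surjective d e⟩,
    hof 0 ⟨1, SetLike.one_mem_graded 𝒜⟩, ?_, ?_⟩, hof, ?_⟩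
  · rintro d e d' e' ⟨x⟩ ⟨y⟩
    exact congrArg (SubQ.mk _) (Subtype.ext (ev_mul x.1 y.1))
  · rintro d e d' e' ⟨x⟩ ⟨y⟩
    exact congrArg (SubQ.mk _) (Subtype.ext (ev_br x.2 y.2))
  · intro ψ hψ
    exact iso_ext fun e x => (hψ e x).trans (hof e x).symm

end Evaluation

end NCPoisson

namespace NCPoisson

/-! ### Lifting to truncated tensor algebras -/

section Lifting

/-- A homomorphism that takes values in `ℂ + J` maps `F^d` into `J^d`. -/
lemma ncFiltration_trivial_le {B C : Type u} [Ring B] [Algebra ℂ B] [Ring C] [Algebra ℂ C]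
    (f : B →ₐ[ℂ] C) (J : Ideal C) [J.IsTwoSided]
    (hJ : ∀ b, ∃ z : ℂ, f b - algebraMap ℂ C z ∈ J) (d : ℕ) {x : B} (hx : x ∈ ncF B d) :
    f x ∈ J ^ d := by
  -- The preimages of the powers of `J` form a multiplicative filtration; it suffices that
  -- commutators with arbitrary elements move up one step in it.
  let K : ℕ → Submodule ℂ B := fun i => ((J ^ i).restrictScalars ℂ).comap f.toLinearMap
  have hK : ∀ {i : ℕ} {x : B}, x ∈ K i ↔ f x ∈ J ^ i := Iff.rfl
  have hK0 : K 0 = ⊤ := by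
    refine top_le_iff.1 fun x _ => ?_
    rw [hK, Submodule.pow_zero, Ideal.one_eq_top]
    trivial
  have hKmul : ∀ i j, K i * K j ≤ K (i + j) := by
    refine fun i j => Submodule.mul_le.2 fun x hx y hy => ?_
    rw [hK, map_mul, Ideal.IsTwoSided.pow_add]
    exact Ideal.mul_mem_mul hx hy
  have hcomm : ∀ (a b : ℤ) (x y : B) (i : ℕ), (∀ e z, z ∈ trivialGrading B e → z ≠ 0 → e = 0) →
      x ∈ trivialGrading B a → y ∈ K i → (b ≠ 0 → y = 0) →
      x * y - sgn a b • (y * x) ∈ K (i + 1) := by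
    intro a b x y i h0 hx hy hb
    by_cases hx0 : x = 0
    · simp [hx0]
    by_cases hb0 : b = 0
    · rw [h0 a x hx hx0, sgn_zero_left, one_smul, hK, map_sub, map_mul, map_mul]
      -- Subtracting the scalar `z` from `f x` does not change commutators, and the difference lies
      -- in `J`.
      obtain ⟨z, hz⟩ := hJ x
      have hzy : (f x - algebraMap ℂ C z) * f y ∈ J ^ (i + 1) := by
        rw [Ideal.IsTwoSided.pow_succ]
        exact Ideal.mul_mem_mul hz hy
      have hyz : f y * (f x - algebraMap ℂ C z) ∈ J ^ (i + 1) := by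
        rw [Ideal.IsTwoSided.pow_add, Submodule.pow_one]
        exact Ideal.mul_mem_mul hy hz
      have h1 := Ideal.sub_mem _ hzy hyz
      convert h1 using 1
      rw [sub_mul, mul_sub, Algebra.commutes z (f y)]
      abel
    · simp [hb hb0]
  -- Only zero has nonzero degree, so the signs never matter for the trivial grading.
  have h0 : ∀ e z, z ∈ trivialGrading B e → z ≠ 0 → e = 0 := by
    intro e z hz hz0
    by_contra he
    rw [trivialGrading, if_neg he] at hz
    exact hz0 hz
  have hlie : ∀ {k e x}, IsLieMonomial (trivialGrading B) k e x →
      x ∈ K (k - 1) ∧ (e ≠ 0 → x = 0) := by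
    intro k e x h
    induction h with
    | @base e x hx =>
      refine ⟨by rw [Nat.sub_self, hK0]; trivial, fun he => ?_⟩
      by_contra hx0
      exact he (h0 e x hx hx0)
    | @step k a b x y hx hy ih =>
      have hk := hy.pos
      refine ⟨?_, fun he => ?_⟩
      · have := hcomm a b x y (k - 1) h0 hx ih.1 ih.2
        rwa [show k - 1 + 1 = k + 1 - 1 by omega] at this
      · by_cases hb : b = 0
        · have hx0 : x = 0 := by
            by_contra hx0
            exact he (by rw [h0 a x hx hx0, hb, add_zero])
          simp [hx0]
        · simp [ih.2 hb]
  have hprod : ∀ l : List ℕ, ((l.map fun i => lieSpan (trivialGrading B) i *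
      (⊤ : Submodule ℂ B)).prod) ≤ K (l.map fun i => i - 1).sum := by
    intro l
    induction l with
    | nil => simp [hK0]
    | cons i l ih =>
      simp only [List.map_cons, List.prod_cons, List.sum_cons]
      refine le_trans (mul_le_mul' ?_ ih) (hKmul _ _)
      refine le_trans (mul_le_mul' (Submodule.span_le.2 ?_) hK0.ge) (hKmul (i - 1) 0)
      rintro x ⟨e, hx⟩
      exact (hlie hx).1
  -- Only an inequality, since an entry `i = 0` has `i - 1 = 0` in `ℕ`; the inequality goes in the
  -- direction that is needed.
  have hsum : ∀ l : List ℕ, l.sum ≤ l.length + (l.map fun i => i - 1).sum := by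
    intro l
    induction l with
    | nil => simp
    | cons i l ih => simp only [List.sum_cons, List.length_cons, List.map_cons]; omega
  have hle : ncFiltration (trivialGrading B) d ≤ K d := by
    refine iSup_le fun l => ?_
    refine le_trans (mul_le_mul' hK0.ge (hprod l.1)) ((hKmul _ _).trans ?_)
    intro x hx
    rw [hK] at hx ⊢
    refine Ideal.pow_le_pow_right ?_ hx
    have := hsum l.1
    have := l.2
    omega
  exact hle hx

/-- Nilpotent approximation: a subalgebra that contains `J` modulo `J²` contains `J` modulo all
powers of `J`. -/
lemma le_sup_pow {B : Type*} [Ring B] [Algebra ℂ B] {X J : Submodule ℂ B} (hX : X * X ≤ X)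
    (hXJ : X ≤ J) (h : J ≤ X ⊔ J * J) (k : ℕ) : J ≤ X ⊔ J ^ (k + 1) := by
  induction k with
  | zero => simp
  | succ k ih =>
    refine h.trans (sup_le le_sup_left ?_)
    -- The induction hypothesis is used for the left factor and then, against `X`, for the right
    -- factor; every term outside `X * X` then lies in `J ^ (k + 2)`.
    calc J * J ≤ (X ⊔ J ^ (k + 1)) * J := mul_le_mul' ih le_rfl
      _ = X * J ⊔ J ^ (k + 1 + 1) := by rw [Submodule.sup_mul, ← pow_succ]
      _ ≤ X * (X ⊔ J ^ (k + 1)) ⊔ J ^ (k + 1 + 1) := sup_le_sup_right (mul_le_mul' le_rfl ih) _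
      _ = X * X ⊔ X * J ^ (k + 1) ⊔ J ^ (k + 1 + 1) := by rw [Submodule.mul_sup]
      _ ≤ X ⊔ J ^ (k + 1 + 1) := by
        refine sup_le (sup_le (hX.trans le_sup_left) ?_) le_sup_right
        refine le_trans (mul_le_mul' hXJ le_rfl) ?_
        rw [← pow_succ']
        exact le_sup_right

/-! ### Truncated tensor algebras -/

section TruncT

variable (U : Type u) [AddCommGroup U] [Module ℂ U]

/-- The augmentation ideal of the tensor algebra. -/
abbrev augIdeal : Ideal (TensorAlgebra ℂ U) :=
  RingHom.ker (TensorAlgebra.algebraMapInv : TensorAlgebra ℂ U →ₐ[ℂ] ℂ)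

/-- The truncated tensor algebra. -/
abbrev TruncT (n : ℕ) : Type u := TensorAlgebra ℂ U ⧸ augIdeal U ^ n

/-- The quotient map to the truncated tensor algebra. -/
noncomputable abbrev truncMk (n : ℕ) : TensorAlgebra ℂ U →ₐ[ℂ] TruncT U n :=
  Ideal.Quotient.mkₐ ℂ (augIdeal U ^ n)

variable {U}

lemma truncMk_surjective (n : ℕ) : Function.Surjective (truncMk U n) :=
  Ideal.Quotient.mkₐ_surjective ℂ _

lemma truncMk_eq_zero {n : ℕ} {t : TensorAlgebra ℂ U} :
    truncMk U n t = 0 ↔ t ∈ augIdeal U ^ n := Ideal.Quotient.eq_zero_iff_mem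

lemma sub_algebraMap_mem_augIdeal (t : TensorAlgebra ℂ U) :
    t - algebraMap ℂ _ (TensorAlgebra.algebraMapInv t) ∈ augIdeal U := by
  rw [RingHom.mem_ker, map_sub, AlgHom.commutes, Algebra.algebraMap_self_apply, sub_self]

lemma ι_mem_augIdeal (u : U) : TensorAlgebra.ι ℂ u ∈ augIdeal U := by
  rw [RingHom.mem_ker, TensorAlgebra.algebraMapInv, TensorAlgebra.lift_ι_apply,
    LinearMap.zero_apply]

/-- The tensor algebra is spanned by scalars and `U` modulo the square of the augmentation ideal. -/
lemma exists_sub_ι_mem (t : TensorAlgebra ℂ U) :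
    ∃ u, t - algebraMap ℂ _ (TensorAlgebra.algebraMapInv t) - TensorAlgebra.ι ℂ u ∈
      augIdeal U ^ 2 := by
  have h2 : augIdeal U ^ 2 = augIdeal U * augIdeal U := by
    rw [Ideal.IsTwoSided.pow_succ, Submodule.pow_one]
  induction t using TensorAlgebra.induction with
  | algebraMap r => exact ⟨0, by simp⟩
  | ι x =>
    refine ⟨x, ?_⟩
    rw [(RingHom.mem_ker).1 (ι_mem_augIdeal x)]
    simp
  | add a b ha hb =>
    obtain ⟨u, hu⟩ := ha
    obtain ⟨v, hv⟩ := hb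
    refine ⟨u + v, ?_⟩
    convert (augIdeal U ^ 2).add_mem hu hv using 1
    simp only [map_add]; abel
  | mul a b ha hb =>
    obtain ⟨u, hu⟩ := ha
    obtain ⟨v, hv⟩ := hb
    set x := TensorAlgebra.algebraMapInv a with hx
    set y := TensorAlgebra.algebraMapInv b with hy
    -- The linear part of a product of elements with constant terms `x` and `y`, by the Leibniz
    -- rule.
    refine ⟨y • u + x • v, ?_⟩
    have h1 := h2 ▸ Ideal.mul_mem_mul (sub_algebraMap_mem_augIdeal a)
      (sub_algebraMap_mem_augIdeal b)
    have h3 := (augIdeal U ^ 2).mul_mem_left (algebraMap ℂ _ y) hu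
    have h4 := (augIdeal U ^ 2).mul_mem_left (algebraMap ℂ _ x) hv
    convert (augIdeal U ^ 2).add_mem h1 ((augIdeal U ^ 2).add_mem h3 h4) using 1
    rw [← hx, ← hy]
    simp only [map_mul, map_add, map_smul, ← hx, ← hy, Algebra.algebraMap_eq_smul_one, mul_sub,
      sub_mul, smul_mul_assoc, mul_smul_comm, one_mul, mul_one]
    module

/-- The map to the trivial square zero extension of `ℂ` by `U` kills the square of the augmentation
ideal and is injective on `U`. -/
lemma eq_zero_of_ι_mem {u : U} (h : TensorAlgebra.ι ℂ u ∈ augIdeal U ^ 2) : u = 0 := by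
  let _ : Module ℂᵐᵒᵖ U := Module.compHom _ ((RingHom.id ℂ).fromOpposite mul_comm)
  have : IsCentralScalar ℂ U := ⟨fun r m => rfl⟩
  have hfst : ∀ t : TensorAlgebra ℂ U,
      (TensorAlgebra.toTrivSqZeroExt t).fst = TensorAlgebra.algebraMapInv t := by
    intro t
    have : (TrivSqZeroExt.fstHom ℂ ℂ U).comp TensorAlgebra.toTrivSqZeroExt =
        TensorAlgebra.algebraMapInv := by
      ext u
      simp [TensorAlgebra.algebraMapInv]
    exact AlgHom.congr_fun this t
  have key : ∀ t ∈ augIdeal U ^ 2, TensorAlgebra.toTrivSqZeroExt t = 0 := by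
    intro t ht
    rw [Ideal.IsTwoSided.pow_succ, Submodule.pow_one] at ht
    refine Submodule.smul_induction_on ht (fun x hx y hy => ?_) (fun x y hx hy => ?_)
    · have hx' := (hfst x).trans hx
      have hy' := (hfst y).trans hy
      rw [smul_eq_mul, map_mul]
      ext <;> simp [hx', hy']
    · rw [map_add, hx, hy, add_zero]
  have := key _ h
  rw [TensorAlgebra.toTrivSqZeroExt_ι] at this
  simpa using congrArg TrivSqZeroExt.snd this

/-- Truncated tensor algebras are NC nilpotent. -/
lemma isNCNilpotent_truncT {n N : ℕ} (hn : 1 ≤ n) (hN : n ≤ N + 1) :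
    IsNCNilpotent N (TruncT U n) := by
  let ε : TruncT U n →ₐ[ℂ] ℂ := Ideal.Quotient.liftₐ _ TensorAlgebra.algebraMapInv
    fun a ha => (Ideal.pow_le_pow_right hn ha |> fun h => by rwa [Submodule.pow_one] at h)
  have hε : ∀ t, ε (truncMk U n t) = TensorAlgebra.algebraMapInv t := fun t => rfl
  -- Powers of the augmentation ideal of the quotient lift to powers of the augmentation ideal
  -- upstairs. So the power `N + 1 ≥ n`, which contains `F^{N+1}`, vanishes.
  have key : ∀ k, ∀ x ∈ (RingHom.ker ε) ^ k, ∃ t ∈ augIdeal U ^ k, truncMk U n t = x := by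
    intro k
    induction k with
    | zero =>
      intro x _
      obtain ⟨t, rfl⟩ := truncMk_surjective n x
      exact ⟨t, by rw [Submodule.pow_zero, Ideal.one_eq_top]; trivial, rfl⟩
    | succ k ih =>
      intro x hx
      rw [Ideal.IsTwoSided.pow_succ] at hx
      refine Submodule.smul_induction_on hx (fun x hx y hy => ?_) (fun x y hx hy => ?_)
      · obtain ⟨t, rfl⟩ := truncMk_surjective n x
        obtain ⟨s, hs, rfl⟩ := ih y hy
        refine ⟨t * s, ?_, map_mul _ _ _⟩
        rw [Ideal.IsTwoSided.pow_succ]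
        exact Ideal.mul_mem_mul hx hs
      · obtain ⟨t, ht, rfl⟩ := hx
        obtain ⟨s, hs, rfl⟩ := hy
        exact ⟨t + s, Ideal.add_mem _ ht hs, map_add _ _ _⟩
  rw [IsNCNilpotent, eq_bot_iff]
  intro x hx
  have := ncFiltration_trivial_le (AlgHom.id ℂ (TruncT U n)) (RingHom.ker ε)
    (fun b => ⟨ε b, by rw [AlgHom.id_apply, RingHom.mem_ker, map_sub, AlgHom.commutes,
      Algebra.algebraMap_self_apply, sub_self]⟩) (N + 1) hx
  obtain ⟨t, ht, rfl⟩ := key _ _ this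
  exact truncMk_eq_zero.2 (Ideal.pow_le_pow_right hN ht)

/-- The transition maps between truncated tensor algebras. -/
noncomputable abbrev truncFactor {m n : ℕ} (h : m ≤ n) : TruncT U n →ₐ[ℂ] TruncT U m :=
  Ideal.Quotient.factorₐ ℂ (Ideal.pow_le_pow_right h)

lemma truncFactor_mk {m n : ℕ} (h : m ≤ n) (t : TensorAlgebra ℂ U) :
    truncFactor h (truncMk U n t) = truncMk U m t := rfl

/-- Homomorphisms to truncated tensor algebras lift along the transition maps. -/
lemma exists_lift_truncT {R' : Type u} [Ring R'] [Algebra ℂ R'] {N : ℕ} (hR' : IsDSmooth N R')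
    (g : R' →ₐ[ℂ] TruncT U 2) {n : ℕ} (hn : 2 ≤ n) (hN : n ≤ N + 1) :
    ∃ f : R' →ₐ[ℂ] TruncT U n, (truncFactor hn).comp f = g := by
  induction n, hn using Nat.le_induction with
  | base =>
    refine ⟨g, AlgHom.ext fun x => ?_⟩
    rw [AlgHom.comp_apply]
    obtain ⟨t, ht⟩ := truncMk_surjective 2 (g x)
    rw [← ht, truncFactor_mk]
  | succ n hn ih =>
    obtain ⟨f, hf⟩ := ih (by omega)
    -- Raising the order by one is an extension with kernel `I^n / I^{n+1}`. It has square zero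
    -- since `2n ≥ n + 1`, and it is central since scalars commute with everything and both `I^n ·
    -- I` and `I · I^n` lie in `I^{n+1}`.
    obtain ⟨h, hh⟩ := hR'.2.2 (TruncT U (n + 1)) (TruncT U n) (truncFactor n.le_succ)
      (isNCNilpotent_truncT (by omega) hN) (isNCNilpotent_truncT (by omega) (by omega))
      (fun x => by
        obtain ⟨t, rfl⟩ := truncMk_surjective n x
        exact ⟨truncMk U (n + 1) t, truncFactor_mk _ _⟩)
      (fun x y hx hy => by
        obtain ⟨t, rfl⟩ := truncMk_surjective _ x
        obtain ⟨s, rfl⟩ := truncMk_surjective _ y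
        rw [truncFactor_mk, truncMk_eq_zero] at hx hy
        rw [← map_mul, truncMk_eq_zero]
        refine Ideal.pow_le_pow_right (show n + 1 ≤ n + n by omega) ?_
        rw [Ideal.IsTwoSided.pow_add]
        exact Ideal.mul_mem_mul hx hy)
      (fun x y hx => by
        obtain ⟨t, rfl⟩ := truncMk_surjective _ x
        obtain ⟨s, rfl⟩ := truncMk_surjective _ y
        rw [truncFactor_mk, truncMk_eq_zero] at hx
        rw [← sub_eq_zero, ← map_mul, ← map_mul, ← map_sub, truncMk_eq_zero]
        have h1 : t * (s - algebraMap ℂ _ (TensorAlgebra.algebraMapInv s)) ∈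
            augIdeal U ^ (n + 1) := by
          rw [Ideal.IsTwoSided.pow_add, Submodule.pow_one]
          exact Ideal.mul_mem_mul hx (sub_algebraMap_mem_augIdeal s)
        have h2 : (s - algebraMap ℂ _ (TensorAlgebra.algebraMapInv s)) * t ∈
            augIdeal U ^ (n + 1) := by
          rw [Ideal.IsTwoSided.pow_succ]
          exact Ideal.mul_mem_mul (sub_algebraMap_mem_augIdeal s) hx
        convert Ideal.sub_mem _ h1 h2 using 1
        rw [mul_sub, sub_mul, Algebra.commutes]
        abel) f
    refine ⟨h, ?_⟩
    rw [← hf, ← hh]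
    refine AlgHom.ext fun x => ?_
    simp only [AlgHom.comp_apply]
    obtain ⟨t, ht⟩ := truncMk_surjective _ (h x)
    rw [← ht]
    rfl

end TruncT

/-! ### Formal coordinates at a character -/

section Coordinates

variable {R : Type u} [Ring R] [Algebra ℂ R] (χ : R →ₐ[ℂ] ℂ)

/-- The kernel of a character. -/
def charKer : Submodule ℂ R := LinearMap.ker χ.toLinearMap

variable {χ} in
lemma mem_charKer {s : R} : s ∈ charKer χ ↔ χ s = 0 := Iff.rfl

/-- The cotangent space at a character. -/
abbrev Cotan : Type u := SubQ (charKer χ) (charKer χ * charKer χ)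

/-- The differential at a character. -/
noncomputable def differential : R →ₗ[ℂ] Cotan χ :=
  (Submodule.mkQ _).comp ((LinearMap.id - χ.toLinearMap.smulRight (1 : R)).codRestrict (charKer χ)
    fun r => by simp [mem_charKer])

variable {χ}

lemma differential_of_mem {s : R} (hs : s ∈ charKer χ) :
    differential χ s = SubQ.mk _ ⟨s, hs⟩ := by
  refine congrArg (SubQ.mk _) (Subtype.ext ?_)
  change s - χ s • 1 = s
  rw [mem_charKer.1 hs, zero_smul, sub_zero]

lemma differential_one : differential χ 1 = 0 := by
  refine (Submodule.Quotient.mk_eq_zero _).2 ?_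
  change (1 : R) - χ 1 • 1 ∈ charKer χ * charKer χ
  rw [map_one, one_smul, sub_self]
  exact Submodule.zero_mem _

/-- The defect of the Leibniz rule is the product `(r - χ(r)) (s - χ(s))`, which lies in the square
of the kernel. -/
lemma differential_mul (r s : R) :
    differential χ (r * s) = χ r • differential χ s + χ s • differential χ r := by
  refine (Submodule.Quotient.eq _).2 ?_
  change (r * s - χ (r * s) • 1) - (χ r • (s - χ s • 1) + χ s • (r - χ r • 1)) ∈
    charKer χ * charKer χ
  have h : (r - χ r • 1) * (s - χ s • 1) ∈ charKer χ * charKer χ :=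
    Submodule.mul_mem_mul (by simp [mem_charKer]) (by simp [mem_charKer])
  convert h using 1
  simp only [map_mul, mul_sub, sub_mul, smul_mul_assoc, mul_smul_comm, one_mul, mul_one]
  module

lemma differential_surjective (u : Cotan χ) : ∃ s ∈ charKer χ, differential χ s = u := by
  obtain ⟨⟨s, hs⟩, rfl⟩ := Submodule.Quotient.mk_surjective _ u
  exact ⟨s, hs, differential_of_mem hs⟩

variable (χ) in
/-- The first order Taylor expansion at a character. -/
noncomputable def taylor : R →ₐ[ℂ] TruncT (Cotan χ) 2 :=
  AlgHom.ofLinearMap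
    ((Algebra.linearMap ℂ _).comp χ.toLinearMap +
      ((truncMk (Cotan χ) 2).toLinearMap.comp (TensorAlgebra.ι ℂ)).comp (differential χ))
    (by simp [differential_one])
    (fun r s => by
      have h : truncMk (Cotan χ) 2 (TensorAlgebra.ι ℂ (differential χ r)) *
          truncMk (Cotan χ) 2 (TensorAlgebra.ι ℂ (differential χ s)) = 0 := by
        rw [← map_mul, truncMk_eq_zero, Ideal.IsTwoSided.pow_succ, Submodule.pow_one]
        exact Ideal.mul_mem_mul (ι_mem_augIdeal _) (ι_mem_augIdeal _)
      simp only [LinearMap.add_apply, LinearMap.comp_apply, AlgHom.toLinearMap_apply,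
        Algebra.linearMap_apply, differential_mul, map_mul, map_add, map_smul, mul_add, add_mul, h,
        add_zero, Algebra.algebraMap_eq_smul_one, smul_mul_assoc, mul_smul_comm, one_mul, mul_one]
      module)

lemma taylor_apply (r : R) : taylor χ r =
    algebraMap ℂ _ (χ r) + truncMk (Cotan χ) 2 (TensorAlgebra.ι ℂ (differential χ r)) := rfl

/-- The expansion takes values in `ℂ + J` with `J² = 0`, so it maps `F^{n+1}` to `J^{n+1} = 0`. It
therefore factors through `R^{≤ n}`, to which the lifting property applies. -/
lemma taylor_eq_zero {n : ℕ} (hn : 1 ≤ n) {a : R} (ha : a ∈ ncF R (n + 1)) : taylor χ a = 0 := by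
  let ε : TruncT (Cotan χ) 2 →ₐ[ℂ] ℂ := Ideal.Quotient.liftₐ _ TensorAlgebra.algebraMapInv
    fun a ha => (Ideal.pow_le_pow_right one_le_two ha |> fun h => by rwa [Submodule.pow_one] at h)
  let J : Ideal (TruncT (Cotan χ) 2) := RingHom.ker ε
  have h1 : ∀ x ∈ J, ∀ y ∈ J, x * y = 0 := by
    intro x hx y hy
    obtain ⟨t, rfl⟩ := truncMk_surjective _ x
    obtain ⟨s, rfl⟩ := truncMk_surjective _ y
    rw [← map_mul, truncMk_eq_zero, Ideal.IsTwoSided.pow_succ, Submodule.pow_one]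
    exact Ideal.mul_mem_mul hx hy
  have h2 := ncFiltration_trivial_le (taylor χ) J
    (fun b => ⟨ε (taylor χ b), by rw [RingHom.mem_ker, map_sub, AlgHom.commutes,
      Algebra.algebraMap_self_apply, sub_self]⟩) (n + 1) ha
  have h3 := Ideal.pow_le_pow_right (show 2 ≤ n + 1 by omega) h2
  have h4 : J ^ 2 ≤ ⊥ := by
    rw [Ideal.IsTwoSided.pow_succ (I := J), Submodule.pow_one]
    exact Ideal.mul_le.2 fun x hx y hy => h1 x hx y hy
  exact h4 h3

/-- Formal coordinates at a character of a smooth algebra, up to order `n`. -/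
theorem exists_coordinates (hR : IsSmooth R) {n : ℕ} (hn : 2 ≤ n) :
    ∃ (f : R →ₐ[ℂ] TruncT (Cotan χ) n) (r : Cotan χ →ₗ[ℂ] R),
      (∀ u, f (r u) = truncMk _ n (TensorAlgebra.ι ℂ u)) ∧ (∀ u, r u ∈ charKer χ) ∧
      (∀ s ∈ charKer χ, ∃ t ∈ augIdeal (Cotan χ), truncMk _ n t = f s) ∧
      ∀ k, charKer χ ≤ Subalgebra.toSubmodule (Algebra.adjoin ℂ (Set.range r)) ⊔
        charKer χ ^ (k + 1) := by
  -- The first order expansion, lifted along `R^{≤ n}` to order `n`.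
  obtain ⟨f', hf'⟩ := exists_lift_truncT (hR.2 n) (Ideal.Quotient.liftₐ (ncF R (n + 1)) (taylor χ)
    fun _ ha => taylor_eq_zero (by omega) ha)
    hn (by omega)
  let f : R →ₐ[ℂ] TruncT (Cotan χ) n := f'.comp (Ideal.Quotient.mkₐ ℂ (ncF R (n + 1)))
  have hf : ∀ x, truncFactor hn (f x) = taylor χ x := fun x =>
    AlgHom.congr_fun hf' (Ideal.Quotient.mkₐ ℂ (ncF R (n + 1)) x)
  have hfJ : ∀ s ∈ charKer χ, ∃ t ∈ augIdeal (Cotan χ), truncMk _ n t = f s := by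
    intro s hs
    obtain ⟨t, ht⟩ := truncMk_surjective n (f s)
    refine ⟨t, ?_, ht⟩
    have h := hf s
    rw [← ht, truncFactor_mk, taylor_apply, mem_charKer.1 hs, map_zero, zero_add, ← sub_eq_zero,
      ← map_sub, truncMk_eq_zero] at h
    have h' := Ideal.pow_le_pow_right one_le_two h
    rw [Submodule.pow_one] at h'
    simpa using Ideal.add_mem _ h' (ι_mem_augIdeal (differential χ s))
  let I : Submodule ℂ (TensorAlgebra ℂ (Cotan χ)) := (augIdeal (Cotan χ)).restrictScalars ℂ
  let J : Submodule ℂ (TruncT (Cotan χ) n) := I.map (truncMk _ n).toLinearMap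
  -- Surjectivity of `f` is obtained by nilpotent approximation: the image of `f` meets the
  -- nilpotent augmentation ideal `J` in a subspace that is closed under products and that fills `J`
  -- modulo `J²`.
  let X : Submodule ℂ (TruncT (Cotan χ) n) := Subalgebra.toSubmodule f.range ⊓ J
  have hI2 : ∀ t ∈ augIdeal (Cotan χ) ^ 2, t ∈ I * I := by
    intro t ht
    rw [Ideal.IsTwoSided.pow_succ, Submodule.pow_one] at ht
    refine Submodule.smul_induction_on ht (fun x hx y hy => Submodule.mul_mem_mul hx hy)
      (fun x y hx hy => Submodule.add_mem _ hx hy)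
  have hII : I * I ≤ I := Submodule.mul_le.2 fun x _ y hy =>
    (augIdeal (Cotan χ)).mul_mem_left x hy
  have hJJ : J * J ≤ J := by
    rw [← Submodule.map_mul]
    exact Submodule.map_mono hII
  have hIpow : ∀ k, ∀ t ∈ I ^ k, t ∈ augIdeal (Cotan χ) ^ k := by
    intro k
    induction k with
    | zero => intro t _; rw [Submodule.pow_zero, Ideal.one_eq_top]; trivial
    | succ k ih =>
      intro t ht
      rw [pow_succ'] at ht
      have : I * I ^ k ≤ (augIdeal (Cotan χ) ^ (k + 1)).restrictScalars ℂ :=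
        Submodule.mul_le.2 fun x hx y hy => by
          rw [Ideal.IsTwoSided.pow_succ]
          exact Ideal.mul_mem_mul hx (ih y hy)
      exact this ht
  have hJn : J ^ n = ⊥ := by
    rw [← Submodule.map_pow, eq_bot_iff]
    rintro _ ⟨t, ht, rfl⟩
    exact truncMk_eq_zero.2 (hIpow n t ht)
  have hXX : X * X ≤ X := Submodule.mul_le.2 fun x hx y hy =>
    ⟨f.range.mul_mem hx.1 hy.1, hJJ (Submodule.mul_mem_mul hx.2 hy.2)⟩
  have hJX : J ≤ X ⊔ J * J := by
    rintro _ ⟨t, ht, rfl⟩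
    obtain ⟨u, hu⟩ := exists_sub_ι_mem t
    rw [(RingHom.mem_ker).1 ht, map_zero, sub_zero] at hu
    -- Any linear term is the differential of some `s` in the kernel of `χ`, and `f s` agrees with
    -- it modulo `J²`.
    obtain ⟨s, hs, rfl⟩ := differential_surjective u
    obtain ⟨t', ht', hts⟩ := hfJ s hs
    have h := hf s
    rw [← hts, truncFactor_mk, taylor_apply, mem_charKer.1 hs, map_zero, zero_add, ← sub_eq_zero,
      ← map_sub, truncMk_eq_zero] at h
    have h' : truncMk _ n (t - t') ∈ J * J := by
      rw [← Submodule.map_mul]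
      refine ⟨_, hI2 _ ?_, rfl⟩
      convert Ideal.sub_mem _ hu h using 1
      abel
    have e : truncMk _ n t = truncMk _ n t' + truncMk _ n (t - t') := by rw [← map_add]; congr 1; abel
    change truncMk _ n t ∈ _
    rw [e]
    exact Submodule.add_mem_sup ⟨⟨s, hts.symm⟩, ⟨t', ht', rfl⟩⟩ h'
  have hJle : J ≤ X := by
    have := le_sup_pow hXX inf_le_right hJX (n - 1)
    rwa [show n - 1 + 1 = n by omega, hJn, sup_bot_eq] at this
  have hsurj : Function.Surjective f := by
    intro x
    obtain ⟨t, rfl⟩ := truncMk_surjective n x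
    have h1 := (hJle ⟨_, sub_algebraMap_mem_augIdeal t, rfl⟩).1
    have h2 := f.range.add_mem h1 (f.range.algebraMap_mem (TensorAlgebra.algebraMapInv t))
    have e : (truncMk _ n).toLinearMap (t - algebraMap ℂ _ (TensorAlgebra.algebraMapInv t)) +
        algebraMap ℂ _ (TensorAlgebra.algebraMapInv t) = truncMk _ n t := by
      rw [AlgHom.toLinearMap_apply, map_sub, AlgHom.commutes, sub_add_cancel]
    rwa [e] at h2
  -- The coordinates are preimages of the free generators under `f`, chosen linearly.
  obtain ⟨σ, hσ⟩ := f.toLinearMap.exists_rightInverse_of_surjective (LinearMap.range_eq_top.2 hsurj)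
  let r : Cotan χ →ₗ[ℂ] R := σ.comp ((truncMk _ n).toLinearMap.comp (TensorAlgebra.ι ℂ))
  have hr : ∀ u, f (r u) = truncMk _ n (TensorAlgebra.ι ℂ u) := fun u =>
    LinearMap.congr_fun hσ (truncMk _ n (TensorAlgebra.ι ℂ u))
  have hr2 : ∀ u, algebraMap ℂ _ (χ (r u)) + truncMk (Cotan χ) 2 (TensorAlgebra.ι ℂ
      (differential χ (r u))) = truncMk _ 2 (TensorAlgebra.ι ℂ u) := by
    intro u
    rw [← taylor_apply, ← hf, hr, truncFactor_mk]
  have hrχ : ∀ u, r u ∈ charKer χ := by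
    intro u
    have h := hr2 u
    rw [← (truncMk (Cotan χ) 2).commutes, ← map_add, ← sub_eq_zero, ← map_sub,
      truncMk_eq_zero] at h
    have h' := Ideal.pow_le_pow_right one_le_two h
    rw [Submodule.pow_one, RingHom.mem_ker, map_sub, map_add,
      (RingHom.mem_ker).1 (ι_mem_augIdeal _), (RingHom.mem_ker).1 (ι_mem_augIdeal _),
      AlgHom.commutes] at h'
    simpa [mem_charKer] using h'
  -- Modulo the square of the augmentation ideal, `f` is the Taylor expansion, so the coordinates
  -- represent a basis-free identity map of the cotangent space.
  have hrd : ∀ u, differential χ (r u) = u := by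
    intro u
    have h := hr2 u
    rw [mem_charKer.1 (hrχ u), map_zero, zero_add, ← sub_eq_zero, ← map_sub, ← map_sub,
      truncMk_eq_zero] at h
    exact sub_eq_zero.1 (eq_zero_of_ι_mem h)
  refine ⟨f, r, hr, hrχ, hfJ, fun k => ?_⟩
  have hMM : charKer χ * charKer χ ≤ charKer χ := Submodule.mul_le.2 fun x hx y hy => by
    rw [mem_charKer] at hx ⊢
    rw [map_mul, hx, zero_mul]
  -- The same approximation argument inside `R`, where the kernel of `χ` need not be nilpotent, so
  -- that a power of it remains.
  refine (le_sup_pow (X := Subalgebra.toSubmodule (Algebra.adjoin ℂ (Set.range r)) ⊓ charKer χ)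
    (Submodule.mul_le.2 fun x hx y hy => ⟨Subalgebra.mul_mem _ hx.1 hy.1,
      hMM (Submodule.mul_mem_mul hx.2 hy.2)⟩) inf_le_right ?_ k).trans
    (sup_le_sup_right inf_le_left _)
  intro s hs
  have h1 : s - r (differential χ s) ∈ charKer χ * charKer χ := by
    have := hrd (differential χ s)
    rw [differential_of_mem (hrχ _), differential_of_mem hs] at this
    have h := SubQ.mk_eq_mk.1 this
    rw [← differential_of_mem hs] at h
    rw [← neg_sub]
    exact Submodule.neg_mem _ h
  rw [← add_sub_cancel (r (differential χ s)) s]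
  exact Submodule.add_mem_sup ⟨Algebra.subset_adjoin ⟨_, rfl⟩, hrχ _⟩ h1

end Coordinates

end Lifting

end NCPoisson

namespace NCPoisson

/-! ### Adic filtrations of the Poisson envelope and operators on it -/

namespace PTot

section Adic

variable {A : Type u} [Ring A] [Algebra ℂ A] {𝒜 : ℤ → Submodule ℂ A} [SetLike.GradedMonoid 𝒜]

/-- The class of a homogeneous element of `A`. -/
noncomputable def of (e : ℤ) : 𝒜 e →ₗ[ℂ] PTot 𝒜 where
  toFun a := mon (.of e a)
  map_add' a b := (rel (PRel.of_add e a b)).trans (map_add _ _ _)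
  map_smul' c a := (rel (PRel.of_smul e c a)).trans (map_smul _ _ _)

lemma of_apply (e : ℤ) (a : 𝒜 e) : of e a = mon (.of e a) := rfl

lemma of_congr {e e' : ℤ} {a : 𝒜 e} {b : 𝒜 e'} (he : e = e') (h : (a : A) = b) :
    of e a = of e' b := by
  subst he
  rw [Subtype.ext h]

lemma of_mul_of {e e' : ℤ} (a : 𝒜 e) (b : 𝒜 e') :
    of e a * of e' b = of (e + e') ⟨(a : A) * b, SetLike.mul_mem_graded a.2 b.2⟩ := by
  rw [of_apply, of_apply, ← mon_mul]
  exact rel (PRel.of_mul e e' a b)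

lemma of_mem_Pl {e : ℤ} (a : 𝒜 e) : of e a ∈ Pl 𝒜 e := mon_mem_Pl (.of e a)

lemma of_mem_Pu {e : ℤ} (a : 𝒜 e) : of e a ∈ Pu 𝒜 0 := mon_mem_Pu (.of e a)

/-- The operator `k p · + {p, ·}`. -/
noncomputable def op (k : ℕ) (p : PTot 𝒜) : PTot 𝒜 →ₗ[ℂ] PTot 𝒜 :=
  (k : ℂ) • LinearMap.mulLeft ℂ p + pbr p

lemma op_apply (k : ℕ) (p q : PTot 𝒜) : op k p q = (k : ℂ) • (p * q) + pbr p q := rfl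

/-- The operators `k p · + {p, ·}` of Lie elements `p` of weight `k` form a Lie algebra. -/
lemma op_superBracket {a e : ℤ} {g p : PTot 𝒜} (hg : g ∈ Pl 𝒜 a) (hp : p ∈ Pl 𝒜 e) (k : ℕ)
    (z : PTot 𝒜) :
    op 1 g (op k p z) - sgn a e • op k p (op 1 g z) = op (k + 1) (pbr g p) z := by
  have h1 := mul_comm_of_mem hg hp
  have h2 := jacobi z hg hp
  have h3 := leibniz z hg hp
  have h4 := leibniz z hp hg
  have h5 := br_antisymm hp hg
  have h6 : g * (p * z) = sgn a e • (p * (g * z)) := by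
    rw [← mul_assoc, h1, smul_mul_assoc, mul_assoc]
  -- Multiplicities `k` come from differentiating `k p z` by `{g, ·}`; the additional one comes from
  -- the term `{p, g} z` of `{p, g z}` after antisymmetry. The remaining mixed terms cancel.
  simp only [op_apply, map_add, map_smul, h2, h3, h4, h5, h6,
    sgn_comm e a, Nat.cast_add, Nat.cast_one, one_smul, smul_mul_assoc]
  rcases sgn_eq a e with h | h <;> rw [h] <;> module

/-! #### The part of upper degree at least `d` -/

variable (𝒜) in
/-- The part of upper degree at least `d`. -/
noncomputable def Pge (d : ℕ) : Submodule ℂ (PTot 𝒜) :=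
  ⨅ j : Fin d, LinearMap.ker (proj 𝒜 j)

lemma mem_Pge {d : ℕ} {x : PTot 𝒜} : x ∈ Pge 𝒜 d ↔ ∀ j < d, proj 𝒜 j x = 0 := by
  simp only [Pge, Submodule.mem_iInf, LinearMap.mem_ker]
  exact ⟨fun h j hj => h ⟨j, hj⟩, fun h j => h j j.2⟩

lemma Pu_le_Pge {d d' : ℕ} (h : d' ≤ d) : Pu 𝒜 d ≤ Pge 𝒜 d' := fun x hx =>
  mem_Pge.2 fun j hj => by rw [proj_of_mem hx, if_neg (by omega)]

lemma Pge_antitone {d d' : ℕ} (h : d' ≤ d) : Pge 𝒜 d ≤ Pge 𝒜 d' := fun _ hx =>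
  mem_Pge.2 fun j hj => mem_Pge.1 hx j (by omega)

lemma mul_mem_Pge {i d : ℕ} {p q : PTot 𝒜} (hp : p ∈ Pu 𝒜 i) (hq : q ∈ Pge 𝒜 d) :
    p * q ∈ Pge 𝒜 (d + i) := mem_Pge.2 fun j hj => by
  rw [proj_mul hp]
  split_ifs
  · rw [mem_Pge.1 hq _ (by omega), mul_zero]
  · rfl

lemma br_mem_Pge {i d : ℕ} {p q : PTot 𝒜} (hp : p ∈ Pu 𝒜 i) (hq : q ∈ Pge 𝒜 d) :
    pbr p q ∈ Pge 𝒜 (d + i + 1) := mem_Pge.2 fun j hj => by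
  rw [proj_br hp]
  split_ifs
  · rw [mem_Pge.1 hq _ (by omega), map_zero]
  · rfl

lemma op_mem_Pge {i d : ℕ} (k : ℕ) {p q : PTot 𝒜} (hp : p ∈ Pu 𝒜 i) (hq : q ∈ Pge 𝒜 d) :
    op k p q ∈ Pge 𝒜 (d + i) :=
  Submodule.add_mem _ (Submodule.smul_mem _ _ (mul_mem_Pge hp hq))
    (Pge_antitone (by omega) (br_mem_Pge hp hq))

/-! #### Powers of the ideal of a character -/

variable {R : Type u} [Ring R] [Algebra ℂ R] (c : R →ₐ[ℂ] PTot 𝒜) (χ : R →ₐ[ℂ] ℂ)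

/-- The subspace `𝔪^k P` for the kernel `𝔪` of the character `χ`. -/
noncomputable def adic : ℕ → Submodule ℂ (PTot 𝒜)
  | 0 => ⊤
  | k + 1 => Submodule.span ℂ {x | ∃ s ∈ charKer χ, ∃ p ∈ adic k, c s * p = x}

variable {c χ}

lemma char_mul_mem_adic {s : R} (hs : s ∈ charKer χ) {k : ℕ} {p : PTot 𝒜} (hp : p ∈ adic c χ k) :
    c s * p ∈ adic c χ (k + 1) := Submodule.subset_span ⟨s, hs, p, hp, rfl⟩

/-- To prove that a linear map sends `𝔪^{k+1} P` to a subspace one may check the products. -/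
lemma adic_succ_le {k : ℕ} {N : Submodule ℂ (PTot 𝒜)}
    (h : ∀ s ∈ charKer χ, ∀ p ∈ adic c χ k, c s * p ∈ N) : adic c χ (k + 1) ≤ N := by
  refine Submodule.span_le.2 ?_
  rintro _ ⟨s, hs, p, hp, rfl⟩
  exact h s hs p hp

lemma adic_succ_le_self (k : ℕ) : adic c χ (k + 1) ≤ adic c χ k := by
  induction k with
  | zero => exact le_top
  | succ k ih => exact adic_succ_le fun s hs p hp => char_mul_mem_adic hs (ih hp)

lemma adic_antitone {k k' : ℕ} (h : k' ≤ k) : adic c χ k ≤ adic c χ k' :=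
  antitone_nat_of_succ_le adic_succ_le_self h

lemma pow_mem_adic {s : R} {k : ℕ} (hs : s ∈ charKer χ ^ k) : c s ∈ adic c χ k := by
  induction k generalizing s with
  | zero => trivial
  | succ k ih =>
    rw [pow_succ'] at hs
    have : charKer χ * charKer χ ^ k ≤ (adic c χ (k + 1)).comap c.toLinearMap :=
      Submodule.mul_le.2 fun x hx y hy => by
        rw [Submodule.mem_comap, AlgHom.toLinearMap_apply, map_mul]
        exact char_mul_mem_adic hx (ih hy)
    exact this hs

section Central

variable (hl : ∀ r, c r ∈ Pl 𝒜 0)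

include hl

/-- The image of `R` has lower degree 0, hence is central and can be moved past `q`. -/
lemma mul_adic (q : PTot 𝒜) {k : ℕ} {p : PTot 𝒜} (hp : p ∈ adic c χ k) : q * p ∈ adic c χ k := by
  induction k generalizing p with
  | zero => trivial
  | succ k ih =>
    refine adic_succ_le (N := (adic c χ (k + 1)).comap (LinearMap.mulLeft ℂ q))
      (fun s hs p hp => ?_) hp
    rw [Submodule.mem_comap, LinearMap.mulLeft_apply, ← mul_assoc, ← comm_of_mem_zero (hl s),
      mul_assoc]
    exact char_mul_mem_adic hs (ih hp)

omit hl in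
lemma adic_mul (q : PTot 𝒜) {k : ℕ} {p : PTot 𝒜} (hp : p ∈ adic c χ k) : p * q ∈ adic c χ k := by
  induction k generalizing p with
  | zero => trivial
  | succ k ih =>
    refine adic_succ_le (N := (adic c χ (k + 1)).comap (LinearMap.mulRight ℂ q))
      (fun s hs p hp => ?_) hp
    rw [Submodule.mem_comap, LinearMap.mulRight_apply, mul_assoc]
    exact char_mul_mem_adic hs (ih hp)

/-- A derivation removes at most one factor from a product of elements of `𝔪`. For `k = 0` the
truncated subtraction is harmless, as `adic` starts with the whole space. -/
lemma br_adic (q : PTot 𝒜) {k : ℕ} {p : PTot 𝒜} (hp : p ∈ adic c χ k) :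
    pbr q p ∈ adic c χ (k - 1) := by
  induction k generalizing p with
  | zero => trivial
  | succ k ih =>
    refine adic_succ_le (N := (adic c χ k).comap (pbr q)) (fun s hs p hp => ?_) hp
    rw [Submodule.mem_comap, leibniz_zero (hl s)]
    refine Submodule.add_mem _ (mul_adic hl _ hp) ?_
    rcases k with _ | k
    · trivial
    · exact char_mul_mem_adic hs (ih hp)

lemma adic_br (q : PTot 𝒜) {k : ℕ} {p : PTot 𝒜} (hp : p ∈ adic c χ k) :
    pbr p q ∈ adic c χ (k - 1) := by
  induction k generalizing p with
  | zero => trivial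
  | succ k ih =>
    refine adic_succ_le (N := (adic c χ k).comap (pbr.flip q)) (fun s hs p hp => ?_) hp
    rw [Submodule.mem_comap, LinearMap.flip_apply, leibniz_left_zero (hl s)]
    refine Submodule.add_mem _ ?_ (adic_mul _ hp)
    rcases k with _ | k
    · trivial
    · exact char_mul_mem_adic hs (ih hp)

end Central

variable (c χ) in
/-- The weight filtration: elements of `𝔪` have weight `1`, brackets have weight `2`. -/
noncomputable def wt (n : ℕ) : Submodule ℂ (PTot 𝒜) :=
  ⨅ j : ℕ, (adic c χ (n - 2 * j)).comap (proj 𝒜 j)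

lemma mem_wt {n : ℕ} {x : PTot 𝒜} : x ∈ wt c χ n ↔ ∀ j, proj 𝒜 j x ∈ adic c χ (n - 2 * j) := by
  simp only [wt, Submodule.mem_iInf, Submodule.mem_comap]

lemma wt_antitone {k k' : ℕ} (h : k' ≤ k) : wt c χ k ≤ wt c χ k' := fun _ hx =>
  mem_wt.2 fun j => adic_antitone (by omega) (mem_wt.1 hx j)

lemma mem_wt_zero (x : PTot 𝒜) : x ∈ wt c χ 0 := mem_wt.2 fun j => by
  rw [Nat.zero_sub]; trivial

lemma char_mul_mem_wt (hu : ∀ r, c r ∈ Pu 𝒜 0) {s : R} (hs : s ∈ charKer χ) {n : ℕ} {q : PTot 𝒜}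
    (hq : q ∈ wt c χ n) : c s * q ∈ wt c χ (n + 1) := mem_wt.2 fun j => by
  rw [proj_mul (hu s), if_pos (Nat.zero_le j), Nat.sub_zero]
  exact adic_antitone (by omega) (char_mul_mem_adic hs (mem_wt.1 hq j))

section Central

variable (hl : ∀ r, c r ∈ Pl 𝒜 0)

include hl

lemma mul_mem_wt {i n : ℕ} {p q : PTot 𝒜} (hp : p ∈ Pu 𝒜 i) (hq : q ∈ wt c χ n) :
    p * q ∈ wt c χ (n + 2 * i) := mem_wt.2 fun j => by
  rw [proj_mul hp]
  split_ifs
  · exact adic_antitone (by omega) (mul_adic hl p (mem_wt.1 hq (j - i)))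
  · exact Submodule.zero_mem _

/-- The bracket loses at most one power of `𝔪`, while the new bracket counts with weight 2, a net
gain of one. This is the reason for the weight 2. -/
lemma br_mem_wt {i n : ℕ} {p q : PTot 𝒜} (hp : p ∈ Pu 𝒜 i) (hq : q ∈ wt c χ n) :
    pbr p q ∈ wt c χ (n + 2 * i + 1) := mem_wt.2 fun j => by
  rw [proj_br hp]
  split_ifs
  · exact adic_antitone (by omega) (br_adic hl p (mem_wt.1 hq (j - (i + 1))))
  · exact Submodule.zero_mem _

lemma op_mem_wt {i n : ℕ} (k : ℕ) {p q : PTot 𝒜} (hp : p ∈ Pu 𝒜 i) (hq : q ∈ wt c χ n) :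
    op k p q ∈ wt c χ (n + 2 * i) :=
  Submodule.add_mem _ (Submodule.smul_mem _ _ (mul_mem_wt hl hp hq))
    (wt_antitone (by omega) (br_mem_wt hl hp hq))

/-- Multiplication by `s` adds a power of `𝔪`, and `{s, ·}` gains one anyway. Consequently an
`n`-fold product of such operators vanishes on the truncation of order `n`. -/
lemma op_char_mem_wt (hu : ∀ r, c r ∈ Pu 𝒜 0) {n : ℕ} (k : ℕ) {s : R} (hs : s ∈ charKer χ)
    {q : PTot 𝒜} (hq : q ∈ wt c χ n) : op k (c s) q ∈ wt c χ (n + 1) :=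
  Submodule.add_mem _ (Submodule.smul_mem _ _ (char_mul_mem_wt hu hs hq))
    (wt_antitone (by omega) (br_mem_wt hl (hu s) hq))

end Central

lemma op_add (k : ℕ) (p p' : PTot 𝒜) : op k (p + p') = op k p + op k p' := by
  simp only [op, map_add]
  have : LinearMap.mulLeft ℂ (p + p') = LinearMap.mulLeft ℂ p + LinearMap.mulLeft ℂ p' :=
    LinearMap.ext fun q => add_mul p p' q
  rw [this, smul_add]
  abel

lemma op_smul (k : ℕ) (z : ℂ) (p : PTot 𝒜) : op k (z • p) = z • op k p := by
  have : LinearMap.mulLeft ℂ (z • p) = z • LinearMap.mulLeft ℂ p :=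
    LinearMap.ext fun q => smul_mul_assoc z p q
  rw [op, op, this, map_smul, smul_add, smul_comm]

/-! #### The action on the truncation -/

variable (c χ) in
/-- The truncation of the Poisson envelope with respect to the weight. -/
abbrev WtQuot (n : ℕ) : Type u := PTot 𝒜 ⧸ wt c χ n

variable (hl : ∀ r, c r ∈ Pl 𝒜 0) (n : ℕ)

include hl in
lemma wt_le_comap_op (p : Pu 𝒜 0) : wt c χ n ≤ (wt c χ n).comap (op 1 p.1) := fun _ hq =>
  wt_antitone (Nat.le_add_right n _) (op_mem_wt hl 1 p.2 hq)

/-- The operators `p · + {p, ·}` on the truncation, for `p` of upper degree `0`. -/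
noncomputable def opBar : Pu 𝒜 0 →ₗ[ℂ] Module.End ℂ (WtQuot c χ n) where
  toFun p := Submodule.mapQ _ _ (op 1 p.1) (wt_le_comap_op hl n p)
  map_add' p p' := by
    refine Submodule.linearMap_qext _ (LinearMap.ext fun q => ?_)
    rw [LinearMap.add_comp, LinearMap.add_apply]
    simp only [LinearMap.comp_apply, Submodule.mkQ_apply, Submodule.mapQ_apply,
      Submodule.coe_add, op_add, LinearMap.add_apply, Submodule.Quotient.mk_add]
  map_smul' z p := by
    refine Submodule.linearMap_qext _ (LinearMap.ext fun q => ?_)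
    rw [LinearMap.smul_comp, LinearMap.smul_apply]
    simp only [LinearMap.comp_apply, Submodule.mkQ_apply, Submodule.mapQ_apply,
      Submodule.coe_smul, op_smul, LinearMap.smul_apply, Submodule.Quotient.mk_smul,
      RingHom.id_apply]

lemma opBar_mk (p : Pu 𝒜 0) (q : PTot 𝒜) :
    opBar (χ := χ) hl n p ((wt c χ n).mkQ q) = (wt c χ n).mkQ (op 1 p.1 q) :=
  Submodule.mapQ_apply _ _ (h := wt_le_comap_op hl n p) _ _

variable {Γ : Type*} (deg : Γ → ℤ) (g : Γ → PTot 𝒜)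

section Operators

variable (hgl : ∀ x, g x ∈ Pl 𝒜 (deg x)) (hgu : ∀ x, g x ∈ Pu 𝒜 0)

include hgu in
lemma lieVal_mem_Pu (x : Γ) (l : List Γ) :
    lieVal deg (fun _ _ => pbr) g x l ∈ Pu 𝒜 l.length := by
  induction l with
  | nil => exact hgu x
  | cons y l ih =>
    have := br_mem_Pu (hgu y) ih
    rwa [zero_add] at this

include hgu in
lemma prodVal_mem_Pu (M : List (Γ × List Γ)) :
    prodVal deg (fun _ _ => pbr) g M ∈ Pu 𝒜 (prodUp M) := by
  induction M with
  | nil => exact one_mem_Pu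
  | cons p M ih => exact mul_mem_Pu (lieVal_mem_Pu deg g hgu _ _) ih

/-- The operators of the generators on the truncation. -/
noncomputable def genOp (x : Γ) : Module.End ℂ (WtQuot c χ n) := opBar hl n ⟨g x, hgu x⟩

include hgl

/-- Iterating `op_superBracket`: super commutators of operators become brackets in the envelope, and
the coefficient of the multiplication counts the entries of the Lie monomial. -/
lemma lieVal_genOp_mk (x : Γ) (l : List Γ) (q : PTot 𝒜) :
    lieVal deg (superBracket _) (genOp (χ := χ) hl n g hgu) x l ((wt c χ n).mkQ q) =
      (wt c χ n).mkQ (op (l.length + 1) (lieVal deg (fun _ _ => pbr) g x l) q) := by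
  induction l generalizing q with
  | nil => rfl
  | cons y l ih =>
    rw [lieVal, superBracket_apply, LinearMap.sub_apply, LinearMap.smul_apply,
      Module.End.mul_apply, Module.End.mul_apply, ih]
    have e1 : ∀ q, genOp (χ := χ) hl n g hgu y ((wt c χ n).mkQ q) =
      (wt c χ n).mkQ (op 1 (g y) q) := fun q => opBar_mk hl n _ q
    rw [e1, e1, ih, ← map_smul, ← map_sub, op_superBracket (hgl y)
      (lieVal_mem (superLeibniz_PTot 𝒜) hgl x l)]
    rfl

lemma prodVal_genOp_mem_wt (M : List (Γ × List Γ)) {K : ℕ} {q : PTot 𝒜} (hq : q ∈ wt c χ K) :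
    prodVal deg (superBracket _) (genOp (χ := χ) hl n g hgu) M ((wt c χ n).mkQ q) ∈
      (wt c χ (K + 2 * prodUp M)).map (wt c χ n).mkQ := by
  induction M with
  | nil => exact ⟨q, hq, rfl⟩
  | cons p M ih =>
    obtain ⟨q', hq', h⟩ := ih
    rw [prodVal, Module.End.mul_apply, ← h, lieVal_genOp_mk (hgl := hgl)]
    refine ⟨_, ?_, rfl⟩
    have := op_mem_wt hl (p.2.length + 1) (lieVal_mem_Pu deg g hgu p.1 p.2) hq'
    rwa [show K + 2 * prodUp M + 2 * p.2.length = K + 2 * prodUp (p :: M) by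
      simp only [prodUp]; ring] at this

lemma prodVal_genOp_mem_Pge (M : List (Γ × List Γ)) {K : ℕ} {q : PTot 𝒜} (hq : q ∈ Pge 𝒜 K) :
    prodVal deg (superBracket _) (genOp (χ := χ) hl n g hgu) M ((wt c χ n).mkQ q) ∈
      (Pge 𝒜 (K + prodUp M)).map (wt c χ n).mkQ := by
  induction M with
  | nil => exact ⟨q, hq, rfl⟩
  | cons p M ih =>
    obtain ⟨q', hq', h⟩ := ih
    rw [prodVal, Module.End.mul_apply, ← h, lieVal_genOp_mk (hgl := hgl)]
    refine ⟨_, ?_, rfl⟩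
    have := op_mem_Pge (p.2.length + 1) (lieVal_mem_Pu deg g hgu p.1 p.2) hq'
    rwa [show K + prodUp M + p.2.length = K + prodUp (p :: M) by
      simp only [prodUp]; ring] at this

/-- A factor `v` with `k` entries acts by `k v · + {v, ·}`, and the bracket term has one more
bracket than the product. So the leading term is the product itself, with the coefficients `k`
multiplying up to `prodLen M`. -/
lemma prodVal_genOp_one (M : List (Γ × List Γ)) :
    prodVal deg (superBracket _) (genOp (χ := χ) hl n g hgu) M ((wt c χ n).mkQ 1) -
      (prodLen M : ℂ) • (wt c χ n).mkQ (prodVal deg (fun _ _ => pbr) g M) ∈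
      (Pge 𝒜 (prodUp M + 1)).map (wt c χ n).mkQ := by
  induction M with
  | nil => simp [prodVal, prodLen]
  | cons p M ih =>
    obtain ⟨q, hq, h⟩ := ih
    rw [eq_sub_iff_add_eq, ← map_smul, ← map_add] at h
    rw [prodVal, Module.End.mul_apply, ← h, lieVal_genOp_mk (hgl := hgl), ← map_smul, ← map_sub]
    refine ⟨_, ?_, rfl⟩
    set v := lieVal deg (fun _ _ => pbr) g p.1 p.2 with hv
    have hvu : v ∈ Pu 𝒜 p.2.length := lieVal_mem_Pu deg g hgu p.1 p.2
    have h1 := op_mem_Pge (p.2.length + 1) hvu hq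
    have h2 := Pu_le_Pge le_rfl (br_mem_Pu hvu (prodVal_mem_Pu deg g hgu M))
    have e1 : prodUp M + 1 + p.2.length = prodUp (p :: M) + 1 := by simp [prodUp]; ring
    have e2 : p.2.length + prodUp M + 1 = prodUp (p :: M) + 1 := by simp [prodUp]
    rw [e1] at h1
    rw [e2] at h2
    refine Set.mem_of_eq_of_mem ?_
      (Submodule.add_mem _ h1 (Submodule.smul_mem _ (prodLen M : ℂ) h2))
    simp only [prodVal, prodLen, op_apply, map_add, map_smul, Nat.cast_mul, Nat.cast_add,
      Nat.cast_one, ← hv]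
    module

end Operators

end Adic

end PTot

end NCPoisson

namespace NCPoisson

/-! ### Operators that raise a filtration -/

section Raise

variable {M : Type*} [AddCommGroup M] [Module ℂ M]

/-- The operators that raise the filtration `V` by `k`. -/
def raise (V : ℕ → Submodule ℂ M) (k : ℕ) : Submodule ℂ (Module.End ℂ M) where
  carrier := {T | ∀ K, ∀ v ∈ V K, T v ∈ V (K + k)}
  add_mem' hS hT K v hv := Submodule.add_mem _ (hS K v hv) (hT K v hv)
  zero_mem' _ _ _ := Submodule.zero_mem _
  smul_mem' c _ hT K v hv := Submodule.smul_mem _ c (hT K v hv)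

variable {V : ℕ → Submodule ℂ M}

lemma mul_mem_raise {k l : ℕ} {S T : Module.End ℂ M} (hS : S ∈ raise V k) (hT : T ∈ raise V l) :
    S * T ∈ raise V (k + l) := fun K v hv => by
  rw [Module.End.mul_apply, show K + (k + l) = K + l + k by omega]
  exact hS _ _ (hT _ _ hv)

lemma one_mem_raise : (1 : Module.End ℂ M) ∈ raise V 0 := fun _ _ hv => hv

lemma raise_antitone (hV : Antitone V) {k l : ℕ} (h : l ≤ k) : raise V k ≤ raise V l :=
  fun _ hT K v hv => hV (by omega) (hT K v hv)

/-- If the augmentation ideal raises the filtration by one, then its powers raise it accordingly. -/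
lemma map_augIdeal_pow_mem_raise (hV : Antitone V) {U : Type u} [AddCommGroup U] [Module ℂ U]
    (φ : TensorAlgebra ℂ U →ₐ[ℂ] Module.End ℂ M) (h : ∀ u, φ (TensorAlgebra.ι ℂ u) ∈ raise V 1)
    (k : ℕ) {t : TensorAlgebra ℂ U} (ht : t ∈ augIdeal U ^ k) : φ t ∈ raise V k := by
  have h0 : ∀ t, φ t ∈ raise V 0 := fun t => by
    induction t using TensorAlgebra.induction with
    | algebraMap z =>
      rw [AlgHom.commutes, Algebra.algebraMap_eq_smul_one]
      exact Submodule.smul_mem _ _ one_mem_raise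
    | ι u => exact raise_antitone hV zero_le_one (h u)
    | mul a b ha hb => rw [map_mul]; exact mul_mem_raise ha hb
    | add a b ha hb => rw [map_add]; exact Submodule.add_mem _ ha hb
  have h1 : ∀ t : TensorAlgebra ℂ U,
      φ (t - algebraMap ℂ _ (TensorAlgebra.algebraMapInv t)) ∈ raise V 1 := fun t => by
    induction t using TensorAlgebra.induction with
    | algebraMap z => simp
    | ι u =>
      have : TensorAlgebra.algebraMapInv (TensorAlgebra.ι ℂ u) = 0 := ι_mem_augIdeal u
      rw [this, map_zero, sub_zero]
      exact h u
    | mul a b ha hb =>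
      -- Each term contains a factor of augmentation zero, to which the induction hypothesis
      -- applies.
      have e1 : a * b - algebraMap ℂ _ (TensorAlgebra.algebraMapInv (a * b)) =
          (a - algebraMap ℂ _ (TensorAlgebra.algebraMapInv a)) * b +
          TensorAlgebra.algebraMapInv a •
            (b - algebraMap ℂ _ (TensorAlgebra.algebraMapInv b)) := by
        rw [map_mul, map_mul, smul_sub, Algebra.smul_def, Algebra.smul_def, sub_mul]
        abel
      rw [e1, map_add, map_mul, map_smul]
      exact Submodule.add_mem _ (mul_mem_raise ha (h0 b)) (Submodule.smul_mem _ _ hb)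
    | add a b ha hb =>
      rw [map_add, map_add, add_sub_add_comm, map_add]
      exact Submodule.add_mem _ ha hb
  induction k generalizing t with
  | zero => exact h0 t
  | succ k ih =>
    rw [Ideal.IsTwoSided.pow_succ] at ht
    refine Submodule.mul_induction_on ht (fun a ha b hb => ?_) fun a b ha hb => ?_
    · rw [map_mul, add_comm]
      have := h1 a
      rw [show TensorAlgebra.algebraMapInv a = 0 from ha, map_zero, sub_zero] at this
      exact mul_mem_raise this (ih hb)
    · rw [map_add]; exact Submodule.add_mem _ ha hb

/-- By `hker`, `ψ` factors through `q`, and `hspan` says that the range of `q` is spanned by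
eigenvectors of the induced map with nonzero eigenvalues. Independence of eigenspaces then excludes
the eigenvalue 0 on this range. -/
lemma ker_le_ker_of_eigen {D Z : Type*} [AddCommGroup D] [Module ℂ D] [AddCommGroup Z] [Module ℂ Z]
    {q ψ : D →ₗ[ℂ] Z} (hker : LinearMap.ker q ≤ LinearMap.ker ψ)
    (hspan : ∀ x, x ∈ Submodule.span ℂ {y | ∃ κ : ℂ, κ ≠ 0 ∧ ψ y = κ • q y} ⊔ LinearMap.ker q) :
    LinearMap.ker ψ ≤ LinearMap.ker q := by
  intro x hx
  -- The induced map lives only on the range of `q`, which it need not be known to preserve;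
  -- extending it to all of `Z` gives an endomorphism whose eigenspaces can be used.
  obtain ⟨Ψ, hΨ⟩ := LinearMap.exists_extend
    (((LinearMap.ker q).liftQ ψ hker).comp q.quotKerEquivRange.symm.toLinearMap)
  have key : ∀ y, Ψ (q y) = ψ y := fun y => by
    have h1 := LinearMap.congr_fun hΨ (q.quotKerEquivRange ((LinearMap.ker q).mkQ y))
    rw [LinearMap.comp_apply, LinearMap.comp_apply, LinearEquiv.coe_coe,
      LinearEquiv.symm_apply_apply] at h1
    exact h1
  have h0 : q x ∈ Module.End.eigenspace Ψ 0 := by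
    rw [Module.End.mem_eigenspace_iff, key, zero_smul]; exact hx
  have h1 : q x ∈ ⨆ κ : ℂ, ⨆ _ : κ ≠ 0, Module.End.eigenspace Ψ κ := by
    have : Submodule.span ℂ {y | ∃ κ : ℂ, κ ≠ 0 ∧ ψ y = κ • q y} ⊔ LinearMap.ker q ≤
        (⨆ κ : ℂ, ⨆ _ : κ ≠ 0, Module.End.eigenspace Ψ κ).comap q := by
      refine sup_le (Submodule.span_le.2 ?_) fun y hy => ?_
      · rintro y ⟨κ, hκ, hy⟩
        refine Submodule.mem_iSup_of_mem κ (Submodule.mem_iSup_of_mem hκ ?_)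
        rw [Module.End.mem_eigenspace_iff, key, hy]
      · rw [Submodule.mem_comap, LinearMap.mem_ker.1 hy]; exact Submodule.zero_mem _
    exact this (hspan x)
  exact (Submodule.disjoint_def.1 (Module.End.eigenspaces_iSupIndep Ψ 0)) _ h0 h1

end Raise

/-! ### Images of the NC filtration -/

section OpGe

variable {Γ : Type*} (deg : Γ → ℤ) {B : Type u} [Ring B] [Algebra ℂ B] (g : Γ → B)

/-- The span of the products of Lie monomials of degree `e` with at least `d` brackets. -/
def prodGe (d : ℕ) (e : ℤ) : Submodule ℂ B :=
  Submodule.span ℂ {z | ∃ M, d ≤ prodUp M ∧ prodDeg deg M = e ∧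
    prodVal deg (superBracket B) g M = z}

variable {deg g}

lemma prodGe_cast {k k' : ℕ} {e e' : ℤ} {x : B} (h : x ∈ prodGe deg g k e) (hk : k = k')
    (he : e = e') : x ∈ prodGe deg g k' e' := by subst hk he; exact h

lemma prodGen_le_prodGe {d d' : ℕ} (h : d ≤ d') (e : ℤ) :
    prodGen deg (superBracket B) g d' e ≤ prodGe deg g d e := by
  refine Submodule.span_mono ?_
  rintro _ ⟨M, rfl, rfl, rfl⟩
  exact ⟨M, h, rfl, rfl⟩

lemma mul_mem_prodGe {d d' : ℕ} {e e' : ℤ} {x y : B} (hx : x ∈ prodGe deg g d e)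
    (hy : y ∈ prodGe deg g d' e') : x * y ∈ prodGe deg g (d + d') (e + e') := by
  refine bilin_mem_of_span (LinearMap.mul ℂ B) ?_ hx hy
  rintro _ ⟨M, hM, rfl, rfl⟩ _ ⟨N, hN, rfl, rfl⟩
  exact prodGen_le_prodGe (by omega) _
    (mul_mem_prodGen (prodVal_mem_prodGen M) (prodVal_mem_prodGen N))

lemma superBracket_mem_prodGe {d d' : ℕ} {e e' : ℤ} {x y : B} (hx : x ∈ prodGe deg g d e)
    (hy : y ∈ prodGe deg g d' e') :
    superBracket B e e' x y ∈ prodGe deg g (d + d' + 1) (e + e') := by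
  refine bilin_mem_of_span (superBracket B e e') ?_ hx hy
  rintro _ ⟨M, hM, rfl, rfl⟩ _ ⟨N, hN, rfl, rfl⟩
  exact prodGen_le_prodGe (by omega) _ (br_mem_prodGen (superLeibniz_superBracket B)
    (fun _ => trivial) (prodVal_mem_prodGen M) (prodVal_mem_prodGen N))

variable {Λ : Type u} [Ring Λ] [Algebra ℂ Λ] {𝒜 : ℤ → Submodule ℂ Λ}

lemma map_superBracket (φ : Λ →ₐ[ℂ] B) (e e' : ℤ) (x y : Λ) :
    φ (superBracket Λ e e' x y) = superBracket B e e' (φ x) (φ y) := by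
  simp [superBracket_apply]

lemma map_prodVal (φ : Λ →ₐ[ℂ] B) (γ : Γ → Λ) (h : ∀ x, φ (γ x) = g x) (M : List (Γ × List Γ)) :
    φ (prodVal deg (superBracket Λ) γ M) = prodVal deg (superBracket B) g M := by
  have hl : ∀ x l, φ (lieVal deg (superBracket Λ) γ x l) = lieVal deg (superBracket B) g x l := by
    intro x l
    induction l with
    | nil => exact h x
    | cons y l ih => rw [lieVal, map_superBracket, h, ih]; rfl
  induction M with
  | nil => exact map_one φ
  | cons p M ih => rw [prodVal, map_mul, hl, ih]; rfl

variable {φ : Λ →ₐ[ℂ] B} (hφ : ∀ e, ∀ x ∈ 𝒜 e, φ x ∈ prodGe deg g 0 e)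

include hφ

lemma map_isLieMonomial_mem {k : ℕ} {e : ℤ} {x : Λ} (h : IsLieMonomial 𝒜 k e x) :
    φ x ∈ prodGe deg g (k - 1) e := by
  induction h with
  | base hx => exact hφ _ _ hx
  | @step k a b x y hx hy ih =>
    have := superBracket_mem_prodGe (hφ _ _ hx) ih
    rw [← map_superBracket] at this
    exact prodGe_cast this (by have := hy.pos; omega) rfl

lemma map_isNCMonomial_mem {d : ℕ} {e : ℤ} {x : Λ} (h : IsNCMonomial 𝒜 d e x) :
    φ x ∈ prodGe deg g d e := by
  induction h with
  | base hx => exact hφ _ _ hx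
  | step hx hl hy ih =>
    rw [map_mul, map_mul]
    exact prodGe_cast (mul_mem_prodGe (mul_mem_prodGe ih (map_isLieMonomial_mem hφ hl))
      (hφ _ _ hy)) (by omega) rfl

/-- The filtration involves Lie monomials in all homogeneous elements, but the operators are known
only on generators. Expanding images in products of Lie monomials of generators can only increase
the number of brackets, which is why `prodGe` asks for at least `d` of them. -/
lemma map_ncFiltration_le [GradedAlgebra 𝒜] {K : ℕ → Submodule ℂ B} (hK : Antitone K)
    (h : ∀ M, prodVal deg (superBracket B) g M ∈ K (prodUp M)) {d : ℕ} {x : Λ}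
    (hx : x ∈ ncFiltration 𝒜 d) : φ x ∈ K d := by
  have hle : ∀ e, prodGe deg g d e ≤ K d := fun e => by
    refine Submodule.span_le.2 ?_
    rintro _ ⟨M, hM, -, rfl⟩
    exact hK hM (h M)
  rw [ncFiltration_eq_span] at hx
  induction hx using Submodule.span_induction with
  | mem x hx => obtain ⟨e, hx⟩ := hx; exact hle e (map_isNCMonomial_mem hφ hx)
  | zero => rw [map_zero]; exact Submodule.zero_mem _
  | add x y _ _ hx hy => rw [map_add]; exact Submodule.add_mem _ hx hy
  | smul c x _ hx => rw [map_smul]; exact Submodule.smul_mem _ c hx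

end OpGe

/-! ### Representatives of products of Lie monomials -/

section Represents

variable {Λ : Type u} [Ring Λ] [Algebra ℂ Λ] {𝒜 : ℤ → Submodule ℂ Λ} [GradedAlgebra 𝒜]
  {Γ : Type*} {deg : Γ → ℤ} {p : Γ → PTot (abelGrading 𝒜)} {γ : Γ → Λ}

lemma represents_prodVal (h : ∀ x, Represents 𝒜 0 (deg x) (p x) (γ x)) (M : List (Γ × List Γ)) :
    Represents 𝒜 (prodUp M) (prodDeg deg M) (prodVal deg (fun _ _ => PTot.pbr) p M)
      (prodVal deg (superBracket Λ) γ M) := by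
  have hl : ∀ x l, Represents 𝒜 l.length (lieDeg deg x l) (lieVal deg (fun _ _ => PTot.pbr) p x l)
      (lieVal deg (superBracket Λ) γ x l) := by
    intro x l
    induction l with
    | nil => exact h x
    | cons y l ih => exact ((h y).br ih).cast (by simp) rfl
  induction M with
  | nil => exact Represents.one
  | cons p M ih => exact (hl _ _).mul ih

end Represents

end NCPoisson

namespace NCPoisson

namespace PTot

/-! ### Homogeneous elements of the algebra inside the Poisson envelope -/

section OfLam

variable {Λ : Type u} [Ring Λ] [Algebra ℂ Λ] {𝒜 : ℤ → Submodule ℂ Λ} [GradedAlgebra 𝒜]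

/-- The class in the Poisson envelope of a homogeneous element of `Λ`. -/
noncomputable def ofLam (e : ℤ) : 𝒜 e →ₗ[ℂ] PTot (abelGrading 𝒜) where
  toFun x := of e (abelMk 𝒜 e x)
  map_add' x y := by
    rw [← map_add]
    exact of_congr rfl (map_add (Ideal.Quotient.mkₐ ℂ (ncIdeal 𝒜 1)) x.1 y.1)
  map_smul' c x := by
    rw [RingHom.id_apply, ← map_smul]
    exact of_congr rfl (map_smul (Ideal.Quotient.mkₐ ℂ (ncIdeal 𝒜 1)) c x.1)

lemma ofLam_congr {e e' : ℤ} {x : 𝒜 e} {y : 𝒜 e'} (he : e = e') (h : (x : Λ) = y) :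
    ofLam e x = ofLam e' y := of_congr he (congrArg (Ideal.Quotient.mkₐ ℂ (ncIdeal 𝒜 1)) h)

lemma ofLam_mul_ofLam {e e' : ℤ} (x : 𝒜 e) (y : 𝒜 e') :
    ofLam e x * ofLam e' y = ofLam (e + e') ⟨(x : Λ) * y, SetLike.mul_mem_graded x.2 y.2⟩ :=
  (of_mul_of _ _).trans
    (of_congr rfl (map_mul (Ideal.Quotient.mkₐ ℂ (ncIdeal 𝒜 1)) x.1 y.1).symm)

lemma ofLam_one : ofLam 0 ⟨1, SetLike.one_mem_graded 𝒜⟩ = (1 : PTot (abelGrading 𝒜)) :=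
  of_congr rfl (map_one (Ideal.Quotient.mkₐ ℂ (ncIdeal 𝒜 1)))

lemma ofLam_mem_Pl {e : ℤ} (x : 𝒜 e) : ofLam e x ∈ Pl (abelGrading 𝒜) e := of_mem_Pl _

lemma ofLam_mem_Pu {e : ℤ} (x : 𝒜 e) : ofLam e x ∈ Pu (abelGrading 𝒜) 0 := of_mem_Pu _

lemma ofLam_surjective {e : ℤ} (a : abelGrading 𝒜 e) : ∃ x, ofLam e x = of e a := by
  obtain ⟨_, x, hx, rfl⟩ := a
  exact ⟨⟨x, hx⟩, rfl⟩

end OfLam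

end PTot

/-! ### The Poisson envelope of the free product and its generators near a character -/

section FreeProductEnvelope

variable {R W : Type u} [Ring R] [Algebra ℂ R] [AddCommGroup W] [Module ℂ W]
  (𝒲 : ℤ → Submodule ℂ W) [DirectSum.Decomposition 𝒲]

variable (R) in
/-- The total space of the Poisson envelope of `(R ∗ T(W))^{ab}`. -/
abbrev Env : Type u := PTot (abelGrading (lamGrading R 𝒲))

lemma ofLam_inR_mul (x y : R) :
    PTot.ofLam 0 (⟨inR R W (x * y), inR_mem _⟩ : lamGrading R 𝒲 0) =
      PTot.ofLam 0 (⟨inR R W x, inR_mem _⟩ : lamGrading R 𝒲 0) *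
        PTot.ofLam 0 (⟨inR R W y, inR_mem _⟩ : lamGrading R 𝒲 0) := by
  rw [PTot.ofLam_mul_ofLam]
  exact PTot.ofLam_congr (add_zero 0).symm (map_mul (inR R W) x y)

lemma ofLam_inR_one :
    PTot.ofLam 0 (⟨inR R W 1, inR_mem _⟩ : lamGrading R 𝒲 0) = 1 := by
  rw [← PTot.ofLam_one]
  exact PTot.ofLam_congr rfl (map_one (inR R W))

/-- The homomorphism from `R` to the Poisson envelope. -/
noncomputable def envR : R →ₐ[ℂ] Env R 𝒲 :=
  AlgHom.ofLinearMap (PTot.ofLam 0 ∘ₗ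
      (inR R W).toLinearMap.codRestrict (lamGrading R 𝒲 0) inR_mem)
    (ofLam_inR_one 𝒲) (ofLam_inR_mul 𝒲)

lemma envR_apply (r : R) : envR 𝒲 r = PTot.ofLam 0 ⟨inR R W r, inR_mem r⟩ := rfl

lemma envR_mem_Pl (r : R) : envR 𝒲 r ∈ PTot.Pl (abelGrading (lamGrading R 𝒲)) 0 :=
  PTot.ofLam_mem_Pl _

lemma envR_mem_Pu (r : R) : envR 𝒲 r ∈ PTot.Pu (abelGrading (lamGrading R 𝒲)) 0 :=
  PTot.ofLam_mem_Pu _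

/-- The class in the Poisson envelope of a homogeneous element of `W`. -/
noncomputable def envW (R : Type u) [Ring R] [Algebra ℂ R] (a : ℤ) : 𝒲 a →ₗ[ℂ] Env R 𝒲 :=
  PTot.ofLam a ∘ₗ ((inW R W) ∘ₗ (𝒲 a).subtype).codRestrict (lamGrading R 𝒲 a) fun w => inW_mem w.2

lemma envW_apply {a : ℤ} (w : 𝒲 a) :
    envW 𝒲 R a w = PTot.ofLam a ⟨inW R W w, inW_mem w.2⟩ := rfl

/-- A linear map on `W` from linear maps on the homogeneous parts. -/
noncomputable def homLift {X : Type*} [AddCommGroup X] [Module ℂ X] (h : ∀ a, 𝒲 a →ₗ[ℂ] X) :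
    W →ₗ[ℂ] X :=
  DirectSum.toModule ℂ ℤ _ h ∘ₗ (DirectSum.decomposeLinearEquiv 𝒲).toLinearMap

lemma homLift_of {X : Type*} [AddCommGroup X] [Module ℂ X] (h : ∀ a, 𝒲 a →ₗ[ℂ] X) {a : ℤ}
    (w : 𝒲 a) : homLift 𝒲 h w = h a w := by
  simp only [homLift, LinearMap.comp_apply, LinearEquiv.coe_coe,
    DirectSum.decomposeLinearEquiv_apply, DirectSum.decompose_coe]
  exact DirectSum.toModule_lof ℂ a _

/-- To prove a property of `ofLam` it suffices to consider `R` and `W`. -/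
lemma ofLam_mem_of_closed (N : ℤ → Submodule ℂ (Env R 𝒲)) (hR : ∀ r, envR 𝒲 r ∈ N 0)
    (hW : ∀ a w, envW 𝒲 R a w ∈ N a)
    (hmul : ∀ e e' x y, x ∈ N e → y ∈ N e' → x * y ∈ N (e + e')) {e : ℤ}
    (x : lamGrading R 𝒲 e) : PTot.ofLam e x ∈ N e := by
  have key : ∀ {e : ℤ} {x : Lam R W} (h : IsWord R 𝒲 e x),
      PTot.ofLam e ⟨x, Submodule.subset_span h⟩ ∈ N e := fun {e x} h => by
    induction h with
    | base r => exact hR r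
    | @step e a x w hx hw r ih =>
      have := hmul _ _ _ _ (hmul _ _ _ _ ih (hW a ⟨w, hw⟩)) (hR r)
      rw [add_zero] at this
      refine Set.mem_of_eq_of_mem ?_ this
      rw [envW_apply, envR_apply, PTot.ofLam_mul_ofLam, PTot.ofLam_mul_ofLam]
      exact PTot.ofLam_congr (add_zero _).symm rfl
  -- Words span the piece, so the subspace where the claim holds, pushed into the free product,
  -- contains all of it.
  have hle : lamGrading R 𝒲 e ≤ ((N e).comap (PTot.ofLam e)).map (lamGrading R 𝒲 e).subtype :=
    Submodule.span_le.2 fun x hx => ⟨⟨x, Submodule.subset_span hx⟩, key hx, rfl⟩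
  obtain ⟨y, hy, hyx⟩ := hle x.2
  rwa [← Subtype.ext hyx]

/-- Coordinates of order `n` at a character. -/
structure Coordinates (χ : R →ₐ[ℂ] ℂ) (n : ℕ) where
  /-- the truncated expansion -/
  toFun : R →ₐ[ℂ] TruncT (Cotan χ) n
  /-- the coordinates -/
  coord : Cotan χ →ₗ[ℂ] R
  toFun_coord : ∀ u, toFun (coord u) = truncMk _ n (TensorAlgebra.ι ℂ u)
  coord_mem : ∀ u, coord u ∈ charKer χ
  exists_augIdeal : ∀ s ∈ charKer χ, ∃ t ∈ augIdeal (Cotan χ), truncMk _ n t = toFun s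
  charKer_le : ∀ k, charKer χ ≤
    Subalgebra.toSubmodule (Algebra.adjoin ℂ (Set.range coord)) ⊔ charKer χ ^ (k + 1)

lemma IsSmooth.nonempty_coordinates (hR : IsSmooth R) (χ : R →ₐ[ℂ] ℂ) {n : ℕ} (hn : 2 ≤ n) :
    Nonempty (Coordinates χ n) :=
  let ⟨f, r, h1, h2, h3, h4⟩ := exists_coordinates (χ := χ) hR hn
  ⟨⟨f, r, h1, h2, h3, h4⟩⟩

namespace Coordinates

variable {𝒲} {χ : R →ₐ[ℂ] ℂ} {n : ℕ} (κ : Coordinates χ n)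

/-- The indices of the generators: coordinates and homogeneous elements of `W`. -/
abbrev Gen (χ : R →ₐ[ℂ] ℂ) (𝒲 : ℤ → Submodule ℂ W) : Type u := Cotan χ ⊕ Σ a, 𝒲 a

/-- The degrees of the generators. -/
def deg : Gen χ 𝒲 → ℤ
  | .inl _ => 0
  | .inr p => p.1

/-- The generators in `R ∗ T(W)`. -/
noncomputable def gen : Gen χ 𝒲 → Lam R W
  | .inl u => inR R W (κ.coord u)
  | .inr p => inW R W p.2

omit [DirectSum.Decomposition 𝒲] in
lemma gen_mem (x : Gen χ 𝒲) : κ.gen x ∈ lamGrading R 𝒲 (deg x) :=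
  match x with
  | .inl _ => inR_mem _
  | .inr p => inW_mem p.2.2

/-- The generators in the Poisson envelope. -/
noncomputable def genEnv (x : Gen χ 𝒲) : Env R 𝒲 := PTot.ofLam (deg x) ⟨κ.gen x, κ.gen_mem x⟩

lemma genEnv_mem_Pl (x : Gen χ 𝒲) :
    κ.genEnv x ∈ PTot.Pl (abelGrading (lamGrading R 𝒲)) (deg x) := PTot.ofLam_mem_Pl _

lemma genEnv_mem_Pu (x : Gen χ 𝒲) :
    κ.genEnv x ∈ PTot.Pu (abelGrading (lamGrading R 𝒲)) 0 := PTot.ofLam_mem_Pu _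

lemma represents_gen (x : Gen χ 𝒲) :
    Represents (lamGrading R 𝒲) 0 (deg x) (κ.genEnv x) (κ.gen x) :=
  Represents.of ⟨κ.gen x, κ.gen_mem x⟩

/-! #### Approximation by products of Lie monomials -/

/-- The span of products of Lie monomials, up to the `N`-th power of the ideal of the character. -/
noncomputable def approx (d : ℕ) (e : ℤ) (N : ℕ) : Submodule ℂ (Env R 𝒲) :=
  prodGen deg (fun _ _ => PTot.pbr) κ.genEnv d e ⊔ PTot.adic (envR 𝒲) χ N

lemma approx_cast {d d' : ℕ} {e e' : ℤ} {N : ℕ} {x : Env R 𝒲} (h : x ∈ κ.approx d e N)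
    (hd : d = d') (he : e = e') : x ∈ κ.approx d' e' N := by subst hd he; exact h

lemma mul_mem_approx {d d' : ℕ} {e e' : ℤ} {N : ℕ} {x y : Env R 𝒲} (hx : x ∈ κ.approx d e N)
    (hy : y ∈ κ.approx d' e' N) : x * y ∈ κ.approx (d + d') (e + e') N := by
  obtain ⟨a, ha, a', ha', rfl⟩ := Submodule.mem_sup.1 hx
  obtain ⟨b, hb, b', hb', rfl⟩ := Submodule.mem_sup.1 hy
  have e1 : (a + a') * (b + b') = a * b + ((a + a') * b' + a' * b) := by noncomm_ring
  rw [e1]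
  exact Submodule.add_mem_sup (mul_mem_prodGen ha hb)
    (Submodule.add_mem _ (PTot.mul_adic (envR_mem_Pl 𝒲) _ hb') (PTot.adic_mul _ ha'))

/-- The bracket costs one order of approximation, because it lowers the power of `𝔪` by one. -/
lemma br_mem_approx {d d' : ℕ} {e e' : ℤ} {N : ℕ} {x y : Env R 𝒲}
    (hx : x ∈ κ.approx d e (N + 1)) (hy : y ∈ κ.approx d' e' (N + 1)) :
    PTot.pbr x y ∈ κ.approx (d + d' + 1) (e + e') N := by
  obtain ⟨a, ha, a', ha', rfl⟩ := Submodule.mem_sup.1 hx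
  obtain ⟨b, hb, b', hb', rfl⟩ := Submodule.mem_sup.1 hy
  have e1 : PTot.pbr (a + a') (b + b') =
      PTot.pbr a b + (PTot.pbr (a + a') b' + PTot.pbr a' b) := by
    simp only [map_add, LinearMap.add_apply]
    abel
  rw [e1]
  have h1 := PTot.br_adic (envR_mem_Pl 𝒲) (a + a') hb'
  have h2 := PTot.adic_br (envR_mem_Pl 𝒲) b ha'
  rw [Nat.add_sub_cancel] at h1 h2
  exact Submodule.add_mem_sup
    (br_mem_prodGen (superLeibniz_PTot (abelGrading (lamGrading R 𝒲))) κ.genEnv_mem_Pl ha hb)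
    (Submodule.add_mem _ h1 h2)

/-- After subtraction of its constant term, `r` is a polynomial in the coordinates modulo a high
power of `𝔪`. -/
lemma envR_mem_approx (r : R) (N : ℕ) : envR 𝒲 r ∈ κ.approx 0 0 N := by
  have hr : r - χ r • 1 ∈ charKer χ := by simp [mem_charKer]
  obtain ⟨x, hx, y, hy, h⟩ := Submodule.mem_sup.1 (κ.charKer_le N hr)
  have hone : (1 : Env R 𝒲) ∈ κ.approx 0 0 N := Submodule.mem_sup_left one_mem_prodGen
  have e1 : r = χ r • 1 + (x + y) := by rw [h]; abel
  rw [e1, map_add, map_add, map_smul, map_one]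
  refine Submodule.add_mem _ (Submodule.smul_mem _ _ hone) (Submodule.add_mem _ ?_
    (Submodule.mem_sup_right (PTot.adic_succ_le_self _ (PTot.pow_mem_adic hy))))
  clear h e1
  induction hx using Algebra.adjoin_induction with
  | mem x hx =>
    obtain ⟨u, rfl⟩ := hx
    exact Submodule.mem_sup_left (gen_mem_prodGen (deg := deg (χ := χ) (𝒲 := 𝒲))
      (g := κ.genEnv) (.inl u))
  | algebraMap z =>
    rw [AlgHom.commutes, Algebra.algebraMap_eq_smul_one]
    exact Submodule.smul_mem _ _ hone
  | add a b _ _ ha hb => rw [map_add]; exact Submodule.add_mem _ ha hb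
  | mul a b _ _ ha hb =>
    rw [map_mul]
    exact κ.approx_cast (κ.mul_mem_approx ha hb) (add_zero _) (add_zero _)

lemma envW_mem_approx {a : ℤ} (w : 𝒲 a) (N : ℕ) : envW 𝒲 R a w ∈ κ.approx 0 a N :=
  Submodule.mem_sup_left (gen_mem_prodGen (deg := deg (χ := χ) (𝒲 := 𝒲))
    (g := κ.genEnv) (.inr ⟨a, w⟩))

/-- Since each bracket consumes one order, the induction must run over all `N` at once; the orders
can be chosen high enough at the leaves. -/
lemma mon_mem_approx (m : PMon (abelGrading (lamGrading R 𝒲))) (N : ℕ) :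
    PTot.mon m ∈ κ.approx m.up m.low N := by
  induction m generalizing N with
  | of e a =>
    obtain ⟨x, hx⟩ := PTot.ofLam_surjective a
    change PTot.of e a ∈ _
    rw [← hx]
    exact ofLam_mem_of_closed 𝒲 (fun e => κ.approx 0 e N) (fun r => κ.envR_mem_approx r N)
      (fun a w => κ.envW_mem_approx w N)
      (fun e e' x y hx hy => κ.approx_cast (κ.mul_mem_approx hx hy) (add_zero _) rfl) x
  | mul m m' h h' => rw [PTot.mon_mul]; exact κ.mul_mem_approx (h N) (h' N)
  | br m m' h h' => rw [PTot.mon_br]; exact κ.br_mem_approx (h _) (h' _)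

end Coordinates

end FreeProductEnvelope

end NCPoisson

namespace NCPoisson

/-! ### The action of the free product on the truncated Poisson envelope -/

section Representation

variable {R W : Type u} [Ring R] [Algebra ℂ R] [AddCommGroup W] [Module ℂ W]
  (𝒲 : ℤ → Submodule ℂ W) [DirectSum.Decomposition 𝒲]

namespace Coordinates

variable (χ : R →ₐ[ℂ] ℂ) (n : ℕ)

/-- The truncation of the Poisson envelope at a character. -/
abbrev EnvQuot : Type u := PTot.WtQuot (envR 𝒲) χ n

/-- The filtration by weight on the truncation. -/
noncomputable def wtBar (K : ℕ) : Submodule ℂ (EnvQuot 𝒲 χ n) :=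
  (PTot.wt (envR 𝒲) χ K).map (PTot.wt (envR 𝒲) χ n).mkQ

/-- The filtration by upper degree on the truncation. -/
noncomputable def upBar (K : ℕ) : Submodule ℂ (EnvQuot 𝒲 χ n) :=
  (PTot.Pge (abelGrading (lamGrading R 𝒲)) K).map (PTot.wt (envR 𝒲) χ n).mkQ

lemma wtBar_antitone : Antitone (wtBar 𝒲 χ n) := fun _ _ h =>
  Submodule.map_mono (PTot.wt_antitone h)

lemma upBar_antitone : Antitone (upBar 𝒲 χ n) := fun _ _ h =>
  Submodule.map_mono (PTot.Pge_antitone h)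

variable {𝒲 χ n}

lemma mkQ_mem_wtBar_zero (q : Env R 𝒲) : (PTot.wt (envR 𝒲) χ n).mkQ q ∈ wtBar 𝒲 χ n 0 :=
  ⟨q, PTot.mem_wt_zero q, rfl⟩

lemma eq_zero_of_mem_wtBar {v : EnvQuot 𝒲 χ n} (hv : v ∈ wtBar 𝒲 χ n n) : v = 0 := by
  obtain ⟨q, hq, rfl⟩ := hv
  exact (Submodule.Quotient.mk_eq_zero _).2 hq

variable (κ : Coordinates χ n)

variable (𝒲) in
/-- The operators of the generators on the truncation. -/
noncomputable def op (x : Gen χ 𝒲) : Module.End ℂ (EnvQuot 𝒲 χ n) :=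
  PTot.genOp (envR_mem_Pl 𝒲) n κ.genEnv κ.genEnv_mem_Pu x

lemma prodVal_op_mem_raise_wtBar (M : List (Gen χ 𝒲 × List (Gen χ 𝒲))) :
    prodVal deg (superBracket _) (κ.op 𝒲) M ∈ raise (wtBar 𝒲 χ n) (2 * prodUp M) := by
  rintro K _ ⟨q, hq, rfl⟩
  exact PTot.prodVal_genOp_mem_wt (envR_mem_Pl 𝒲) n deg κ.genEnv κ.genEnv_mem_Pl
    κ.genEnv_mem_Pu M hq

lemma prodVal_op_mem_raise_upBar (M : List (Gen χ 𝒲 × List (Gen χ 𝒲))) :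
    prodVal deg (superBracket _) (κ.op 𝒲) M ∈ raise (upBar 𝒲 χ n) (prodUp M) := by
  rintro K _ ⟨q, hq, rfl⟩
  exact PTot.prodVal_genOp_mem_Pge (envR_mem_Pl 𝒲) n deg κ.genEnv κ.genEnv_mem_Pl
    κ.genEnv_mem_Pu M hq

lemma prodVal_op_one (M : List (Gen χ 𝒲 × List (Gen χ 𝒲))) :
    prodVal deg (superBracket _) (κ.op 𝒲) M ((PTot.wt (envR 𝒲) χ n).mkQ 1) -
      (prodLen M : ℂ) • (PTot.wt (envR 𝒲) χ n).mkQ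
        (prodVal deg (fun _ _ => PTot.pbr) κ.genEnv M) ∈ upBar 𝒲 χ n (prodUp M + 1) :=
  PTot.prodVal_genOp_one (envR_mem_Pl 𝒲) n deg κ.genEnv κ.genEnv_mem_Pl κ.genEnv_mem_Pu M

lemma op_inl_mem_raise (u : Cotan χ) : κ.op 𝒲 (.inl u) ∈ raise (wtBar 𝒲 χ n) 1 := by
  rintro K _ ⟨q, hq, rfl⟩
  exact ⟨_, PTot.op_char_mem_wt (envR_mem_Pl 𝒲) (envR_mem_Pu 𝒲) 1 (κ.coord_mem u) hq,
    (PTot.opBar_mk (envR_mem_Pl 𝒲) n ⟨_, κ.genEnv_mem_Pu (.inl u)⟩ q).symm⟩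

variable (𝒲) in
/-- The representation of the tensor algebra on the coordinates. -/
noncomputable def tensorRep :
    TensorAlgebra ℂ (Cotan χ) →ₐ[ℂ] Module.End ℂ (EnvQuot 𝒲 χ n) :=
  TensorAlgebra.lift ℂ (PTot.opBar (envR_mem_Pl 𝒲) n ∘ₗ
    ((envR 𝒲).toLinearMap ∘ₗ κ.coord).codRestrict (PTot.Pu (abelGrading (lamGrading R 𝒲)) 0)
      fun u => envR_mem_Pu 𝒲 (κ.coord u))

lemma tensorRep_ι (u : Cotan χ) :
    κ.tensorRep 𝒲 (TensorAlgebra.ι ℂ u) = κ.op 𝒲 (.inl u) :=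
  TensorAlgebra.lift_ι_apply _ u

lemma tensorRep_mem_raise (k : ℕ) {t : TensorAlgebra ℂ (Cotan χ)} (ht : t ∈ augIdeal _ ^ k) :
    κ.tensorRep 𝒲 t ∈ raise (wtBar 𝒲 χ n) k :=
  map_augIdeal_pow_mem_raise (wtBar_antitone 𝒲 χ n) _
    (fun u => by rw [tensorRep_ι]; exact κ.op_inl_mem_raise u) k ht

/-- Such a tensor raises the weight by `n`, and weight `n` is zero in the truncation. Thus the
action factors through the algebra in which the expansion of `R` takes values. -/
lemma tensorRep_eq_zero {t : TensorAlgebra ℂ (Cotan χ)} (ht : t ∈ augIdeal _ ^ n) :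
    κ.tensorRep 𝒲 t = 0 := by
  refine Submodule.linearMap_qext _ (LinearMap.ext fun q => ?_)
  have := κ.tensorRep_mem_raise n ht 0 _ (mkQ_mem_wtBar_zero q)
  rw [zero_add] at this
  exact eq_zero_of_mem_wtBar this

variable (𝒲) in
/-- The representation of the free product on the truncation. -/
noncomputable def rep : Lam R W →ₐ[ℂ] Module.End ℂ (EnvQuot 𝒲 χ n) :=
  lamLift ((Ideal.Quotient.liftₐ _ (κ.tensorRep 𝒲) fun _ ht => κ.tensorRep_eq_zero ht).comp
    κ.toFun) (homLift 𝒲 fun a => PTot.opBar (envR_mem_Pl 𝒲) n ∘ₗ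
      (envW 𝒲 R a).codRestrict (PTot.Pu (abelGrading (lamGrading R 𝒲)) 0)
        fun _ => PTot.ofLam_mem_Pu _)

lemma rep_inR {r : R} {t : TensorAlgebra ℂ (Cotan χ)} (h : truncMk _ n t = κ.toFun r) :
    κ.rep 𝒲 (inR R W r) = κ.tensorRep 𝒲 t := by
  rw [rep, lamLift_inR, AlgHom.comp_apply, ← h]
  exact Ideal.Quotient.liftₐ_apply _ _ _ _

/-- For coordinates this uses that the expansion sends them exactly, not only to first order, to the
free generators. -/
lemma rep_gen (x : Gen χ 𝒲) : κ.rep 𝒲 (κ.gen x) = κ.op 𝒲 x := by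
  rcases x with u | ⟨a, w⟩
  · exact (κ.rep_inR (κ.toFun_coord u).symm).trans (κ.tensorRep_ι u)
  · exact (lamLift_inW _ _ _).trans (homLift_of 𝒲 _ w)

lemma op_mem_prodGe (x : Gen χ 𝒲) : κ.op 𝒲 x ∈ prodGe deg (κ.op 𝒲) 0 (deg x) :=
  prodGen_le_prodGe le_rfl _ (gen_mem_prodGen x)

lemma tensorRep_mem_prodGe (t : TensorAlgebra ℂ (Cotan χ)) :
    κ.tensorRep 𝒲 t ∈ prodGe deg (κ.op 𝒲) 0 0 := by
  induction t using TensorAlgebra.induction with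
  | algebraMap z =>
    rw [AlgHom.commutes, Algebra.algebraMap_eq_smul_one]
    exact Submodule.smul_mem _ _ (prodGen_le_prodGe le_rfl _ one_mem_prodGen)
  | ι u => rw [tensorRep_ι]; exact κ.op_mem_prodGe (.inl u)
  | mul a b ha hb =>
    rw [map_mul]
    exact prodGe_cast (mul_mem_prodGe ha hb) (add_zero _) (add_zero _)
  | add a b ha hb => rw [map_add]; exact Submodule.add_mem _ ha hb

/-- The coordinates do not generate `R`, but `R` acts through noncommutative polynomials in them; so
every homogeneous element acts by a combination of products of the operators of the generators. -/
lemma rep_mem_prodGe (e : ℤ) (x : Lam R W) (hx : x ∈ lamGrading R 𝒲 e) :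
    κ.rep 𝒲 x ∈ prodGe deg (κ.op 𝒲) 0 e := by
  have hr : ∀ r, κ.rep 𝒲 (inR R W r) ∈ prodGe deg (κ.op 𝒲) 0 0 := fun r => by
    obtain ⟨t, ht⟩ := truncMk_surjective n (κ.toFun r)
    rw [κ.rep_inR ht]
    exact κ.tensorRep_mem_prodGe t
  have key : ∀ {e : ℤ} {x : Lam R W}, IsWord R 𝒲 e x →
      κ.rep 𝒲 x ∈ prodGe deg (κ.op 𝒲) 0 e := fun {e x} h => by
    induction h with
    | base r => exact hr r
    | @step e a x w hx hw r ih =>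
      have hw' : κ.rep 𝒲 (inW R W w) ∈ prodGe deg (κ.op 𝒲) 0 a := by
        have h1 := κ.op_mem_prodGe (.inr ⟨a, w, hw⟩)
        rw [← rep_gen] at h1
        exact h1
      rw [map_mul, map_mul]
      exact prodGe_cast (mul_mem_prodGe (mul_mem_prodGe ih hw') (hr r)) (add_zero _) (add_zero _)
  have hle : lamGrading R 𝒲 e ≤ (prodGe deg (κ.op 𝒲) 0 e).comap (κ.rep 𝒲).toLinearMap :=
    Submodule.span_le.2 fun x hx => key hx
  exact hle hx

/-- A Lie monomial with `k` brackets acts by an element with `k` brackets, each of weight 2. -/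
lemma rep_mem_raise_wtBar {d : ℕ} {x : Lam R W} (hx : x ∈ ncFiltration (lamGrading R 𝒲) d) :
    κ.rep 𝒲 x ∈ raise (wtBar 𝒲 χ n) (2 * d) :=
  map_ncFiltration_le κ.rep_mem_prodGe (K := fun d => raise (wtBar 𝒲 χ n) (2 * d))
    (fun _ _ h => raise_antitone (wtBar_antitone 𝒲 χ n) (by omega))
    κ.prodVal_op_mem_raise_wtBar hx

lemma rep_mem_raise_upBar {d : ℕ} {x : Lam R W} (hx : x ∈ ncFiltration (lamGrading R 𝒲) d) :
    κ.rep 𝒲 x ∈ raise (upBar 𝒲 χ n) d :=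
  map_ncFiltration_le κ.rep_mem_prodGe (K := raise (upBar 𝒲 χ n))
    (fun _ _ h => raise_antitone (upBar_antitone 𝒲 χ n) h)
    κ.prodVal_op_mem_raise_upBar hx

lemma rep_one_mem_upBar {d : ℕ} {x : Lam R W} (hx : x ∈ ncFiltration (lamGrading R 𝒲) d) :
    κ.rep 𝒲 x ((PTot.wt (envR 𝒲) χ n).mkQ 1) ∈ upBar 𝒲 χ n d := by
  have := κ.rep_mem_raise_upBar hx 0 _ ⟨1, PTot.mem_Pge.2 fun j hj => absurd hj (by omega), rfl⟩
  rwa [zero_add] at this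

end Coordinates

end Representation

end NCPoisson

namespace NCPoisson

/-- A variant of `ker_le_ker_of_eigen` for the image of a projection. -/
lemma eq_zero_of_eigen {F Z : Type*} [AddCommGroup F] [Module ℂ F] [AddCommGroup Z] [Module ℂ Z]
    {π : F →ₗ[ℂ] F} {q ψ : F →ₗ[ℂ] Z} (hπ : ∀ x, π (π x) = π x)
    (hker : ∀ x, π x = x → q x = 0 → ψ x = 0)
    (hspan : ∀ x, π x ∈
      Submodule.span ℂ {y | π y = y ∧ ∃ κ : ℂ, κ ≠ 0 ∧ ψ y = κ • q y} ⊔ LinearMap.ker q)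
    {x : F} (hx : π x = x) (h : ψ x = 0) : q x = 0 := by
  have hE : ∀ y ∈ Submodule.span ℂ {y | π y = y ∧ ∃ κ : ℂ, κ ≠ 0 ∧ ψ y = κ • q y}, π y = y := by
    intro y hy
    have hle : Submodule.span ℂ {y | π y = y ∧ ∃ κ : ℂ, κ ≠ 0 ∧ ψ y = κ • q y} ≤
        LinearMap.ker (π - LinearMap.id) := Submodule.span_le.2 fun y hy => by
      rw [SetLike.mem_coe, LinearMap.mem_ker, LinearMap.sub_apply, LinearMap.id_apply, hy.1,
        sub_self]
    exact sub_eq_zero.1 (hle hy)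
  -- Composing with the projection replaces the image of `π` by the whole space, where the previous
  -- lemma applies.
  have key := ker_le_ker_of_eigen (q := q ∘ₗ π) (ψ := ψ ∘ₗ π)
    (fun y hy => hker _ (hπ y) hy) (fun y => by
      obtain ⟨a, ha, b, hb, hab⟩ := Submodule.mem_sup.1 (hspan y)
      have e1 : y = a + (b + (y - π y)) := by rw [← add_assoc, hab]; abel
      have e2 : π b = b := by
        rw [eq_sub_of_add_eq' hab, map_sub, hπ, hE a ha]
      rw [e1]
      refine Submodule.add_mem_sup (Submodule.span_mono ?_ ha) (Submodule.add_mem _ ?_ ?_)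
      · rintro z ⟨hz, κ, hκ, h⟩
        exact ⟨κ, hκ, by rw [LinearMap.comp_apply, LinearMap.comp_apply, hz, h]⟩
      · rw [LinearMap.mem_ker, LinearMap.comp_apply, e2]; exact hb
      · rw [LinearMap.mem_ker, LinearMap.comp_apply, map_sub, hπ, sub_self, map_zero])
  have h1 : (q ∘ₗ π) x = 0 := key (show (ψ ∘ₗ π) x = 0 by rw [LinearMap.comp_apply, hx, h])
  rwa [LinearMap.comp_apply, hx] at h1

section ProjF

variable {A : Type u} [Ring A] [Algebra ℂ A] {𝒜 : ℤ → Submodule ℂ A}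

lemma PTot.projF_projF (d : ℕ) (x : PFree 𝒜) :
    PTot.projF 𝒜 d (PTot.projF 𝒜 d x) = PTot.projF 𝒜 d x := by
  have hx := mem_span_toFree x
  induction hx using Submodule.span_induction with
  | zero => simp
  | add x y _ _ hx hy => simp only [map_add, hx, hy]
  | smul c x _ hx => simp only [map_smul, hx]
  | mem x h =>
    obtain ⟨m, rfl⟩ := h
    rw [PTot.projF_toFree]
    split_ifs with h
    · rw [PTot.projF_toFree, if_pos h]
    · exact map_zero _

lemma PTot.projF_mul {m : PMon 𝒜} (hm : m.up = 0) (d : ℕ) (x : PFree 𝒜) :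
    PTot.projF 𝒜 d (bilinExt .mul m.toFree x) = bilinExt .mul m.toFree (PTot.projF 𝒜 d x) := by
  have hx := mem_span_toFree x
  induction hx using Submodule.span_induction with
  | zero => simp
  | add x y _ _ hx hy => simp only [map_add, hx, hy]
  | smul c x _ hx => simp only [map_smul, hx]
  | mem x h =>
    obtain ⟨m', rfl⟩ := h
    rw [bilinExt_toFree, PTot.projF_toFree, PTot.projF_toFree, PMon.up, hm, zero_add]
    split_ifs
    · rw [bilinExt_toFree]
    · exact (map_zero _).symm

end ProjF

section Evaluation

variable {Λ : Type u} [Ring Λ] [Algebra ℂ Λ] {𝒜 : ℤ → Submodule ℂ Λ} [GradedAlgebra 𝒜]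

lemma ev_projF_mem_ncFiltration (d : ℕ) (x : PFree (abelGrading 𝒜)) :
    ev 𝒜 (PTot.projF _ d x) ∈ ncFiltration 𝒜 d := by
  have hx := mem_span_toFree x
  induction hx using Submodule.span_induction with
  | zero => simp
  | add x y _ _ hx hy => rw [map_add, map_add]; exact Submodule.add_mem _ hx hy
  | smul c x _ hx => rw [map_smul, map_smul]; exact Submodule.smul_mem _ c hx
  | mem x h =>
    obtain ⟨m, rfl⟩ := h
    rw [PTot.projF_toFree]
    split_ifs with h
    · subst h
      exact ncSp_le _ _ (ev_mem (toFree_mem m))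
    · rw [map_zero]; exact Submodule.zero_mem _

lemma abelSec_abelMk_sub_mem {e : ℤ} (x : 𝒜 e) :
    (abelSec (abelMk 𝒜 e x) : Λ) - x ∈ ncFiltration 𝒜 1 :=
  ncSp_le _ _ (sub_mem_ncSp_one (abelSec _).2 x.2 (mk_abelSec (abelMk 𝒜 e x)))

end Evaluation

/-! ### The kernel of the comparison map near a character -/

section Injectivity

variable {R W : Type u} [Ring R] [Algebra ℂ R] [AddCommGroup W] [Module ℂ W]
  {𝒲 : ℤ → Submodule ℂ W} [DirectSum.Decomposition 𝒲]

namespace Coordinates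

variable {χ : R →ₐ[ℂ] ℂ} {n : ℕ} (κ : Coordinates χ n)

/-- The element `s` itself raises the weight by one since its expansion has no constant term; the
chosen representative differs from it by an element of `F^1`, which raises the weight by two. -/
lemma rep_abelSec_mem_raise {s : R} (hs : s ∈ charKer χ) :
    κ.rep 𝒲 (abelSec (abelMk (lamGrading R 𝒲) 0 ⟨inR R W s, inR_mem s⟩)) ∈
      raise (wtBar 𝒲 χ n) 1 := by
  have h1 := abelSec_abelMk_sub_mem (𝒜 := lamGrading R 𝒲) ⟨inR R W s, inR_mem s⟩
  obtain ⟨t, ht, hts⟩ := κ.exists_augIdeal s hs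
  have h2 := κ.tensorRep_mem_raise (𝒲 := 𝒲) 1 (t := t) (by rwa [Submodule.pow_one])
  rw [← κ.rep_inR hts] at h2
  have h3 := raise_antitone (wtBar_antitone 𝒲 χ n) (by omega : 1 ≤ 2 * 1) (κ.rep_mem_raise_wtBar h1)
  rw [map_sub] at h3
  exact (Submodule.sub_mem_iff_left _ h2).1 h3

/-- An element of `𝔪^N P` is the class of a combination of monomials whose components act as
operators that raise the weight by `N` more than expected. -/
lemma exists_rep_mem_raise (N : ℕ) : PTot.adic (envR 𝒲) χ N ≤
    (⨅ d, (raise (wtBar 𝒲 χ n) (N + 2 * d)).comap ((κ.rep 𝒲).toLinearMap ∘ₗ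
      ev (lamGrading R 𝒲) ∘ₗ PTot.projF _ d)).map (PTot.mk _) := by
  induction N with
  | zero =>
    intro p _
    obtain ⟨y, rfl⟩ := PTot.mk_surjective p
    refine ⟨y, (Submodule.mem_iInf _).2 fun d => ?_, rfl⟩
    have := κ.rep_mem_raise_wtBar (ev_projF_mem_ncFiltration d y)
    rwa [Submodule.mem_comap, zero_add]
  | succ N ih =>
    refine PTot.adic_succ_le fun s hs p hp => ?_
    obtain ⟨y, hy, rfl⟩ := ih hp
    -- The formal product with the generator of `s`: it contains no bracket, so it commutes with the
    -- projections to the components and adds one to the weight.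
    refine ⟨bilinExt .mul (PMon.of 0 (abelMk (lamGrading R 𝒲) 0 ⟨inR R W s, inR_mem s⟩)).toFree y,
      (Submodule.mem_iInf _).2 fun d => ?_, PTot.mk_mul _ _⟩
    have h1 := (Submodule.mem_iInf _).1 hy d
    rw [Submodule.mem_comap, LinearMap.comp_apply, LinearMap.comp_apply] at h1 ⊢
    rw [PTot.projF_mul rfl, ev_mul, ev_toFree, AlgHom.toLinearMap_apply, map_mul,
      show N + 1 + 2 * d = 1 + (N + 2 * d) by ring]
    exact mul_mem_raise (κ.rep_abelSec_mem_raise hs) h1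

/-- This makes the action on 1 a function of the class. Modulo relations, whose components evaluate
one filtration step deeper, `x` may be replaced by a combination whose component with `d` brackets
raises the weight by at least `n` and so acts by zero. -/
lemma rep_ev_one_mem_upBar {d : ℕ} {x : PFree (abelGrading (lamGrading R 𝒲))}
    (hx : PTot.projF _ d x = x) (hm : PTot.mk _ x ∈ PTot.adic (envR 𝒲) χ (n - 2 * d)) :
    κ.rep 𝒲 (ev _ x) ((PTot.wt (envR 𝒲) χ n).mkQ 1) ∈ upBar 𝒲 χ n (d + 1) := by
  obtain ⟨y, hy, hyx⟩ := κ.exists_rep_mem_raise _ hm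
  have h1 := (Submodule.mem_iInf _).1 hy d 0 _ (mkQ_mem_wtBar_zero 1)
  have h2 := eq_zero_of_mem_wtBar (wtBar_antitone 𝒲 χ n (by omega) h1)
  have h3 : x - y ∈ relSpan _ := PTot.mk_eq_zero.1 (by rw [map_sub, hyx, sub_self])
  have h4 := κ.rep_one_mem_upBar (ev_projF_mem h3 d)
  rw [map_sub, map_sub, map_sub, LinearMap.sub_apply, hx] at h4
  exact (Submodule.sub_mem_iff_left _ (by
    rw [LinearMap.comp_apply, LinearMap.comp_apply, AlgHom.toLinearMap_apply] at h2
    rw [h2]; exact Submodule.zero_mem _)).1 h4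

variable (χ n 𝒲) in
/-- The class of a formal combination in the truncation modulo higher upper degree. -/
noncomputable def cls (d : ℕ) : PFree (abelGrading (lamGrading R 𝒲)) →ₗ[ℂ]
    EnvQuot 𝒲 χ n ⧸ upBar 𝒲 χ n (d + 1) :=
  (upBar 𝒲 χ n (d + 1)).mkQ ∘ₗ (PTot.wt (envR 𝒲) χ n).mkQ ∘ₗ PTot.mk _

variable (𝒲) in
/-- The action of a formal combination on the unit, modulo higher upper degree. -/
noncomputable def act (d : ℕ) : PFree (abelGrading (lamGrading R 𝒲)) →ₗ[ℂ]
    EnvQuot 𝒲 χ n ⧸ upBar 𝒲 χ n (d + 1) :=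
  (upBar 𝒲 χ n (d + 1)).mkQ ∘ₗ LinearMap.applyₗ ((PTot.wt (envR 𝒲) χ n).mkQ 1) ∘ₗ
    (κ.rep 𝒲).toLinearMap ∘ₗ ev _

lemma act_eq_zero {d : ℕ} {x : PFree (abelGrading (lamGrading R 𝒲))} :
    κ.act 𝒲 d x = 0 ↔
      κ.rep 𝒲 (ev _ x) ((PTot.wt (envR 𝒲) χ n).mkQ 1) ∈ upBar 𝒲 χ n (d + 1) :=
  Submodule.Quotient.mk_eq_zero _

/-- Weight at least `n` for an element with exactly `d` brackets means order `n - 2 * d` along `𝔪`,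
and dividing by more brackets does not affect this component. -/
lemma cls_eq_zero {d : ℕ} {x : PFree (abelGrading (lamGrading R 𝒲))}
    (hx : PTot.projF _ d x = x) :
    cls 𝒲 χ n d x = 0 ↔ PTot.mk _ x ∈ PTot.adic (envR 𝒲) χ (n - 2 * d) := by
  have hp : PTot.proj (abelGrading (lamGrading R 𝒲)) d (PTot.mk _ x) = PTot.mk _ x := by
    rw [PTot.proj_mk, hx]
  constructor
  · intro h
    obtain ⟨z, hz, hzx⟩ := (Submodule.Quotient.mk_eq_zero (upBar 𝒲 χ n (d + 1))).1 h
    have h1 := PTot.mem_wt.1 ((Submodule.Quotient.eq _).1 hzx) d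
    rw [map_sub, hp, PTot.mem_Pge.1 hz d (Nat.lt_succ_self d), zero_sub] at h1
    exact neg_mem_iff.1 h1
  · intro h
    have h1 : PTot.mk _ x ∈ PTot.wt (envR 𝒲) χ n := PTot.mem_wt.2 fun j => by
      have := PTot.proj_mem d (PTot.mk (abelGrading (lamGrading R 𝒲)) x)
      rw [hp] at this
      rw [PTot.proj_of_mem this]
      split_ifs with hj
      · rwa [← hj]
      · exact Submodule.zero_mem _
    have h2 : (PTot.wt (envR 𝒲) χ n).mkQ (PTot.mk _ x) = 0 :=
      (Submodule.Quotient.mk_eq_zero _).2 h1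
    rw [cls, LinearMap.comp_apply, LinearMap.comp_apply, h2, map_zero]

/-- Products of Lie monomials are represented by eigenvectors. -/
lemma exists_eigenvector (M : List (Gen χ 𝒲 × List (Gen χ 𝒲))) :
    ∃ y, PTot.projF _ (prodUp M) y = y ∧
      PTot.mk _ y = prodVal deg (fun _ _ => PTot.pbr) κ.genEnv M ∧
      κ.act 𝒲 (prodUp M) y = (prodLen M : ℂ) • cls 𝒲 χ n (prodUp M) y := by
  obtain ⟨-, y, hy, hyM, h⟩ := represents_prodVal κ.represents_gen M
  refine ⟨y, by rw [PTot.projF_of_mem hy, if_pos rfl], hyM, ?_⟩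
  -- The evaluation of `y` differs from the product of Lie monomials in `Λ` by an element of the
  -- next filtration step, which is invisible here; the latter acts on 1 with leading coefficient
  -- `prodLen M`.
  have h1 := κ.rep_one_mem_upBar (ncSp_le _ _ h)
  have h2 := κ.prodVal_op_one M
  rw [← map_prodVal (κ.rep 𝒲) κ.gen κ.rep_gen] at h2
  rw [map_sub, LinearMap.sub_apply] at h1
  have h3 := Submodule.add_mem _ h1 h2
  rw [sub_add_sub_cancel, ← hyM] at h3
  exact ((Submodule.Quotient.eq (upBar 𝒲 χ n (prodUp M + 1))).2 h3).trans
    (map_smul (upBar 𝒲 χ n (prodUp M + 1)).mkQ _ _)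

variable (𝒲) in
/-- The formal combinations of upper degree `d` on which the action on the unit is a nonzero
multiple of the class. -/
def eigenvectors (d : ℕ) : Set (PFree (abelGrading (lamGrading R 𝒲))) :=
  {y | PTot.projF _ d y = y ∧ ∃ z : ℂ, z ≠ 0 ∧ κ.act 𝒲 d y = z • cls 𝒲 χ n d y}

lemma exists_mem_span_eigenvectors {d : ℕ} {e : ℤ} {p : Env R 𝒲}
    (hp : p ∈ prodGen deg (fun _ _ => PTot.pbr) κ.genEnv d e) :
    ∃ y ∈ Submodule.span ℂ (κ.eigenvectors 𝒲 d), PTot.mk _ y = p := by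
  have hle : prodGen deg (fun _ _ => PTot.pbr) (κ.genEnv (𝒲 := 𝒲)) d e ≤
      (Submodule.span ℂ (κ.eigenvectors 𝒲 d)).map (PTot.mk _) := by
    refine Submodule.span_le.2 ?_
    rintro _ ⟨M, rfl, rfl, rfl⟩
    obtain ⟨y, hy, hyM, h⟩ := κ.exists_eigenvector M
    exact ⟨y, Submodule.subset_span ⟨hy, _, Nat.cast_ne_zero.2 (prodLen_ne_zero M), h⟩, hyM⟩
  exact hle hp

lemma projF_eq_of_mem_span_eigenvectors {d : ℕ} {y : PFree (abelGrading (lamGrading R 𝒲))}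
    (hy : y ∈ Submodule.span ℂ (κ.eigenvectors 𝒲 d)) : PTot.projF _ d y = y := by
  have hle : Submodule.span ℂ (κ.eigenvectors 𝒲 d) ≤
      LinearMap.ker (PTot.projF _ d - LinearMap.id) := Submodule.span_le.2 fun y hy => by
    rw [SetLike.mem_coe, LinearMap.mem_ker, LinearMap.sub_apply, LinearMap.id_apply, hy.1,
      sub_self]
  exact sub_eq_zero.1 (hle hy)

/-- Up to `𝔪^{n - 2d} P`, which is exactly what `cls` kills, monomials are combinations of products
of Lie monomials in the generators, and these are represented by eigenvectors. -/
lemma projF_mem_span_eigenvectors (d : ℕ) (x : PFree (abelGrading (lamGrading R 𝒲))) :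
    PTot.projF _ d x ∈
      Submodule.span ℂ (κ.eigenvectors 𝒲 d) ⊔ LinearMap.ker (cls 𝒲 χ n d) := by
  have hx := mem_span_toFree x
  induction hx using Submodule.span_induction with
  | zero => rw [map_zero]; exact Submodule.zero_mem _
  | add x y _ _ hx hy => rw [map_add]; exact Submodule.add_mem _ hx hy
  | smul c x _ hx => rw [map_smul]; exact Submodule.smul_mem _ c hx
  | mem x h =>
    obtain ⟨m, rfl⟩ := h
    by_cases hm : m.up = d
    · obtain ⟨p, hp, a, ha, hpa⟩ := Submodule.mem_sup.1 (κ.mon_mem_approx m (n - 2 * d))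
      rw [hm] at hp
      obtain ⟨y, hy, rfl⟩ := κ.exists_mem_span_eigenvectors hp
      rw [PTot.projF_toFree, if_pos hm, ← add_sub_cancel y m.toFree]
      refine Submodule.add_mem_sup hy ?_
      have hm' : PTot.projF _ d (m.toFree - y) = m.toFree - y := by
        rw [map_sub, κ.projF_eq_of_mem_span_eigenvectors hy, PTot.projF_toFree, if_pos hm]
      refine (cls_eq_zero hm').2 ?_
      have e1 : PTot.mk (abelGrading (lamGrading R 𝒲)) (m.toFree - y) = a := by
        rw [map_sub, sub_eq_iff_eq_add, add_comm]
        exact hpa.symm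
      rwa [e1]
    · rw [PTot.projF_toFree, if_neg hm]
      exact Submodule.zero_mem _

/-- An element evaluating into `F^{d+1}` acts on 1 by zero modulo more than `d` brackets. Since the
passage from class to action is diagonalizable with nonzero eigenvalues, the class vanishes. -/
theorem mk_mem_adic (κ : Coordinates χ n) {d : ℕ} {x : PFree (abelGrading (lamGrading R 𝒲))}
    (hx : PTot.projF _ d x = x) (h : ev _ x ∈ ncFiltration (lamGrading R 𝒲) (d + 1)) :
    PTot.mk _ x ∈ PTot.adic (envR 𝒲) χ (n - 2 * d) :=
  (cls_eq_zero hx).1 (eq_zero_of_eigen (π := PTot.projF _ d) (ψ := κ.act 𝒲 d)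
    (PTot.projF_projF d)
    (fun _ hx h => κ.act_eq_zero.2 (κ.rep_ev_one_mem_upBar hx ((cls_eq_zero hx).1 h)))
    (κ.projF_mem_span_eigenvectors d) hx (κ.act_eq_zero.2 (κ.rep_one_mem_upBar h)))

end Coordinates

/-- The classes of the elements of the kernel of the evaluation lie in all powers of the ideals of
all characters. -/
theorem IsSmooth.mk_mem_adic (hR : IsSmooth R) (χ : R →ₐ[ℂ] ℂ) {d : ℕ} {e : ℤ}
    {x : PFree (abelGrading (lamGrading R 𝒲))} (hx : x ∈ monSpan _ d e)
    (h : ev _ x ∈ ncFiltration (lamGrading R 𝒲) (d + 1)) (N : ℕ) :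
    PTot.mk _ x ∈ PTot.adic (envR 𝒲) χ N := by
  -- The order must exceed `N` by the weight `2 * d` of the brackets and be at least 2.
  obtain ⟨κ⟩ := hR.nonempty_coordinates χ (n := N + 2 * d + 2) (by omega)
  exact PTot.adic_antitone (by omega)
    (κ.mk_mem_adic (by rw [PTot.projF_of_mem hx, if_pos rfl]) h)

end Injectivity

end NCPoisson

namespace NCPoisson

/-! ### The intersection of the powers of the ideals of all characters -/

section Krull

/-- A maximal ideal of a finitely generated algebra is the kernel of a character. -/
lemma exists_ker_eq_of_isMaximal {Z : Type*} [CommRing Z] [Algebra ℂ Z] [Algebra.FiniteType ℂ Z]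
    (I : Ideal Z) [I.IsMaximal] : ∃ χ : Z →ₐ[ℂ] ℂ, RingHom.ker χ = I := by
  let _ : Field (Z ⧸ I) := Ideal.Quotient.field I
  have := finite_of_finite_type_of_isJacobsonRing ℂ (Z ⧸ I)
  let φ : ℂ ≃ₐ[ℂ] Z ⧸ I := AlgEquiv.ofBijective (Algebra.ofId ℂ (Z ⧸ I))
    IsAlgClosed.algebraMap_bijective_of_isIntegral
  refine ⟨φ.symm.toAlgHom.comp (Ideal.Quotient.mkₐ ℂ I), Ideal.ext fun z => ?_⟩
  rw [RingHom.mem_ker, ← Ideal.Quotient.eq_zero_iff_mem]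
  exact map_eq_zero_iff φ.symm φ.symm.injective

/-- If `y ≠ 0`, its annihilator lies in a maximal ideal, which is the kernel of a character by the
Nullstellensatz. Krull's intersection theorem gives `r` in this ideal with `r y = y`; then `1 - r`
annihilates `y`, so 1 lies in the maximal ideal. -/
lemma eq_zero_of_mem_ker_pow_smul {Z P : Type*} [CommRing Z] [Algebra ℂ Z]
    [Algebra.FiniteType ℂ Z] [AddCommGroup P] [Module Z P] {K : Submodule Z P} (hK : K.FG) {y : P}
    (hy : y ∈ K) (h : ∀ (χ : Z →ₐ[ℂ] ℂ) (N : ℕ), y ∈ RingHom.ker χ ^ N • K) : y = 0 := by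
  by_contra hy0
  let I : Ideal Z := LinearMap.ker (LinearMap.toSpanSingleton Z P y)
  have hI : I ≠ ⊤ := fun hI => hy0 (by
    have : (1 : Z) ∈ I := hI ▸ Submodule.mem_top
    rwa [LinearMap.mem_ker, LinearMap.toSpanSingleton_apply, one_smul] at this)
  obtain ⟨𝔪, h𝔪, hle⟩ := Ideal.exists_le_maximal I hI
  obtain ⟨χ, rfl⟩ := exists_ker_eq_of_isMaximal 𝔪
  have := Algebra.FiniteType.isNoetherianRing ℂ Z
  have : Module.Finite Z K := Module.Finite.iff_fg.2 hK
  obtain ⟨r, hr⟩ := (Ideal.mem_iInf_smul_pow_eq_bot_iff (RingHom.ker χ) (⟨y, hy⟩ : K)).1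
    ((Submodule.mem_iInf _).2 fun N => (Submodule.mem_smul_top_iff _ _ _).2 (h χ N))
  have h1 : (1 - r.1 : Z) ∈ I := by
    rw [LinearMap.mem_ker, LinearMap.toSpanSingleton_apply, sub_smul, one_smul, sub_eq_zero]
    exact (congrArg Subtype.val hr).symm
  have h2 := Ideal.add_mem _ (hle h1) r.2
  rw [sub_add_cancel] at h2
  exact h𝔪.ne_top ((Ideal.eq_top_iff_one _).2 h2)

end Krull

/-! ### Finite generation of the part with a given number of brackets -/

section FiniteGeneration

variable {Z P : Type*} [CommRing Z] [Ring P] [Algebra Z P]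

/-- Monomials without repetitions in elements that commute up to scalars and have scalar squares
generate a module that is closed under multiplication by these elements. -/
lemma exists_fg_closed (l : List P) (hsq : ∀ w ∈ l, ∃ z : Z, w * w = algebraMap Z P z)
    (hcomm : ∀ v ∈ l, ∀ w ∈ l, ∃ z : Z, v * w = z • (w * v)) :
    ∃ K : Submodule Z P, K.FG ∧ 1 ∈ K ∧ ∀ w ∈ l, ∀ x ∈ K, w * x ∈ K := by
  induction l with
  | nil => exact ⟨Submodule.span Z {1}, Submodule.fg_span_singleton _,
    Submodule.mem_span_singleton_self _, by simp⟩
  | cons v l ih =>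
    obtain ⟨K, hK, h1, hl⟩ := ih (fun w hw => hsq w (List.mem_cons_of_mem _ hw))
      fun w hw w' hw' => hcomm w (List.mem_cons_of_mem _ hw) w' (List.mem_cons_of_mem _ hw')
    -- At most one factor `v`, written in front; a second one is absorbed by the scalar `v * v`.
    refine ⟨K ⊔ K.map (LinearMap.mulLeft Z v), hK.sup (hK.map _), Submodule.mem_sup_left h1, ?_⟩
    intro w hw x hx
    obtain ⟨a, ha, _, ⟨b, hb, rfl⟩, rfl⟩ := Submodule.mem_sup.1 hx
    rw [mul_add, LinearMap.mulLeft_apply, ← mul_assoc]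
    rcases List.mem_cons.1 hw with rfl | hw'
    · obtain ⟨z, hz⟩ := hsq w hw
      rw [hz, ← Algebra.smul_def, add_comm]
      exact Submodule.add_mem_sup (Submodule.smul_mem _ z hb) ⟨a, ha, rfl⟩
    · obtain ⟨z, hz⟩ := hcomm w hw v List.mem_cons_self
      rw [hz, smul_mul_assoc, mul_assoc]
      exact Submodule.add_mem_sup (hl w hw' a ha)
        (Submodule.smul_mem _ z ⟨w * b, hl w hw' b hb, rfl⟩)

end FiniteGeneration

namespace PTot

section FiniteGeneration

variable {A : Type u} [Ring A] [Algebra ℂ A] {𝒜 : ℤ → Submodule ℂ A} [SetLike.GradedMonoid 𝒜]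
  {Z : Type*} [CommRing Z] [Algebra ℂ Z] [Algebra Z (PTot 𝒜)] [IsScalarTower ℂ Z (PTot 𝒜)]
  {Γ : Type*} [Finite Γ] {deg : Γ → ℤ} {g : Γ → PTot 𝒜}

/-- If finitely many homogeneous elements have scalar squares, then the products of Lie monomials
in them with a given number of brackets lie in a finitely generated module. -/
lemma exists_fg_prodVal_mem (hg : ∀ x, g x ∈ Pl 𝒜 (deg x))
    (hsq : ∀ x, ∃ z : Z, g x * g x = algebraMap Z _ z) (d : ℕ) :
    ∃ K : Submodule Z (PTot 𝒜), K.FG ∧ (∀ x, ∀ k ∈ K, g x * k ∈ K) ∧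
      ∀ M, prodUp M = d → prodVal deg (fun _ _ => pbr) g M ∈ K := by
  have hcomm : ∀ {a b : ℤ} {p q : PTot 𝒜}, p ∈ Pl 𝒜 a → q ∈ Pl 𝒜 b →
      p * q = algebraMap ℂ Z (sgn a b) • (q * p) := fun hp hq => by
    rw [algebraMap_smul]
    exact mul_comm_of_mem hp hq
  have hlie : ∀ x l, lieVal deg (fun _ _ => pbr) g x l ∈ Pl 𝒜 (lieDeg deg x l) :=
    lieVal_mem (superLeibniz_PTot 𝒜) hg
  induction d using Nat.strong_induction_on with
  | _ d ih =>
    rcases Nat.eq_zero_or_pos d with rfl | hd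
    · have := Fintype.ofFinite Γ
      obtain ⟨K, hK, h1, h⟩ := exists_fg_closed (Z := Z) (Finset.univ.toList.map g)
        (by simpa using hsq) (by
          simp only [List.mem_map, Finset.mem_toList, Finset.mem_univ, true_and,
            forall_exists_index, forall_apply_eq_imp_iff]
          exact fun x y => ⟨_, hcomm (hg x) (hg y)⟩)
      have h' : ∀ x, ∀ k ∈ K, g x * k ∈ K := fun x => h _ (by simp)
      refine ⟨K, hK, h', fun M => ?_⟩
      induction M with
      | nil => exact fun _ => h1
      | cons p M ihM =>
        obtain ⟨x, l⟩ := p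
        intro hM
        have hl : l = [] := List.length_eq_zero_iff.1 (Nat.eq_zero_of_add_eq_zero_right hM)
        subst hl
        exact h' x _ (ihM (Nat.eq_zero_of_add_eq_zero_left hM))
    · choose! K hK hgK hMK using ih
      let ι := Γ × {l : List Γ // l.length ≤ d}
      have : Finite {l : List Γ // l.length ≤ d} := List.finite_length_le Γ d
      let L : ι → Submodule Z (PTot 𝒜) := fun i => if 0 < i.2.1.length then
        (K (d - i.2.1.length)).map (LinearMap.mulLeft Z (lieVal deg (fun _ _ => pbr) g i.1 i.2.1))
        else ⊥
      have hclosed : ∀ x, ∀ k ∈ iSup L, g x * k ∈ iSup L := by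
        intro x
        have hle : iSup L ≤ (iSup L).comap (LinearMap.mulLeft Z (g x)) := by
          refine iSup_le fun i => ?_
          by_cases hi : 0 < i.2.1.length
          · simp only [L, if_pos hi]
            rintro _ ⟨k, hk, rfl⟩
            -- The generator is moved past the Lie monomial by super commutativity and absorbed by
            -- the module for fewer brackets.
            rw [Submodule.mem_comap, LinearMap.mulLeft_apply, LinearMap.mulLeft_apply, ← mul_assoc,
              hcomm (hg x) (hlie _ _), smul_mul_assoc, mul_assoc]
            refine Submodule.smul_mem _ _ (Submodule.mem_iSup_of_mem i ?_)
            simp only [if_pos hi]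
            exact ⟨_, hgK _ (by omega) x k hk, rfl⟩
          · simp only [L, if_neg hi]; exact bot_le
        exact fun k hk => hle hk
      refine ⟨iSup L, Submodule.fg_iSup _ fun i => ?_, hclosed, fun M => ?_⟩
      · by_cases hi : 0 < i.2.1.length
        · simp only [L, if_pos hi]; exact (hK _ (by omega)).map _
        · simp only [L, if_neg hi]; exact Submodule.fg_bot
      · induction M with
        | nil => intro hM; exact absurd hM hd.ne
        | cons p M ihM =>
          obtain ⟨x, l⟩ := p
          intro hM
          change l.length + prodUp M = d at hM
          by_cases hl : 0 < l.length
          · refine Submodule.mem_iSup_of_mem (⟨x, l, by omega⟩ : ι) ?_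
            simp only [if_pos hl]
            exact ⟨_, hMK _ (by omega) M (by omega), rfl⟩
          -- Factors without brackets at the front are single generators, under which the module is
          -- closed.
          · have hl' : l = [] := List.length_eq_zero_iff.1 (by omega)
            subst hl'
            exact hclosed x _ (ihM (by simpa using hM))

end FiniteGeneration

end PTot

end NCPoisson

namespace NCPoisson

/-! ### Finite sets of generators -/

section Finiteness

/-- A homomorphism with commuting values kills the commutator ideal. -/
lemma map_eq_zero_of_commute {B C : Type u} [Ring B] [Algebra ℂ B] [Ring C] [Algebra ℂ C]
    (f : B →ₐ[ℂ] C) (hf : ∀ x y, f x * f y = f y * f x) {x : B} (hx : x ∈ ncF B 1) : f x = 0 := by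
  have h0 : ∀ {e z}, z ∈ trivialGrading B e → z ≠ 0 → e = 0 := by
    intro e z hz hz0
    by_contra he
    rw [trivialGrading, if_neg he] at hz
    exact hz0 hz
  have hlie : ∀ {k e x}, IsLieMonomial (trivialGrading B) k e x →
      (x ≠ 0 → e = 0) ∧ (2 ≤ k → f x = 0) := by
    intro k e x h
    induction h with
    | base hx => exact ⟨h0 hx, by omega⟩
    | @step k a b x y hx hy ih =>
      by_cases hx0 : x = 0
      · simp [hx0]
      by_cases hy0 : y = 0
      · simp [hy0]
      rw [h0 hx hx0, ih.1 hy0, sgn_zero_left, one_smul]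
      exact ⟨fun _ => add_zero 0, fun _ => by rw [map_sub, map_mul, map_mul, hf, sub_self]⟩
  have hspan : ∀ k, 2 ≤ k → lieSpan (trivialGrading B) k ≤ LinearMap.ker f.toLinearMap :=
    fun k hk => Submodule.span_le.2 fun x ⟨e, hx⟩ => (hlie hx).2 hk
  -- The condition forces some entry to be at least 2, and the corresponding factor consists of
  -- commutators.
  have hl : ∀ l : List ℕ, l.length < l.sum →
      (l.map fun i => lieSpan (trivialGrading B) i * (⊤ : Submodule ℂ B)).prod ≤
        LinearMap.ker f.toLinearMap := by
    intro l
    induction l with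
    | nil => intro h; exact absurd h (lt_irrefl _)
    | cons i l ih =>
      intro h
      rw [List.map_cons, List.prod_cons]
      refine Submodule.mul_le.2 fun x hx y hy => ?_
      rw [LinearMap.mem_ker, AlgHom.toLinearMap_apply, map_mul]
      rcases Nat.lt_or_ge i 2 with hi | hi
      · rw [List.length_cons, List.sum_cons] at h
        have : f y = 0 := ih (by omega) hy
        rw [this, mul_zero]
      · have : lieSpan (trivialGrading B) i * (⊤ : Submodule ℂ B) ≤
            LinearMap.ker f.toLinearMap := Submodule.mul_le.2 fun x hx y _ => by
          have hx : f x = 0 := hspan i hi hx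
          rw [LinearMap.mem_ker, AlgHom.toLinearMap_apply, map_mul, hx, zero_mul]
        have hx : f x = 0 := this hx
        rw [hx, zero_mul]
  have hle : ncFiltration (trivialGrading B) 1 ≤ LinearMap.ker f.toLinearMap := by
    refine iSup_le fun l => Submodule.mul_le.2 fun x _ y hy => ?_
    have : f y = 0 := hl l.1 (by omega) hy
    rw [LinearMap.mem_ker, AlgHom.toLinearMap_apply, map_mul, this, mul_zero]
  exact hle hx

/-- A smooth algebra is finitely generated modulo its commutator ideal. -/
lemma IsSmooth.exists_finset {R : Type u} [Ring R] [Algebra ℂ R] (hR : IsSmooth R) :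
    ∃ t : Finset R, ∀ r, ∃ r' ∈ Algebra.adjoin ℂ (t : Set R), r - r' ∈ ncF R 1 := by
  obtain ⟨hnil, ⟨hft, -⟩, -⟩ := hR.2 0
  -- The finiteness condition for `R^{≤ 0}` concerns its own abelianization; this second truncation
  -- changes nothing because `R^{≤ 0}` is NC nilpotent of degree 0.
  let φ : R →ₐ[ℂ] Trunc (Trunc R 0) 0 :=
    (Ideal.Quotient.mkₐ ℂ (ncF (Trunc R 0) 1)).comp (Ideal.Quotient.mkₐ ℂ (ncF R 1))
  have hφ : Function.Surjective φ :=
    (Ideal.Quotient.mkₐ_surjective ℂ _).comp (Ideal.Quotient.mkₐ_surjective ℂ _)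
  have hker : ∀ r, φ r = 0 → r ∈ ncF R 1 := fun r hr => by
    have h1 : Ideal.Quotient.mkₐ ℂ (ncF R 1) r ∈ ncF (Trunc R 0) 1 :=
      Ideal.Quotient.eq_zero_iff_mem.1 hr
    rw [show ncF (Trunc R 0) 1 = ⊥ from hnil] at h1
    exact Ideal.Quotient.eq_zero_iff_mem.1 h1
  obtain ⟨s, hs⟩ := hft.out
  classical
  choose ψ hψ using hφ
  refine ⟨s.image ψ, fun r => ?_⟩
  have h1 : φ r ∈ (Algebra.adjoin ℂ ((s.image ψ : Finset R) : Set R)).map φ := by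
    rw [← Algebra.adjoin_image, Finset.coe_image, ← Set.image_comp,
      show φ ∘ ψ = id from funext hψ, Set.image_id, hs]
    trivial
  obtain ⟨r', hr', h⟩ := h1
  refine ⟨r', hr', hker _ ?_⟩
  rw [map_sub, sub_eq_zero]
  exact h.symm

/-- Bases of the homogeneous parts together form a basis of `W`, hence are finite in total. Spanning
is expressed by subspaces so that it can be applied to preimages under `envW`. -/
lemma exists_finite_homogeneous {W : Type u} [AddCommGroup W] [Module ℂ W] [FiniteDimensional ℂ W]
    (𝒲 : ℤ → Submodule ℂ W) [DirectSum.Decomposition 𝒲] :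
    ∃ (J : Type) (_ : Finite J) (dg : J → ℤ) (w : ∀ j, 𝒲 (dg j)), ∀ (a : ℤ) (K : Submodule ℂ (𝒲 a)),
      (∀ j (h : dg j = a), (h ▸ w j) ∈ K) → K = ⊤ := by
  let b := fun a => Module.finBasis ℂ (𝒲 a)
  refine ⟨Σ a, Fin (Module.finrank ℂ (𝒲 a)), Module.Finite.finite_basis
    ((DirectSum.Decomposition.isInternal 𝒲).collectedBasis b), Sigma.fst, fun j => b j.1 j.2,
    fun a K h => top_le_iff.1 ?_⟩
  rw [← (b a).span_eq]
  refine Submodule.span_le.2 ?_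
  rintro _ ⟨k, rfl⟩
  exact h ⟨a, k⟩ rfl

end Finiteness

section Vanishing

variable {R W : Type u} [Ring R] [Algebra ℂ R] [AddCommGroup W] [Module ℂ W]
  {𝒲 : ℤ → Submodule ℂ W} [DirectSum.Decomposition 𝒲]

/-- If generators of `R` modulo commutators and of `W` are among the products of Lie monomials,
then these span the Poisson envelope. -/
lemma mon_mem_prodGen {Γ : Type*} {deg : Γ → ℤ} {g : Γ → Env R 𝒲}
    (hg : ∀ x, g x ∈ PTot.Pl (abelGrading (lamGrading R 𝒲)) (deg x))
    (hR : ∀ r, envR 𝒲 r ∈ prodGen deg (fun _ _ => PTot.pbr) g 0 0)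
    (hW : ∀ a w, envW 𝒲 R a w ∈ prodGen deg (fun _ _ => PTot.pbr) g 0 a)
    (m : PMon (abelGrading (lamGrading R 𝒲))) :
    PTot.mon m ∈ prodGen deg (fun _ _ => PTot.pbr) g m.up m.low := by
  induction m with
  | of e a =>
    obtain ⟨x, hx⟩ := PTot.ofLam_surjective a
    change PTot.of e a ∈ _
    rw [← hx]
    exact ofLam_mem_of_closed 𝒲 (fun e => prodGen deg (fun _ _ => PTot.pbr) g 0 e) hR hW
      (fun e e' x y hx hy => prodGen_cast (mul_mem_prodGen hx hy) (add_zero _) rfl) x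
  | mul m m' h h' => rw [PTot.mon_mul]; exact mul_mem_prodGen h h'
  | br m m' h h' =>
    rw [PTot.mon_br]
    exact br_mem_prodGen (superLeibniz_PTot (abelGrading (lamGrading R 𝒲))) hg h h'

/-- Squares of homogeneous elements are central. -/
lemma PTot.mul_self_mem_center {A : Type u} [Ring A] [Algebra ℂ A] {𝒜 : ℤ → Submodule ℂ A}
    [SetLike.GradedMonoid 𝒜] {a : ℤ} {p : PTot 𝒜} (hp : p ∈ Pl 𝒜 a) :
    p * p ∈ Subalgebra.center ℂ (PTot 𝒜) := by
  rw [Subalgebra.mem_center_iff]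
  intro y
  induction y using PTot.induction with
  | h0 => simp
  | ha x y hx hy => rw [mul_add, add_mul, hx, hy]
  | hs c x hx => rw [mul_smul_comm, smul_mul_assoc, hx]
  | hm m =>
    have h := mul_comm_of_mem (mul_mem_Pl hp hp) (mon_mem_Pl m)
    rw [sgn_add_left, sgn_mul_self, one_smul] at h
    exact h.symm

end Vanishing

end NCPoisson

namespace NCPoisson

/-! ### Elements lying in all powers of the ideals of all characters -/

section Vanishing

variable {R W : Type u} [Ring R] [Algebra ℂ R] [AddCommGroup W] [Module ℂ W]
  {𝒲 : ℤ → Submodule ℂ W} [DirectSum.Decomposition 𝒲]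

/-- A character of `Z` restricts along `c` to a character of `R`, whose kernel maps into the kernel
of the former; so the hypothesis for all characters of `R` supplies the one of
`eq_zero_of_mem_ker_pow_smul`. -/
lemma eq_zero_of_mem_adic {Z : Type u} [CommRing Z] [Algebra ℂ Z] [Algebra.FiniteType ℂ Z]
    [Algebra Z (Env R 𝒲)] (c : R →ₐ[ℂ] Z) (hc : ∀ r, algebraMap Z (Env R 𝒲) (c r) = envR 𝒲 r)
    {K : Submodule Z (Env R 𝒲)} (hK : K.FG) {d : ℕ}
    (hKd : ∀ p ∈ PTot.Pu (abelGrading (lamGrading R 𝒲)) d, p ∈ K) {y : Env R 𝒲}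
    (hy : y ∈ PTot.Pu (abelGrading (lamGrading R 𝒲)) d)
    (h : ∀ (χ : R →ₐ[ℂ] ℂ) (N : ℕ), y ∈ PTot.adic (envR 𝒲) χ N) : y = 0 := by
  refine eq_zero_of_mem_ker_pow_smul hK (hKd y hy) fun χ N => ?_
  -- The powers `𝔪^N P` are formed in the whole envelope, while `K` contains only the part with `d`
  -- brackets; the projection, which is linear over `R`, connects the two.
  have key : ∀ p ∈ PTot.adic (envR 𝒲) (χ.comp c) N,
      PTot.proj (abelGrading (lamGrading R 𝒲)) d p ∈ RingHom.ker χ ^ N • K := by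
    clear hy h
    induction N with
    | zero =>
      intro p _
      rw [pow_zero, Ideal.one_eq_top, Submodule.top_smul]
      exact hKd _ (PTot.proj_mem d p)
    | succ N ih =>
      intro p hp
      induction hp using Submodule.span_induction with
      | zero => rw [map_zero]; exact Submodule.zero_mem _
      | add x y _ _ hx hy => rw [map_add]; exact Submodule.add_mem _ hx hy
      | smul z x _ hx =>
        have : z • PTot.proj (abelGrading (lamGrading R 𝒲)) d x =
            c (algebraMap ℂ R z) • PTot.proj (abelGrading (lamGrading R 𝒲)) d x := by
          rw [Algebra.smul_def (c _), hc, AlgHom.commutes, ← Algebra.smul_def]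
        rw [map_smul, this]
        exact Submodule.smul_mem _ _ hx
      | mem p hp =>
        obtain ⟨s, hs, p, hp, rfl⟩ := hp
        rw [PTot.proj_mul (envR_mem_Pu 𝒲 s), if_pos (Nat.zero_le d), Nat.sub_zero, ← hc,
          ← Algebra.smul_def, pow_succ', Submodule.mul_smul]
        exact Submodule.smul_mem_smul hs (ih p hp)
  have := key y (h _ N)
  rwa [PTot.proj_self hy] at this

/-- A finitely generated commutative algebra of central elements that contains the image of `R`
and the squares of finitely many homogeneous elements. -/
lemma IsSmooth.exists_central (hR : IsSmooth R) {Γ : Type*} [Finite Γ] {deg : Γ → ℤ}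
    {g : Γ → Env R 𝒲} (hg : ∀ x, g x ∈ PTot.Pl (abelGrading (lamGrading R 𝒲)) (deg x)) :
    ∃ (Z : Type u) (_ : CommRing Z) (_ : Algebra ℂ Z) (_ : Algebra.FiniteType ℂ Z)
      (φ : Z →ₐ[ℂ] Env R 𝒲) (c : R →ₐ[ℂ] Z), (∀ z p, φ z * p = p * φ z) ∧
      (∀ r, φ (c r) = envR 𝒲 r) ∧ ∀ x, ∃ z, φ z = g x * g x := by
  obtain ⟨t, ht⟩ := hR.exists_finset
  let C := Subalgebra.center ℂ (Env R 𝒲)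
  have hc : ∀ r, envR 𝒲 r ∈ C := fun r =>
    Subalgebra.mem_center_iff.2 fun b => (PTot.comm_of_mem_zero (envR_mem_Pl 𝒲 r) b).symm
  let c : R →ₐ[ℂ] C := (envR 𝒲).codRestrict C hc
  let sq : Γ → C := fun x => ⟨g x * g x, PTot.mul_self_mem_center (hg x)⟩
  let S : Set C := c '' (t : Set R) ∪ Set.range sq
  have hS : S.Finite := (t.finite_toSet.image c).union (Set.finite_range sq)
  -- The image of `R` is commutative, so commutators of `R` map to zero and generators modulo
  -- commutators suffice.
  have hcS : ∀ r, c r ∈ Algebra.adjoin ℂ S := fun r => by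
    obtain ⟨r', hr', h⟩ := ht r
    have h1 : envR 𝒲 (r - r') = 0 := map_eq_zero_of_commute (envR 𝒲)
      (fun r s => PTot.comm_of_mem_zero (envR_mem_Pl 𝒲 r) _) h
    have h2 : c r = c r' := Subtype.ext (by rwa [map_sub, sub_eq_zero] at h1)
    rw [h2]
    have h3 : c r' ∈ (Algebra.adjoin ℂ (t : Set R)).map c := ⟨r', hr', rfl⟩
    rw [← Algebra.adjoin_image] at h3
    exact Algebra.adjoin_mono Set.subset_union_left h3
  refine ⟨Algebra.adjoin ℂ S, inferInstance, inferInstance,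
    Algebra.FiniteType.adjoin_of_finite hS,
    C.val.comp (Algebra.adjoin ℂ S).val, c.codRestrict _ hcS,
    fun z p => (Subalgebra.mem_center_iff.1 z.1.2 p).symm, fun r => rfl, fun x =>
      ⟨⟨sq x, Algebra.subset_adjoin (Or.inr ⟨x, rfl⟩)⟩, rfl⟩⟩

/-- Generators of `R` modulo commutators and a homogeneous basis of `W` give finitely many elements
whose products of Lie monomials span the envelope. Including their squares in the central algebra
treats even and odd generators alike and makes the part with `d` brackets lie in a finitely
generated module. -/
theorem IsSmooth.eq_zero_of_mem_adic [FiniteDimensional ℂ W] (hR : IsSmooth R) {d : ℕ}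
    {y : Env R 𝒲} (hy : y ∈ PTot.Pu (abelGrading (lamGrading R 𝒲)) d)
    (h : ∀ (χ : R →ₐ[ℂ] ℂ) (N : ℕ), y ∈ PTot.adic (envR 𝒲) χ N) : y = 0 := by
  obtain ⟨t, ht⟩ := hR.exists_finset
  obtain ⟨J, _, dg, w, hw⟩ := exists_finite_homogeneous 𝒲
  let deg : (t : Set R) ⊕ J → ℤ := Sum.elim (fun _ => 0) dg
  let g : (t : Set R) ⊕ J → Env R 𝒲 := Sum.elim (fun r => envR 𝒲 r) fun j => envW 𝒲 R (dg j) (w j)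
  have hg : ∀ x, g x ∈ PTot.Pl (abelGrading (lamGrading R 𝒲)) (deg x) := fun x =>
    match x with
    | .inl r => envR_mem_Pl 𝒲 r.1
    | .inr j => PTot.ofLam_mem_Pl _
  have hgR : ∀ r, envR 𝒲 r ∈ prodGen deg (fun _ _ => PTot.pbr) g 0 0 := fun r => by
    obtain ⟨r', hr', h⟩ := ht r
    have h1 : envR 𝒲 (r - r') = 0 := map_eq_zero_of_commute (envR 𝒲)
      (fun r s => PTot.comm_of_mem_zero (envR_mem_Pl 𝒲 r) _) h
    rw [map_sub, sub_eq_zero] at h1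
    rw [h1]
    clear h1 h
    induction hr' using Algebra.adjoin_induction with
    | mem x hx => exact gen_mem_prodGen (deg := deg) (g := g) (.inl ⟨x, hx⟩)
    | algebraMap z =>
      rw [AlgHom.commutes, Algebra.algebraMap_eq_smul_one]
      exact Submodule.smul_mem _ _ one_mem_prodGen
    | add a b _ _ ha hb => rw [map_add]; exact Submodule.add_mem _ ha hb
    | mul a b _ _ ha hb =>
      rw [map_mul]
      exact prodGen_cast (mul_mem_prodGen ha hb) (add_zero _) (add_zero _)
  have hgW : ∀ a v, envW 𝒲 R a v ∈ prodGen deg (fun _ _ => PTot.pbr) g 0 a := fun a v => by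
    have h1 := hw a ((prodGen deg (fun _ _ => PTot.pbr) g 0 a).comap (envW 𝒲 R a)) fun j hj => by
      subst hj
      exact gen_mem_prodGen (deg := deg) (g := g) (.inr j)
    exact Submodule.eq_top_iff'.1 h1 v
  obtain ⟨Z, _, _, _, φ, c, hφ, hφc, hsq⟩ := hR.exists_central hg
  let _ : Algebra Z (Env R 𝒲) := φ.toRingHom.toAlgebra' hφ
  have : IsScalarTower ℂ Z (Env R 𝒲) := IsScalarTower.of_algebraMap_eq fun z =>
    (φ.commutes z).symm
  obtain ⟨K, hK, -, hMK⟩ := PTot.exists_fg_prodVal_mem (Z := Z) hg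
    (fun x => (hsq x).imp fun z hz => hz.symm) d
  refine NCPoisson.eq_zero_of_mem_adic c hφc hK (fun p hp => ?_) hy h
  have hle : ∀ e, prodGen deg (fun _ _ => PTot.pbr) g d e ≤ K.restrictScalars ℂ := fun e =>
    Submodule.span_le.2 fun _ ⟨M, hM, _, h⟩ => h ▸ hMK M hM
  have hle' : PTot.Pu (abelGrading (lamGrading R 𝒲)) d ≤ K.restrictScalars ℂ :=
    Submodule.span_le.2 fun _ ⟨m, hm, h⟩ => by
      rw [← h]
      have := mon_mem_prodGen hg hgR hgW m
      rw [hm] at this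
      exact hle _ this
  exact hle' hp

end Vanishing

end NCPoisson

theorem lemma3p4 {R : Type u} [Ring R] [Algebra ℂ R] (hR : NCPoisson.IsSmooth R)
    {W : Type u} [AddCommGroup W] [Module ℂ W] [FiniteDimensional ℂ W]
    (𝒲 : ℤ → Submodule ℂ W) [DirectSum.Decomposition 𝒲] :
    ∃! φ : NCPoisson.BigradedPoissonIso
        (NCPoisson.poissonEnvelope (NCPoisson.abelGrading (NCPoisson.lamGrading R 𝒲)))
        (NCPoisson.grPoisson (NCPoisson.lamGrading R 𝒲)),
      ∀ (e : ℤ) (x : NCPoisson.lamGrading R 𝒲 e),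
        φ.toEquiv 0 e (NCPoisson.envOf (NCPoisson.abelGrading (NCPoisson.lamGrading R 𝒲)) e
          (NCPoisson.abelMk (NCPoisson.lamGrading R 𝒲) e x)) =
        NCPoisson.grMk (NCPoisson.lamGrading R 𝒲) e x := by
  refine NCPoisson.existsUnique_iso_of_injective fun d e x hx h =>
    NCPoisson.PTot.mk_eq_zero.1 (hR.eq_zero_of_mem_adic (d := d) ?_ fun χ N =>
      hR.mk_mem_adic χ hx h N)
  have hle : NCPoisson.monSpan (NCPoisson.abelGrading (NCPoisson.lamGrading R 𝒲)) d e ≤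
      (NCPoisson.PTot.Pu (NCPoisson.abelGrading (NCPoisson.lamGrading R 𝒲)) d).comap
        (NCPoisson.PTot.mk _) := Submodule.span_le.2 fun _ ⟨m, hm, _, h⟩ =>
    h ▸ hm ▸ NCPoisson.PTot.mon_mem_Pu m
  exact hle hx
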